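/- Consider the rank-$5$ complex tensor model with fields $T_{\vec p},\bar T_{\vec p}$, where $\vec p\in\{-\Lambda,\dots,\Lambda\}^5\subset\mathbb Z^5$ and $\Lambda\in\mathbb N$ is an ultraviolet cutoff, with bare propagator $C(\vec p\,)=(Z_{-\infty}\vec p^{\,2}+m^2)^{-1}$ and quartic melonic interaction $$S_{int}=Z_\lambda\lambda_{41}^r\sum_{i=1}^5\ \sum_{\vec p_1,\vec p_2,\vec q_1,\vec q_2}\delta_{p_{1i}q_{2i}}\delta_{q_{1i}p_{2i}}\prod_{j\ne i}\delta_{p_{1j}q_{1j}}\delta_{p_{2j}q_{2j}}\;T_{\vec p_1}T_{\vec p_2}\bar T_{\vec q_1}\bar T_{\vec q_2}.$$ The theory is taken at $s=-\infty$, where the infrared regulator vanishes, and perturbatively: $\lambda_{41}^r$ is a formal variable and the counterterms $Z_\lambda,Z_{-\infty},m^2$ are formal power series in $\lambda_{41}^r$ with real coefficients. A connected Feynman graph with $V$ vertices and $L$ internal lines is melonic if its number of internal faces has the maximal value $F=4(L-V+1)$. Let $\Sigma_{-\infty}(\vec p\,)$ be the melonic self-energy, i.e. the sum of the amputated amplitudes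 of the one-particle irreducible (1PI) melonic two-point graphs, where an order-$n$ Wick contraction has weight $(-Z_\lambda\lambda_{41}^r)^n/n!$, the momenta of internal faces are summed over $\{-\Lambda,\dots,\Lambda\}$, and the momentum $\vec p\in\mathbb R^5$ carried by the external faces may be real. Put $$\Gamma^{(2)}_{-\infty}(\vec p\,)=Z_{-\infty}\vec p^{\,2}+m^2-\Sigma_{-\infty}(\vec p\,),\qquad G=1/\Gamma^{(2)}_{-\infty},\qquad \mathcal A_{-\infty}=\sum_{\vec q\in\{-\Lambda,\dots,\Lambda\}^5,\ q_1=0}G(\vec q\,)^2 ,$$ and let $\Gamma^{(4),1}_{-\infty}(0)$ be minus the sum, at zero external momenta and with the same weights, of the amputated 1PI melonic four-point graphs whose boundary graph is the quartic melonic bubble of colour $1$. Let $m_r^2>0$ be a real number. Suppose that the counterterms are such that the renormalization conditions $$\Gamma^{(4),1}_{-\infty}(0)=4\lambda_{41}^r,\qquad \Gamma^{(2)}_{-\infty}(\vec p\,)=m_r^2+\vec p^{\,2}+o(\vec p^{\,2})\quad(\vec p\to 0)$$ hold, the second one for each coefficient of the power series in $\lambda_{41}^r$. Then $$Z_\lambda=\frac{1}{1-2\lambda_{41}^r\mathcal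 A_{-\infty}},\qquad Z_{-\infty}=Z_\lambda,\qquad m^2=m_r^2+\Sigma_{-\infty}(\vec 0\,).$$ -/

import Mathlib

open scoped PowerSeries Topology
open Asymptotics

noncomputable section

namespace MelonicTGFT

/-! Feynman graphs of the complex rank-`d` tensor model with action
`∑ p, (Zwave * p² + massSq) T̄ p T p + (Zvert * lam) ∑ i, W i (T, T̄)`, where the quartic melonic
bubble of colour `i` is
`W i = ∑ δ(p₁ i, q₂ i) δ(q₁ i, p₂ i) ∏_{j ≠ i} δ(p₁ j, q₁ j) δ(p₂ j, q₂ j) T p₁ T p₂ T̄ q₁ T̄ q₂`.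
The renormalized coupling `lam` is the formal variable `X` of `ℝ⟦X⟧`. -/

/-- The bare data of the model, as formal power series in the renormalized coupling: the vertex
renormalization, the wave-function renormalization and the bare squared mass. -/
structure Counterterms where
  Zvert : ℝ⟦X⟧
  Zwave : ℝ⟦X⟧
  massSq : ℝ⟦X⟧

/-- The fields of one type (`T`, or `T̄`) of a graph with `n` quartic vertices and `E` external
points of each type: every vertex `v` has the two fields `(v, false)` and `(v, true)`. -/
abbrev Node (n E : ℕ) : Type := (Fin n × Bool) ⊕ Fin E

/-- A labelled Feynman graph: a colour for each vertex, and a Wick contraction which pairs the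
field `T x` with the field `T̄ (π x)`. -/
abbrev FeynmanGraph (d n E : ℕ) : Type := (Fin n → Fin d) × Equiv.Perm (Node n E)

namespace FeynmanGraph

variable {d n E : ℕ}

/-- The strands of colour `k` inside the vertices, from `T̄` fields to `T` fields: at a vertex of
colour `i` the fields `T̄ (v, b)` and `T (v, b)` share all colours but `i`, and `T̄ (v, b)` shares
the colour `i` with `T (v, !b)`. External points are left alone. -/
def strandFun (G : FeynmanGraph d n E) (k : Fin d) : Node n E → Node n E
  | Sum.inl (v, b) => Sum.inl (v, if G.1 v = k then !b else b)
  | Sum.inr a => Sum.inr a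

theorem strandFun_involutive (G : FeynmanGraph d n E) (k : Fin d) :
    Function.Involutive (G.strandFun k) := by
  rintro (⟨v, b⟩ | a)
  · by_cases h : G.1 v = k <;> simp [strandFun, h]
  · rfl

/-- One step along a strand of colour `k`: cross the propagator that starts at a `T` field, then
the vertex at its other end. The cycles that contain no external point are the closed faces of
colour `k`; the open faces of colour `k` are the arcs between external points. -/
def facePerm (G : FeynmanGraph d n E) (k : Fin d) : Equiv.Perm (Node n E) :=
  (G.strandFun_involutive k).toPerm * G.2

/-- All cycles (fixed points included) of the face permutation of colour `k`. -/
abbrev Cycle (G : FeynmanGraph d n E) (k : Fin d) : Type :=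
  Quotient (Equiv.Perm.SameCycle.setoid (G.facePerm k))

/-- The cycle of colour `k` that runs through the line starting at the field `T x`. -/
def cycleOf (G : FeynmanGraph d n E) (k : Fin d) (x : Node n E) : G.Cycle k :=
  Quotient.mk _ x

/-- The internal (closed) faces of colour `k`. -/
abbrev InternalFace (G : FeynmanGraph d n E) (k : Fin d) : Type :=
  {f : G.Cycle k // ∀ a : Fin E, f ≠ G.cycleOf k (Sum.inr a)}

/-- The internal lines: contractions of a `T` of a vertex with a `T̄` of a vertex. -/
abbrev InternalLine (G : FeynmanGraph d n E) : Type :=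
  {e : Fin n × Bool // (G.2 (Sum.inl e)).isLeft}

instance (G : FeynmanGraph d n E) (k : Fin d) : Finite (G.InternalFace k) :=
  inferInstance

instance (G : FeynmanGraph d n E) (k : Fin d) : Fintype (G.InternalFace k) :=
  Fintype.ofFinite _

/-- The graph on the vertices whose edges are the internal lines outside `S`. -/
def skeleton (G : FeynmanGraph d n E) (S : Set (Fin n × Bool)) : SimpleGraph (Fin n) :=
  SimpleGraph.fromRel fun v w =>
    ∃ b b' : Bool, (v, b) ∉ S ∧ G.2 (Sum.inl (v, b)) = Sum.inl (w, b')

/-- One-particle irreducible: every external point is hooked to a vertex, and the graph is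
connected and stays so when any internal line is cut. -/
def IsOnePI (G : FeynmanGraph d n E) : Prop :=
  (∀ a : Fin E, (G.2 (Sum.inr a)).isLeft) ∧ (G.skeleton ∅).Connected ∧
    ∀ e : G.InternalLine, (G.skeleton {e.1}).Connected

/-- Melonic: the number of internal faces has its maximal value `(d - 1) (L - V + 1)`. -/
def IsMelonic (G : FeynmanGraph d n E) : Prop :=
  ((∑ k, Fintype.card (G.InternalFace k) : ℕ) : ℤ)
    = ((d : ℤ) - 1) * ((Fintype.card G.InternalLine : ℤ) - (n : ℤ) + 1)

/-- The boundary graph of a four-point graph is the quartic melonic bubble of colour `i`. For each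
colour `k` the open faces pair the two external `T` with the two external `T̄` in one of the two
possible ways (the second one exactly when the external points lie on the same cycle); the
condition says that the pairing of colour `i` is the opposite of that of any other colour. -/
def HasBoundary (G : FeynmanGraph d n 2) (i : Fin d) : Prop :=
  ∀ k : Fin d, k ≠ i →
    ((G.facePerm k).SameCycle (Sum.inr 0) (Sum.inr 1) ↔
      ¬ (G.facePerm i).SameCycle (Sum.inr 0) (Sum.inr 1))

end FeynmanGraph

/-- The momenta that remain in each colour with the ultraviolet cutoff `Λ` (tensors of size
`2 Λ + 1`). -/
abbrev Momentum (Λ : ℕ) : Type := {x : ℤ // x ∈ Finset.Icc (-(Λ : ℤ)) (Λ : ℤ)}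

/-- The kinetic kernel `Zwave * q² + massSq`. -/
def kinetic {d : ℕ} (B : Counterterms) (q : Fin d → ℝ) : ℝ⟦X⟧ :=
  PowerSeries.C (∑ k, q k ^ 2) * B.Zwave + B.massSq

open Classical in
/-- Component `k` of the momentum of the line that starts at `T x`: the momentum of the face of
colour `k` through it. Internal faces carry the momenta `m`; open faces carry the external
momentum `p`, which is common to all external points. -/
def lineMomentum {d n E Λ : ℕ} (G : FeynmanGraph d n E) (p : Fin d → ℝ)
    (m : ∀ k, G.InternalFace k → Momentum Λ) (x : Node n E) (k : Fin d) : ℝ :=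
  if h : ∀ a : Fin E, G.cycleOf k x ≠ G.cycleOf k (Sum.inr a) then
    ((m k ⟨G.cycleOf k x, h⟩ : ℤ) : ℝ)
  else p k

open Classical in
/-- The amputated amplitude (without coupling constants): the product of the bare propagators of
the internal lines, summed over the momenta of the internal faces. -/
def amplitude {d n E : ℕ} (Λ : ℕ) (B : Counterterms) (G : FeynmanGraph d n E)
    (p : Fin d → ℝ) : ℝ⟦X⟧ :=
  ∑ m : (∀ k, G.InternalFace k → Momentum Λ),
    ∏ e : G.InternalLine, (kinetic B (lineMomentum G p m (Sum.inl e.1)))⁻¹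

open Classical in
/-- The order-`n` part of the perturbative expansion: `(-Zvert * lam) ^ n / n!` times the sum over
the 1PI melonic Wick contractions selected by `P`. -/
def melonicOrder {d E : ℕ} (Λ : ℕ) (B : Counterterms) (p : Fin d → ℝ) (n : ℕ)
    (P : FeynmanGraph d n E → Prop) : ℝ⟦X⟧ :=
  PowerSeries.C ((n.factorial : ℝ)⁻¹) * (-(B.Zvert * PowerSeries.X)) ^ n *
    ∑ G : FeynmanGraph d n E,
      if G.IsOnePI ∧ G.IsMelonic ∧ P G then amplitude Λ B G p else 0

/-- The sum over all orders. As `X ^ n` divides the order-`n` part, only the orders `n ≤ r`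
contribute to the coefficient of `X ^ r`. -/
def melonicSum {d E : ℕ} (Λ : ℕ) (B : Counterterms) (p : Fin d → ℝ)
    (P : ∀ n, FeynmanGraph d n E → Prop) : ℝ⟦X⟧ :=
  PowerSeries.mk fun r =>
    ∑ n ∈ Finset.range (r + 1), PowerSeries.coeff r (melonicOrder Λ B p n (P n))

/-- The melonic self-energy `Σ(p)`. -/
def selfEnergy {d : ℕ} (Λ : ℕ) (B : Counterterms) (p : Fin d → ℝ) : ℝ⟦X⟧ :=
  melonicSum (E := 1) Λ B p fun _ _ => True

/-- The melonic 1PI two-point function `Γ⁽²⁾(p) = Zwave * p² + massSq - Σ(p)`. -/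
def twoPoint {d : ℕ} (Λ : ℕ) (B : Counterterms) (p : Fin d → ℝ) : ℝ⟦X⟧ :=
  kinetic B p - selfEnergy Λ B p

/-- The effective propagator `G(p)`. -/
def effPropagator {d : ℕ} (Λ : ℕ) (B : Counterterms) (p : Fin d → ℝ) : ℝ⟦X⟧ :=
  (twoPoint Λ B p)⁻¹

/-- The melonic 1PI four-point function of colour `i`, all external momenta being equal to `p`
(the sign is that of the effective action, so that the leading term at `p = 0` is `4 * lam`). -/
def fourPoint {d : ℕ} (Λ : ℕ) (B : Counterterms) (i : Fin d) (p : Fin d → ℝ) : ℝ⟦X⟧ :=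
  - melonicSum (E := 2) Λ B p fun _ G => G.HasBoundary i

/-- The loop `𝒜 = ∑ G(q)²` over the momenta `q` with `q i = 0`. -/
def loopA {d : ℕ} (Λ : ℕ) (B : Counterterms) (i : Fin d) : ℝ⟦X⟧ :=
  ∑ q : Fin d → Momentum Λ,
    if (q i : ℤ) = 0 then effPropagator Λ B (fun k => ((q k : ℤ) : ℝ)) ^ 2 else 0

end MelonicTGFT

end

/-!
The melonic graphs are trees, and the renormalization conditions can be read off from the recursions
of these trees.

Call a cycle of the Wick contraction `π` a loop. Every vertex joins the two loops of its two fields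
(the intermediate field picture), and a face of colour `k` is a cycle of `π` composed with the
exchange of the two fields of each vertex of colour `k`. Inserting the vertices one at a time shows
that the number of faces is largest exactly when the vertices join the loops to a tree
(`sum_numClasses_le`, `isAcyclic_iff_sum_numClasses`). In a tree a line is not a bridge exactly when
all the lines of its loop are internal, so that one-particle irreducibility says that every external
point forms a loop with a single field of a vertex (`FeynmanGraph.isOnePI_and_isMelonic_iff`,
`FeynmanGraph.isOnePI_and_isMelonic_and_hasBoundary_iff`). For the four-point function there are two
ways to pair the external points, which have equal weights (`FeynmanGraph.exchange`).

The sums over labelled trees are evaluated by removing the vertex hooked to a root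
(`forestSum_root`): its other field becomes a new root, whose momentum agrees with that of the old
root in the colour of the vertex. The sum over the forests with `n` vertices and roots in `A` is
therefore `n!` times a coefficient of the product over `A` of the generating functions of a single
tree, as both sides satisfy the same recursion (`forestSum_eq_coeff`). For trees which carry the
second external point of a four-point graph, the recursion has one more term and its solution is a
geometric series of loops (`forestSum_isMarked_eq_coeff`, `sum_markedPropagator`).

Here the generating functions are power series, in a variable that counts the vertices, over the
power series in the coupling. Evaluation at `-(Zvert * lam)`, which is a ring homomorphism
(`evalHom`), turns them into the melonic Schwinger-Dyson equation (`selfEnergy_eq`)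
`Σ(p) = -2 Zvert lam ∑ j, ∑ q with q j = p j, G(q)` and into
`Γ⁽⁴⁾(0) * (1 + 2 Zvert lam 𝒜) = 4 Zvert lam` (`fourPoint_mul`). Since external momenta are real
whereas the momenta of closed faces are integers with a cutoff, the momenta of the trees are symbols
of an arbitrary finite type with a real value each.

The condition on `Γ⁽⁴⁾(0)` now gives `Zvert = 1 + 2 Zvert lam 𝒜`. As `Σ` is a sum of functions of
one component of the momentum, the difference `Δ(t)` between `Γ⁽²⁾` at momenta with component `t`
and with component `0` along a fixed axis does not depend on the other components
(`twoPoint_update_sub`). Writing the difference of two propagators as `-Δ(t) G G'`, dividing by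
`t²` and letting `t` tend to `0`, where `Δ(t) / t²` tends to `1`, gives `Zwave = 1 + 2 Zvert lam
𝒜` (`IsNormalized.Zwave_eq`), hence `Zwave = Zvert`. The limits are taken coefficientwise.
-/

open scoped PowerSeries Topology
open Asymptotics

noncomputable section

namespace MelonicTGFT

/-! ### Counting the classes of an equivalence relation -/

section Classes

variable {α : Type*}

/-- The number of classes of an equivalence relation. -/
def numClasses (r : Setoid α) : ℕ := Nat.card (Quotient r)

theorem numClasses_anti [Finite α] {r s : Setoid α} (h : r ≤ s) : numClasses s ≤ numClasses r :=
  Nat.card_le_card_of_surjective (Quotient.map' id fun _ _ hab => h hab) fun q => by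
    induction q using Quotient.inductionOn' with
    | h a => exact ⟨Quotient.mk'' a, rfl⟩

open Classical in
/-- The equivalence relation obtained from `r` by merging the classes of `a` and `b`. -/
def mergeClasses (r : Setoid α) (a b : α) : Setoid α :=
  Setoid.ker fun x => if r x b then Quotient.mk r a else Quotient.mk r x

theorem le_mergeClasses (r : Setoid α) (a b : α) : r ≤ mergeClasses r a b := by
  classical
  intro x y h
  have hb : r x b ↔ r y b := ⟨fun h' => r.trans (r.symm h) h', fun h' => r.trans h h'⟩
  have hq : (Quotient.mk r x) = Quotient.mk r y := Quotient.sound h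
  change (if r x b then Quotient.mk r a else Quotient.mk r x)
    = if r y b then Quotient.mk r a else Quotient.mk r y
  simp only [hb, hq]

theorem mergeClasses_rel (r : Setoid α) (a b : α) : mergeClasses r a b a b := by
  classical
  change (if r a b then Quotient.mk r a else Quotient.mk r a)
    = if r b b then Quotient.mk r a else Quotient.mk r b
  simp

theorem mergeClasses_iff {r : Setoid α} {a b x y : α} :
    mergeClasses r a b x y ↔ r x y ∨ (r x a ∧ r b y) ∨ (r x b ∧ r a y) := by
  constructor
  · classical
    intro hxy
    change (if r x b then Quotient.mk r a else Quotient.mk r x)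
      = (if r y b then Quotient.mk r a else Quotient.mk r y) at hxy
    split_ifs at hxy with h1 h2 h2
    · exact Or.inl (r.trans h1 (r.symm h2))
    · exact Or.inr (Or.inr ⟨h1, Quotient.exact hxy⟩)
    · exact Or.inr (Or.inl ⟨Quotient.exact hxy, r.symm h2⟩)
    · exact Or.inl (Quotient.exact hxy)
  · have hle := le_mergeClasses r a b
    have hab := mergeClasses_rel r a b
    rintro (h | ⟨h1, h2⟩ | ⟨h1, h2⟩)
    · exact hle h
    · exact (mergeClasses r a b).trans (hle h1) ((mergeClasses r a b).trans hab (hle h2))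
    · exact (mergeClasses r a b).trans (hle h1)
        ((mergeClasses r a b).trans ((mergeClasses r a b).symm hab) (hle h2))

theorem mergeClasses_le {r s : Setoid α} {a b : α} (h : r ≤ s) (hab : s a b) :
    mergeClasses r a b ≤ s := by
  intro x y hxy
  rcases mergeClasses_iff.1 hxy with h1 | ⟨h1, h2⟩ | ⟨h1, h2⟩
  · exact h h1
  · exact s.trans (h h1) (s.trans hab (h h2))
  · exact s.trans (h h1) (s.trans (s.symm hab) (h h2))

open Classical in
theorem numClasses_mergeClasses [Finite α] (r : Setoid α) {a b : α} (h : ¬ r a b) :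
    numClasses (mergeClasses r a b) + 1 = numClasses r := by
  have hf : Set.range (fun x => if r x b then Quotient.mk r a else Quotient.mk r x)
      = {Quotient.mk r b}ᶜ := by
    ext q
    induction q using Quotient.inductionOn' with
    | h x =>
      constructor
      · rintro ⟨y, hy⟩ hq
        rw [Set.mem_singleton_iff] at hq
        rw [hq] at hy
        dsimp only at hy
        split_ifs at hy with h1
        · exact h (Quotient.exact hy)
        · exact h1 (Quotient.exact hy)
      · intro hq
        refine ⟨x, ?_⟩
        have : ¬ r x b := fun h' => hq (Quotient.sound h')
        simp [this]
  have h1 : numClasses (mergeClasses r a b)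
      = Nat.card ↥({Quotient.mk r b}ᶜ : Set (Quotient r)) := by
    rw [← hf]
    exact Nat.card_congr (Setoid.quotientKerEquivRange _)
  have h2 := Set.ncard_add_ncard_compl ({Quotient.mk r b} : Set (Quotient r))
  rw [Set.ncard_singleton] at h2
  rw [h1, numClasses, ← h2, Nat.card_coe_set_eq, add_comm]

theorem numClasses_le_mergeClasses [Finite α] (r : Setoid α) (a b : α) :
    numClasses r ≤ numClasses (mergeClasses r a b) + 1 := by
  by_cases h : r a b
  · exact (numClasses_anti (mergeClasses_le le_rfl h)).trans (Nat.le_succ _)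
  · exact (numClasses_mergeClasses r h).ge

theorem numClasses_le_card [Finite α] {r : Setoid α} {B : Finset α}
    (hB : ∀ x, ∃ b ∈ B, r x b) : numClasses r ≤ B.card := by
  have := Nat.card_le_card_of_surjective (fun b : B => Quotient.mk r b.1) fun q => by
    induction q using Quotient.inductionOn' with
    | h a =>
      obtain ⟨b, hb, hab⟩ := hB a
      exact ⟨⟨b, hb⟩, Quotient.sound (r.symm hab)⟩
  simpa [numClasses] using this

/-- If every class meets `B` and there are at least as many classes as elements of `B`, then `B`
meets every class only once. -/
theorem eq_of_rel_of_card_le [Finite α] {r : Setoid α} {B : Finset α}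
    (hB : ∀ x, ∃ b ∈ B, r x b) (hc : B.card ≤ numClasses r) {a b : α} (ha : a ∈ B) (hb : b ∈ B)
    (hab : r a b) : a = b := by
  classical
  by_contra hne
  have h : ∀ x, ∃ c ∈ B.erase b, r x c := by
    intro x
    obtain ⟨c, hc, hxc⟩ := hB x
    by_cases hcb : c = b
    · subst hcb
      exact ⟨a, Finset.mem_erase.2 ⟨hne, ha⟩, r.trans hxc (r.symm hab)⟩
    · exact ⟨c, Finset.mem_erase.2 ⟨hcb, hc⟩, hxc⟩
  have h1 := numClasses_le_card h
  have h2 := Finset.card_erase_lt_of_mem hb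
  omega

end Classes

/-! ### Cycles of a permutation composed with a transposition -/

section Cycles

variable {α : Type*}

/-- An equivalence relation that contains all the steps `x, π x` contains the cycles of `π`. -/
theorem sameCycle_le {π : Equiv.Perm α} {r : Setoid α} (h : ∀ x, r x (π x)) :
    Equiv.Perm.SameCycle.setoid π ≤ r := by
  rintro x y ⟨j, rfl⟩
  induction j using Int.induction_on with
  | zero => exact r.refl _
  | succ j ih =>
    refine r.trans ih ?_
    rw [add_comm, zpow_add, zpow_one]
    exact h _
  | pred j ih =>
    refine r.trans ih (r.symm ?_)
    have := h ((π ^ (-(j : ℤ) - 1)) x)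
    rwa [← Equiv.Perm.mul_apply, ← zpow_one_add,
      show (1 + (-(j : ℤ) - 1)) = -(j : ℤ) by ring] at this

theorem sameCycle_step (π : Equiv.Perm α) (x : α) : Equiv.Perm.SameCycle.setoid π x (π x) :=
  ⟨1, by simp⟩

variable [DecidableEq α]

theorem sameCycle_swap_mul_le {π : Equiv.Perm α} {r : Setoid α} {a b : α}
    (h : Equiv.Perm.SameCycle.setoid π ≤ r) (hab : r a b) :
    Equiv.Perm.SameCycle.setoid (Equiv.swap a b * π) ≤ r := by
  refine sameCycle_le fun x => ?_
  refine r.trans (h (sameCycle_step π x)) ?_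
  rw [Equiv.Perm.mul_apply]
  generalize π x = y
  by_cases h1 : y = a
  · subst h1; rwa [Equiv.swap_apply_left]
  by_cases h2 : y = b
  · subst h2; rw [Equiv.swap_apply_right]; exact r.symm hab
  rw [Equiv.swap_apply_of_ne_of_ne h1 h2]

theorem le_sameCycle_swap_mul {π : Equiv.Perm α} {r : Setoid α} {a b : α}
    (h : Equiv.Perm.SameCycle.setoid (Equiv.swap a b * π) ≤ r) (hab : r a b) :
    Equiv.Perm.SameCycle.setoid π ≤ r := by
  have := sameCycle_swap_mul_le h hab
  rwa [← mul_assoc, Equiv.swap_mul_self, one_mul] at this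

/-- A transposition of two points of different cycles joins the two cycles. -/
theorem sameCycle_swap_mul_of_not [Finite α] {π : Equiv.Perm α} {a b : α}
    (h : ¬ π.SameCycle a b) : (Equiv.swap a b * π).SameCycle a b := by
  have hex : ∃ j, (π ^ (j + 1)) a = a :=
    ⟨orderOf π - 1, by rw [Nat.sub_add_cancel (orderOf_pos π), pow_orderOf_eq_one]; rfl⟩
  classical
  have key : ∀ j ≤ Nat.find hex, ((Equiv.swap a b * π) ^ j) a = (π ^ j) a := by
    intro j
    induction j with
    | zero => simp
    | succ j ih =>
      intro hj
      rw [pow_succ', Equiv.Perm.mul_apply, ih (by omega), Equiv.Perm.mul_apply, pow_succ' π,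
        Equiv.Perm.mul_apply]
      refine Equiv.swap_apply_of_ne_of_ne ?_ ?_
      · have := Nat.find_min hex (Nat.lt_of_succ_le hj)
        rwa [pow_succ', Equiv.Perm.mul_apply] at this
      · intro hb
        exact h ⟨(j + 1 : ℕ), by rw [zpow_natCast, pow_succ', Equiv.Perm.mul_apply, hb]⟩
  refine ⟨((Nat.find hex) + 1 : ℕ), ?_⟩
  rw [zpow_natCast, pow_succ', Equiv.Perm.mul_apply, key _ le_rfl, Equiv.Perm.mul_apply,
    ← Equiv.Perm.mul_apply π, ← pow_succ', Nat.find_spec hex, Equiv.swap_apply_left]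

theorem sameCycle_swap_mul_eq [Finite α] {π : Equiv.Perm α} {a b : α}
    (h : ¬ π.SameCycle a b) : Equiv.Perm.SameCycle.setoid (Equiv.swap a b * π)
      = mergeClasses (Equiv.Perm.SameCycle.setoid π) a b :=
  le_antisymm (sameCycle_swap_mul_le (le_mergeClasses _ _ _) (mergeClasses_rel _ _ _))
    (mergeClasses_le (le_sameCycle_swap_mul le_rfl (sameCycle_swap_mul_of_not h))
      (sameCycle_swap_mul_of_not h))

theorem numClasses_swap_mul_le [Finite α] (π : Equiv.Perm α) (a b : α) :
    numClasses (Equiv.Perm.SameCycle.setoid (Equiv.swap a b * π))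
      ≤ numClasses (Equiv.Perm.SameCycle.setoid π) + 1 :=
  (numClasses_le_mergeClasses _ a b).trans (Nat.succ_le_succ (numClasses_anti
    (le_sameCycle_swap_mul (le_mergeClasses _ _ _) (mergeClasses_rel _ _ _))))

/-- A transposition of two points of the same cycle separates them. -/
theorem not_sameCycle_swap_mul [Finite α] {π : Equiv.Perm α} {a b : α} (hne : a ≠ b)
    (h : π.SameCycle a b) : ¬ (Equiv.swap a b * π).SameCycle a b := by
  have hex : ∃ j, (π ^ j) a = b := by
    obtain ⟨j, -, hj⟩ := h.exists_pow_eq'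
    exact ⟨j, hj⟩
  classical
  set m := Nat.find hex with hm
  have hm0 : m ≠ 0 := by
    intro h0
    have := Nat.find_spec hex
    rw [← hm, h0] at this
    exact hne this
  have hlt : ∀ j < m, (π ^ j) a ≠ b := fun j hj => Nat.find_min hex hj
  -- up to the first visit of `b` the path from `a` never returns to `a`
  have hret : ∀ j < m, j ≠ 0 → (π ^ j) a ≠ a := by
    intro j hj hj0 hja
    refine hlt (m - j) (by omega) ?_
    have := Nat.find_spec hex
    rw [← hm, show m = (m - j) + j by omega, pow_add, Equiv.Perm.mul_apply, hja] at this
    exact this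
  let s : Set α := {x | ∃ j < m, x = (π ^ j) a}
  have hs : ∀ x ∈ s, (Equiv.swap a b * π) x ∈ s := by
    rintro x ⟨j, hj, rfl⟩
    rw [Equiv.Perm.mul_apply, ← Equiv.Perm.mul_apply π, ← pow_succ']
    by_cases hjm : j + 1 = m
    · rw [hjm, Nat.find_spec hex, Equiv.swap_apply_right]
      exact ⟨0, Nat.pos_of_ne_zero hm0, rfl⟩
    · rw [Equiv.swap_apply_of_ne_of_ne (hret _ (by omega) (by omega)) (hlt _ (by omega))]
      exact ⟨j + 1, by omega, rfl⟩
  intro hsame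
  obtain ⟨j, -, hj⟩ := hsame.exists_pow_eq'
  have hall : ∀ j, ((Equiv.swap a b * π) ^ j) a ∈ s := by
    intro j
    induction j with
    | zero => exact ⟨0, Nat.pos_of_ne_zero hm0, rfl⟩
    | succ j ih => rw [pow_succ', Equiv.Perm.mul_apply]; exact hs _ ih
  obtain ⟨l, hl, hbl⟩ := hall j
  rw [hj] at hbl
  exact hlt l hl hbl.symm

end Cycles

/-! ### Forests of cycles -/

section Forest

variable {n E : ℕ}

/-- The two fields of one type of each of the vertices in `S`. -/
def body (S : Finset (Fin n)) : Finset (Node n E) :=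
  (S ×ˢ Finset.univ).map Function.Embedding.inl

@[simp] theorem inl_mem_body {S : Finset (Fin n)} {v : Fin n} {b : Bool} :
    (Sum.inl (v, b) : Node n E) ∈ body S ↔ v ∈ S := by
  simp [body]

@[simp] theorem inr_notMem_body {S : Finset (Fin n)} {a : Fin E} :
    (Sum.inr a : Node n E) ∉ body S := by
  simp [body]

theorem mem_body {S : Finset (Fin n)} {x : Node n E} :
    x ∈ body S ↔ ∃ v ∈ S, ∃ b, x = Sum.inl (v, b) := by
  rcases x with ⟨v, b⟩ | a <;> simp

theorem card_body (S : Finset (Fin n)) : (body S : Finset (Node n E)).card = 2 * S.card := by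
  simp [body, mul_comm]

/-- The equivalence relation on the fields of type `T` generated by the contraction `π` (whose
cycles are the loops of the intermediate field) and by the vertices in `T`, each of which links
its two fields. -/
def conn (π : Equiv.Perm (Node n E)) (T : Finset (Fin n)) : Setoid (Node n E) :=
  Relation.EqvGen.setoid fun x y =>
    y = π x ∨ ∃ v ∈ T, x = Sum.inl (v, false) ∧ y = Sum.inl (v, true)

variable {π : Equiv.Perm (Node n E)} {T T' S : Finset (Fin n)}

theorem conn_le {r : Setoid (Node n E)} (h : ∀ x, r x (π x))
    (h' : ∀ v ∈ T, r (Sum.inl (v, false)) (Sum.inl (v, true))) : conn π T ≤ r := by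
  refine Setoid.eqvGen_le ?_
  rintro x y (rfl | ⟨v, hv, rfl, rfl⟩)
  · exact h x
  · exact h' v hv

theorem conn_step (π : Equiv.Perm (Node n E)) (T : Finset (Fin n)) (x : Node n E) :
    conn π T x (π x) :=
  Relation.EqvGen.rel _ _ (Or.inl rfl)

theorem conn_link {v : Fin n} (hv : v ∈ T) (b b' : Bool) :
    conn π T (Sum.inl (v, b)) (Sum.inl (v, b')) := by
  have h : conn π T (Sum.inl (v, false)) (Sum.inl (v, true)) :=
    Relation.EqvGen.rel _ _ (Or.inr ⟨v, hv, rfl, rfl⟩)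
  cases b <;> cases b'
  · exact (conn π T).refl _
  · exact h
  · exact (conn π T).symm h
  · exact (conn π T).refl _

theorem conn_mono (h : T ⊆ T') : conn π T ≤ conn π T' :=
  conn_le (conn_step π T') fun _ hv => conn_link (h hv) _ _

theorem conn_insert (v : Fin n) : conn π (insert v T)
    = mergeClasses (conn π T) (Sum.inl (v, false)) (Sum.inl (v, true)) := by
  refine le_antisymm (conn_le (fun x => le_mergeClasses _ _ _ (conn_step π T x)) ?_)
    (mergeClasses_le (conn_mono (Finset.subset_insert _ _))
      (conn_link (Finset.mem_insert_self _ _) _ _))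
  intro w hw
  rcases Finset.mem_insert.1 hw with rfl | hw
  · exact mergeClasses_rel _ _ _
  · exact le_mergeClasses _ _ _ (conn_link hw _ _)

theorem conn_empty (π : Equiv.Perm (Node n E)) : conn π ∅ = Equiv.Perm.SameCycle.setoid π :=
  le_antisymm (conn_le (sameCycle_step π) (by simp)) (sameCycle_le (conn_step π ∅))

theorem numClasses_conn_empty_le (π : Equiv.Perm (Node n E)) (T : Finset (Fin n)) :
    numClasses (conn π ∅) ≤ numClasses (conn π T) + T.card := by
  induction T using Finset.induction_on with
  | empty => simp
  | insert v T hv ih =>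
    rw [Finset.card_insert_of_notMem hv, conn_insert]
    have := numClasses_le_mergeClasses (conn π T) (Sum.inl (v, false)) (Sum.inl (v, true))
    omega

/-- A fixed point of the contraction that belongs to no vertex of `T` is isolated. -/
theorem eq_of_conn_of_fixed {x y : Node n E} (hx : π x = x) (hT : x ∉ body T)
    (h : conn π T x y) : y = x := by
  have hle : conn π T ≤ Setoid.ker (fun z => z = x) := by
    refine conn_le (fun z => ?_) fun v hv => ?_
    · change (z = x) = (π z = x)
      refine propext ⟨fun h => h ▸ hx, fun h => π.injective (h.trans hx.symm)⟩
    · change (_ = x) = (_ = x)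
      refine propext ⟨?_, ?_⟩ <;> rintro rfl <;> simp [hv] at hT
  have h2 : (x = x) = (y = x) := hle h
  exact h2 ▸ rfl

section Peel

variable {a x₁ : Node n E}

theorem peel_apply_left (π : Equiv.Perm (Node n E)) (a x₁ : Node n E) :
    (π * Equiv.swap a x₁) a = π x₁ := by simp

theorem peel_apply_right (π : Equiv.Perm (Node n E)) (a x₁ : Node n E) :
    (π * Equiv.swap a x₁) x₁ = π a := by simp

theorem peel_apply_of_ne (π : Equiv.Perm (Node n E)) {a x₁ z : Node n E} (h : z ≠ a)
    (h' : z ≠ x₁) : (π * Equiv.swap a x₁) z = π z := by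
  rw [Equiv.Perm.mul_apply, Equiv.swap_apply_of_ne_of_ne h h']

theorem conn_peel_le (ha : π a = x₁) (h : T' ⊆ T) :
    conn (π * Equiv.swap a x₁) T' ≤ conn π T := by
  refine conn_le (fun z => ?_) fun v hv => conn_link (h hv) _ _
  by_cases h1 : z = a
  · subst h1
    rw [peel_apply_left]
    refine (conn π T).trans ?_ (conn_step π T x₁)
    rw [← ha]; exact conn_step π T z
  by_cases h2 : z = x₁
  · subst h2
    rw [peel_apply_right, ha]
  · rw [peel_apply_of_ne _ h1 h2]; exact conn_step π T z

theorem conn_le_of_peel {r : Setoid (Node n E)} (ha : π a = x₁)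
    (h : conn (π * Equiv.swap a x₁) T' ≤ r) (hr : r a x₁)
    (hT : ∀ v ∈ T, v ∉ T' → r (Sum.inl (v, false)) (Sum.inl (v, true))) : conn π T ≤ r := by
  refine conn_le (fun z => ?_) fun v hv => ?_
  · by_cases h1 : z = a
    · subst h1; rwa [ha]
    by_cases h2 : z = x₁
    · subst h2
      have := h (conn_step (π * Equiv.swap a z) T' a)
      rw [peel_apply_left] at this
      exact r.trans (r.symm hr) this
    · have := h (conn_step (π * Equiv.swap a x₁) T' z)
      rwa [peel_apply_of_ne _ h1 h2] at this
  · by_cases hv' : v ∈ T'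
    · exact h (conn_link hv' _ _)
    · exact hT v hv hv'

/-- The classes before the field `π a` of the vertex `v` is cut out of its cycle, in terms of the
classes afterwards. -/
theorem rel_of_conn_of_peel {v : Fin n} {b : Bool} (ha : π a = Sum.inl (v, b))
    (hne : a ≠ Sum.inl (v, b)) {r : Setoid (Node n E)}
    (hr : conn (π * Equiv.swap a (Sum.inl (v, b))) (T.erase v) ≤ r)
    (hT : v ∈ T → r a (Sum.inl (v, !b))) {x z : Node n E} (hx : x ≠ Sum.inl (v, b))
    (hz : z ≠ Sum.inl (v, b)) (h : conn π T x z) : r x z := by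
  classical
  -- the removed field is identified with `a`
  have hle : conn π T ≤ r.comap fun z => if z = Sum.inl (v, b) then a else z := by
    refine conn_le_of_peel (T' := T.erase v) ha (conn_le (fun z => ?_) fun w hw => ?_) ?_ ?_
    · rw [Setoid.comap_rel]
      by_cases h2 : z = Sum.inl (v, b)
      · subst h2
        rw [peel_apply_right, ha]
      · have h3 : (π * Equiv.swap a (Sum.inl (v, b))) z ≠ Sum.inl (v, b) := fun h3 => h2 <|
          (π * Equiv.swap a (Sum.inl (v, b))).injective (h3.trans (by rw [peel_apply_right, ha]))
        rw [if_neg h2, if_neg h3]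
        exact hr (conn_step _ _ _)
    · have hwv := (Finset.mem_erase.1 hw).1
      rw [Setoid.comap_rel, if_neg (by simp [hwv]), if_neg (by simp [hwv])]
      exact hr (conn_link hw _ _)
    · rw [Setoid.comap_rel, if_pos rfl, if_neg hne]
    · intro w hw hw'
      have hwv : w = v := by
        by_contra h
        exact hw' (Finset.mem_erase.2 ⟨h, hw⟩)
      subst hwv
      rw [Setoid.comap_rel]
      cases b
      · simpa using hT hw
      · simpa using r.symm (hT hw)
  simpa [Setoid.comap_rel, hx, hz] using hle h

/-- Cutting `π a` out of its cycle creates one more cycle. -/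
theorem numClasses_peel (ha : π a = x₁) (hne : x₁ ≠ a) :
    numClasses (conn (π * Equiv.swap a x₁) ∅) = numClasses (conn π ∅) + 1 := by
  have hn : ¬ conn (π * Equiv.swap a x₁) ∅ a x₁ := fun h =>
    hne (eq_of_conn_of_fixed (π := π * Equiv.swap a x₁) (T := ∅)
      (by rw [peel_apply_right, ha]) (by simp [body])
      ((conn (π * Equiv.swap a x₁) ∅).symm h)).symm
  rw [← numClasses_mergeClasses _ hn]
  congr 2
  refine le_antisymm (mergeClasses_le (conn_peel_le ha le_rfl) ?_)
    (conn_le_of_peel ha (le_mergeClasses _ _ _) (mergeClasses_rel _ _ _) (by simp))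
  rw [← ha]; exact conn_step π ∅ a

end Peel

/-- The cycles of the contraction `π`, joined by the vertices in `S`, form a forest with one tree
for each root in `A`; the additional points in `Y` may lie on any of the trees. Acyclicity is
expressed by the number of cycles, in which each of the remaining nodes counts as a fixed point. -/
structure IsForest (S : Finset (Fin n)) (A Y : Finset (Node n E)) (π : Equiv.Perm (Node n E)) :
    Prop where
  fix : ∀ x, x ∉ A → x ∉ Y → x ∉ body S → π x = x
  reach : ∀ x, x ∈ body S ∨ x ∈ Y → ∃ a ∈ A, conn π S x a
  count : numClasses (conn π ∅) + S.card + Y.card = Fintype.card (Node n E)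

variable {A Y : Finset (Node n E)}

/-- The roots, the additional points and the fields of the vertices in `S` are all different. -/
structure Separated (S : Finset (Fin n)) (A Y : Finset (Node n E)) : Prop where
  root : ∀ a ∈ A, a ∉ body S
  mark : ∀ y ∈ Y, y ∉ A ∧ y ∉ body S

theorem Separated.peel (hs : Separated S A Y) {v : Fin n} (hv : v ∈ S) (b : Bool) :
    Separated (S.erase v) (insert (Sum.inl (v, b)) A) Y where
  root x hx := by
    rcases Finset.mem_insert.1 hx with rfl | hx
    · simp
    · intro h
      obtain ⟨w, hw, b', rfl⟩ := mem_body.1 h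
      exact hs.root _ hx (by simpa using Finset.mem_of_mem_erase hw)
  mark y hy := by
    refine ⟨fun h => ?_, fun h => ?_⟩
    · rcases Finset.mem_insert.1 h with rfl | h
      · exact (hs.mark _ hy).2 (by simpa using hv)
      · exact (hs.mark _ hy).1 h
    · obtain ⟨w, hw, b', rfl⟩ := mem_body.1 h
      exact (hs.mark _ hy).2 (by simpa using Finset.mem_of_mem_erase hw)

theorem Separated.erase (hs : Separated S A Y) (a : Node n E) : Separated S (A.erase a) Y where
  root x hx := hs.root x (Finset.mem_of_mem_erase hx)
  mark y hy := ⟨fun h => (hs.mark y hy).1 (Finset.mem_of_mem_erase h), (hs.mark y hy).2⟩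

/-- The roots lie on different trees. -/
theorem IsForest.eq_of_conn (hf : IsForest S A Y π) (hs : Separated S A Y) {a a' : Node n E}
    (ha : a ∈ A) (ha' : a' ∈ A) (h : conn π S a a') : a = a' := by
  have hd : Disjoint (body S) Y := Finset.disjoint_right.2 fun y hy => (hs.mark y hy).2
  have hsub : ∀ a ∈ A, a ∈ (body S ∪ Y)ᶜ := by
    intro a ha
    rw [Finset.mem_compl, Finset.mem_union, not_or]
    exact ⟨hs.root a ha, fun hy => (hs.mark a hy).1 ha⟩
  refine eq_of_rel_of_card_le (B := (body S ∪ Y)ᶜ) (fun x => ?_) ?_ (hsub a ha) (hsub a' ha') h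
  · by_cases hx : x ∈ (body S ∪ Y)ᶜ
    · exact ⟨x, hx, (conn π S).refl x⟩
    · obtain ⟨b, hb, hxb⟩ := hf.reach x (by simpa [or_iff_not_imp_left] using hx)
      exact ⟨b, hsub b hb, hxb⟩
  · rw [Finset.card_compl, Finset.card_union_of_disjoint hd, card_body]
    have h1 := numClasses_conn_empty_le π S
    have h2 := hf.count
    omega

/-- A root that is contracted with itself is a tree of its own. -/
theorem isForest_and_fixed_iff (hs : Separated S A Y) {a : Node n E} (ha : a ∈ A) :
    IsForest S A Y π ∧ π a = a ↔ IsForest S (A.erase a) Y π := by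
  constructor
  · rintro ⟨hf, hfix⟩
    refine ⟨fun x hx hy hb => ?_, fun x hx => ?_, hf.count⟩
    · by_cases hxa : x = a
      · rw [hxa, hfix]
      · exact hf.fix x (fun h => hx (Finset.mem_erase.2 ⟨hxa, h⟩)) hy hb
    · obtain ⟨a', ha', hxa'⟩ := hf.reach x hx
      refine ⟨a', Finset.mem_erase.2 ⟨?_, ha'⟩, hxa'⟩
      rintro rfl
      have := eq_of_conn_of_fixed hfix (hs.root _ ha) ((conn π S).symm hxa')
      subst this
      rcases hx with hx | hx
      · exact hs.root _ ha hx
      · exact (hs.mark _ hx).1 ha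
  · intro hf
    refine ⟨⟨fun x hx hy hb => hf.fix x (fun h => hx (Finset.mem_of_mem_erase h)) hy hb,
      fun x hx => ?_, hf.count⟩, hf.fix a (by simp) (fun hy => (hs.mark a hy).1 ha) (hs.root a ha)⟩
    obtain ⟨a', ha', hxa'⟩ := hf.reach x hx
    exact ⟨a', Finset.mem_of_mem_erase ha', hxa'⟩

/-- Removing the vertex that is hooked to the root `a` turns its other field into a root. -/
theorem isForest_and_root_iff (hs : Separated S A Y) {a : Node n E} (ha : a ∈ A) {v : Fin n}
    (hv : v ∈ S) (b : Bool) :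
    IsForest S A Y π ∧ π a = Sum.inl (v, b) ↔
      IsForest (S.erase v) (insert (Sum.inl (v, !b)) A) Y
        (π * Equiv.swap a (Sum.inl (v, b))) := by
  have hvS : (Sum.inl (v, b) : Node n E) ∈ body S := by simpa using hv
  have hne : (Sum.inl (v, b) : Node n E) ≠ a := fun h => hs.root a ha (h ▸ hvS)
  have hcard := Finset.card_erase_add_one hv
  set π' := π * Equiv.swap a (Sum.inl (v, b)) with hπ'
  have hx₁ : (Sum.inl (v, b) : Node n E) ∉ insert (Sum.inl (v, !b)) A := by
    simp only [Finset.mem_insert, not_or]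
    exact ⟨by simp, fun h => hs.root _ h hvS⟩
  have hbody : ∀ x : Node n E, x ∈ body S → x = Sum.inl (v, b) ∨ x = Sum.inl (v, !b) ∨
      x ∈ body (S.erase v) := by
    rintro x hx
    obtain ⟨w, hw, b', rfl⟩ := mem_body.1 hx
    by_cases hwv : w = v
    · subst hwv
      cases b <;> cases b' <;> simp
    · right; right; simp [hwv, hw]
  constructor
  · rintro ⟨hf, hroot⟩
    have hfix₁ : π' (Sum.inl (v, b)) = Sum.inl (v, b) := by rw [hπ', peel_apply_right, hroot]
    refine ⟨fun x hx hy hb => ?_, fun x hx => ?_, ?_⟩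
    · by_cases h1 : x = Sum.inl (v, b)
      · rw [h1, hfix₁]
      · have h2 : x ≠ a := fun h => hx (by simp [h, ha])
        rw [hπ', peel_apply_of_ne _ h2 h1]
        refine hf.fix x (fun h => hx (Finset.mem_insert_of_mem h)) hy fun h => ?_
        rcases hbody x h with h | h | h
        · exact h1 h
        · exact hx (by simp [h])
        · exact hb h
    · obtain ⟨a', ha', hxa'⟩ := hf.reach x (hx.imp_left fun h => by
        obtain ⟨w, hw, b', rfl⟩ := mem_body.1 h
        simpa using Finset.mem_of_mem_erase hw)
      -- reaching a root, or the isolated node `inl (v, b)`, is invariant under all steps of `π`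
      let Q : Node n E → Prop := fun z =>
        ∃ a' ∈ insert (Sum.inl (v, b)) (insert (Sum.inl (v, !b)) A), conn π' (S.erase v) z a'
      have hQ : ∀ z ∈ insert (Sum.inl (v, b)) (insert (Sum.inl (v, !b)) A), Q z :=
        fun z hz => ⟨z, hz, (conn π' (S.erase v)).refl z⟩
      have hle : conn π S ≤ Setoid.ker Q := by
        refine conn_le_of_peel (T' := S.erase v) hroot ?_ ?_ ?_
        · intro z w hzw
          exact propext ⟨fun ⟨a', h, h'⟩ => ⟨a', h, (conn π' _).trans ((conn π' _).symm hzw) h'⟩,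
            fun ⟨a', h, h'⟩ => ⟨a', h, (conn π' _).trans hzw h'⟩⟩
        · exact propext (iff_of_true (hQ _ (by simp [ha])) (hQ _ (by simp)))
        · intro w hw hw'
          have : w = v := by
            by_contra h
            exact hw' (Finset.mem_erase.2 ⟨h, hw⟩)
          subst this
          exact propext (iff_of_true (hQ _ (by cases b <;> simp)) (hQ _ (by cases b <;> simp)))
      have hQx : Q x := (show Q x = Q a' from hle hxa').mpr (hQ a' (by simp [ha']))
      obtain ⟨a'', ha'', h''⟩ := hQx
      rcases Finset.mem_insert.1 ha'' with rfl | ha''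
      · have := eq_of_conn_of_fixed hfix₁ (by simp) ((conn π' _).symm h'')
        subst this
        rcases hx with hx | hx
        · simp at hx
        · exact absurd hvS (hs.mark _ hx).2
      · exact ⟨a'', ha'', h''⟩
    · rw [numClasses_peel hroot hne]
      have := hf.count
      omega
  · intro hf
    have hroot : π a = Sum.inl (v, b) := by
      have := hf.fix _ hx₁ (fun h => (hs.mark _ h).2 hvS) (by simp)
      rwa [hπ', peel_apply_right] at this
    refine ⟨⟨fun x hx hy hb => ?_, fun x hx => ?_, ?_⟩, hroot⟩
    · have h1 : x ≠ a := fun h => hx (h ▸ ha)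
      have h2 : x ≠ Sum.inl (v, b) := fun h => hb (h ▸ hvS)
      rw [← peel_apply_of_ne π h1 h2]
      refine hf.fix x ?_ hy ?_
      · simp only [Finset.mem_insert, not_or]
        exact ⟨fun h => hb (by rw [h]; simpa using hv), hx⟩
      · intro h
        obtain ⟨w, hw, b', rfl⟩ := mem_body.1 h
        exact hb (by simpa using Finset.mem_of_mem_erase hw)
    · have hxa : conn π S (Sum.inl (v, b)) a := by
        rw [← hroot]; exact (conn π S).symm (conn_step π S a)
      have hstar : ∀ b', conn π S (Sum.inl (v, b')) a := fun b' =>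
        (conn π S).trans (conn_link hv b' b) hxa
      have hcase : x ∈ body (S.erase v) ∨ x ∈ Y → ∃ a ∈ A, conn π S x a := by
        intro hx
        obtain ⟨a', ha', h⟩ := hf.reach x hx
        have h' := conn_peel_le hroot (Finset.erase_subset v S) h
        rcases Finset.mem_insert.1 ha' with rfl | ha'
        · exact ⟨a, ha, (conn π S).trans h' (hstar _)⟩
        · exact ⟨a', ha', h'⟩
      rcases hx with hx | hx
      · rcases hbody x hx with rfl | rfl | hx
        · exact ⟨a, ha, hxa⟩
        · exact ⟨a, ha, hstar _⟩
        · exact hcase (Or.inl hx)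
      · exact hcase (Or.inr hx)
    · have h1 := hf.count
      rw [numClasses_peel hroot hne] at h1
      omega

end Forest

/-! ### Sums over labelled forests -/

section ForestSum

variable {d n E : ℕ} {R K : Type*}

/-- The vertices of colour `k` in `S`. -/
def colorClass (c : Fin n → Fin d) (S : Finset (Fin n)) (k : Fin d) : Finset (Fin n) :=
  S.filter fun v => c v = k

@[simp] theorem mem_colorClass {c : Fin n → Fin d} {S : Finset (Fin n)} {k : Fin d} {v : Fin n} :
    v ∈ colorClass c S k ↔ v ∈ S ∧ c v = k := by
  simp [colorClass]

theorem colorClass_subset (c : Fin n → Fin d) (S : Finset (Fin n)) (k : Fin d) :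
    colorClass c S k ⊆ S :=
  Finset.filter_subset _ _

/-- A colouring `c` and an assignment `μ` of momenta to the lines, with prescribed values `c₀` and
`p` outside of `S`, such that momenta are conserved along the loops of `π` (which is the
conservation along all the strands of a propagator and along all the strands of a vertex but one)
and, in the colour of the vertex, across every vertex in `S`. -/
structure IsLabelling (S : Finset (Fin n)) (c₀ : Fin n → Fin d) (p : Node n E → Fin d → R)
    (c : Fin n → Fin d) (π : Equiv.Perm (Node n E)) (μ : Node n E → Fin d → R) : Prop where
  color : ∀ v, v ∉ S → c v = c₀ v
  ext : ∀ x, x ∉ body S → μ x = p x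
  line : ∀ x, μ (π x) = μ x
  vert : ∀ v ∈ S, μ (Sum.inl (v, false)) (c v) = μ (Sum.inl (v, true)) (c v)

/-- The faces that do not run through one of the roots in `A` carry momenta which satisfy `I`. -/
def LoopsIn (I : R → Prop) (S : Finset (Fin n)) (A : Finset (Node n E)) (c : Fin n → Fin d)
    (π : Equiv.Perm (Node n E)) (μ : Node n E → Fin d → R) : Prop :=
  ∀ x ∈ body S, ∀ k, (∀ a ∈ A, ¬ conn π (colorClass c S k) x a) → I (μ x k)

variable {S : Finset (Fin n)} {A Y : Finset (Node n E)} {c₀ c : Fin n → Fin d}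
  {p μ : Node n E → Fin d → R} {π : Equiv.Perm (Node n E)} {I : R → Prop}

theorem IsLabelling.eq_of_conn (h : IsLabelling S c₀ p c π μ) {k : Fin d} {x y : Node n E}
    (hxy : conn π (colorClass c S k) x y) : μ x k = μ y k := by
  have hle : conn π (colorClass c S k) ≤ Setoid.ker fun z => μ z k := by
    refine conn_le (fun z => ?_) fun v hv => ?_
    · exact (congrFun (h.line z) k).symm
    · obtain ⟨-, rfl⟩ := mem_colorClass.1 hv
      exact h.vert v (mem_colorClass.1 hv).1
  exact hle hxy

theorem mem_body_erase {v : Fin n} (hv : v ∈ S) (b : Bool) {x : Node n E} :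
    x ∈ body S ↔ x = Sum.inl (v, b) ∨ x = Sum.inl (v, !b) ∨ x ∈ body (S.erase v) := by
  constructor
  · intro hx
    obtain ⟨w, hw, b', rfl⟩ := mem_body.1 hx
    by_cases hwv : w = v
    · subst hwv
      cases b <;> cases b' <;> simp
    · right; right; simp [hwv, hw]
  · rintro (rfl | rfl | hx)
    · simpa
    · simpa
    · obtain ⟨w, hw, b', rfl⟩ := mem_body.1 hx
      simpa using Finset.mem_of_mem_erase hw

theorem colorClass_erase {c : Fin n → Fin d} {S : Finset (Fin n)} {k : Fin d} {v : Fin n} :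
    colorClass c (S.erase v) k = (colorClass c S k).erase v := by
  ext w; simp [and_assoc]

theorem colorClass_erase_subset {c : Fin n → Fin d} {S : Finset (Fin n)} {k : Fin d} {v : Fin n} :
    colorClass c (S.erase v) k ⊆ colorClass c S k := by
  rw [colorClass_erase]; exact Finset.erase_subset _ _

/-- The faces before and after the removal of the vertex hooked to the root `a`: the other field
`inl (v, !b)` of the vertex is tied to `a` exactly in the colour of the vertex. -/
theorem conn_or_of_peel {a : Node n E} (hs : Separated S A Y) (ha : a ∈ A) {v : Fin n}
    (hv : v ∈ S) {b : Bool} (hroot : π a = Sum.inl (v, b)) {k : Fin d} {x z : Node n E}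
    (hx : x ≠ Sum.inl (v, b)) (hz : z ≠ Sum.inl (v, b)) (h : conn π (colorClass c S k) x z) :
    conn (π * Equiv.swap a (Sum.inl (v, b))) (colorClass c (S.erase v) k) x z ∨ c v = k ∧
      (conn (π * Equiv.swap a (Sum.inl (v, b))) (colorClass c (S.erase v) k) x a ∧
        conn (π * Equiv.swap a (Sum.inl (v, b))) (colorClass c (S.erase v) k)
          (Sum.inl (v, !b)) z ∨
      conn (π * Equiv.swap a (Sum.inl (v, b))) (colorClass c (S.erase v) k) x
          (Sum.inl (v, !b)) ∧
        conn (π * Equiv.swap a (Sum.inl (v, b))) (colorClass c (S.erase v) k) a z) := by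
  have hne : a ≠ Sum.inl (v, b) := fun h => hs.root a ha (by simpa [h] using hv)
  by_cases hk : c v = k
  · have := rel_of_conn_of_peel (r := mergeClasses (conn (π * Equiv.swap a (Sum.inl (v, b)))
      (colorClass c (S.erase v) k)) a (Sum.inl (v, !b))) hroot hne
      (by rw [← colorClass_erase]; exact le_mergeClasses _ _ _)
      (fun _ => mergeClasses_rel _ _ _) hx hz h
    rcases mergeClasses_iff.1 this with h | h
    · exact Or.inl h
    · exact Or.inr ⟨hk, h⟩
  · exact Or.inl (rel_of_conn_of_peel hroot hne (by rw [← colorClass_erase])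
      (fun hv' => absurd (mem_colorClass.1 hv').2 hk) hx hz h)

theorem conn_of_conn_peel {a : Node n E} {v : Fin n} {b : Bool} (hroot : π a = Sum.inl (v, b))
    {k : Fin d} {x z : Node n E}
    (h : conn (π * Equiv.swap a (Sum.inl (v, b))) (colorClass c (S.erase v) k) x z) :
    conn π (colorClass c S k) x z :=
  conn_peel_le hroot colorClass_erase_subset h

theorem conn_root_of_color {a : Node n E} {v : Fin n} (hv : v ∈ S) {b : Bool}
    (hroot : π a = Sum.inl (v, b)) : conn π (colorClass c S (c v)) (Sum.inl (v, !b)) a := by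
  refine (conn π _).trans (conn_link (mem_colorClass.2 ⟨hv, rfl⟩) _ b) ?_
  rw [← hroot]
  exact (conn π _).symm (conn_step _ _ _)

/-- The external momenta of the graph that is left when the vertex hooked to the root `a` by its
field `inl (v, b)` is removed: its other field becomes an external point of momentum `q`. -/
def peelMomenta (p : Node n E → Fin d → R) (a : Node n E) (v : Fin n) (b : Bool)
    (q : Fin d → R) : Node n E → Fin d → R :=
  Function.update (Function.update p (Sum.inl (v, !b)) q) (Sum.inl (v, b)) (p a)

@[simp] theorem peelMomenta_self (a : Node n E) (v : Fin n) (b : Bool) (q : Fin d → R) :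
    peelMomenta p a v b q (Sum.inl (v, b)) = p a := by
  simp [peelMomenta]

@[simp] theorem peelMomenta_other (a : Node n E) (v : Fin n) (b : Bool) (q : Fin d → R) :
    peelMomenta p a v b q (Sum.inl (v, !b)) = q := by
  simp [peelMomenta]

theorem peelMomenta_of_ne {a : Node n E} {v : Fin n} {b : Bool} {q : Fin d → R} {x : Node n E}
    (h : ∀ b', x ≠ Sum.inl (v, b')) : peelMomenta p a v b q x = p x := by
  simp [peelMomenta, h]

/-- Labellings before and after the removal of the vertex `v` hooked to the root `a`. The new root
`inl (v, !b)` carries a momentum `q` that agrees with that of `a` in the colour of `v`, by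
conservation across the vertex; the removed field `inl (v, b)` keeps the momentum of `a`. -/
theorem isLabelling_peel_iff {a : Node n E} (hs : Separated S A Y) (ha : a ∈ A) {v : Fin n}
    (hv : v ∈ S) {b : Bool} (hroot : π a = Sum.inl (v, b)) {j : Fin d} {q : Fin d → R} :
    IsLabelling S c₀ p c π μ ∧ c v = j ∧ μ (Sum.inl (v, !b)) = q ↔
      IsLabelling (S.erase v) (Function.update c₀ v j) (peelMomenta p a v b q) c
        (π * Equiv.swap a (Sum.inl (v, b))) μ ∧ q j = p a j := by
  have haS := hs.root a ha
  have hav : ∀ b', a ≠ Sum.inl (v, b') := fun b' h => haS (by simpa [h] using hv)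
  have hnv : ∀ x : Node n E, x ∉ body S → ∀ b', x ≠ Sum.inl (v, b') := by
    rintro x hx b' rfl
    simp [hv] at hx
  constructor
  · rintro ⟨h, rfl, rfl⟩
    have h1 : μ (Sum.inl (v, b)) = p a := by rw [← hroot, h.line, h.ext a haS]
    refine ⟨⟨fun w hw => ?_, fun x hx => ?_, fun z => ?_, fun w hw => ?_⟩, ?_⟩
    · by_cases hwv : w = v
      · subst hwv; simp
      · rw [Function.update_of_ne hwv]
        exact h.color w fun hw' => hw (Finset.mem_erase.2 ⟨hwv, hw'⟩)
    · by_cases hxS : x ∈ body S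
      · rcases (mem_body_erase hv b).1 hxS with rfl | rfl | h'
        · rw [peelMomenta_self, h1]
        · rw [peelMomenta_other]
        · exact absurd h' hx
      · rw [peelMomenta_of_ne (hnv x hxS), h.ext x hxS]
    · by_cases hz : z = a
      · subst hz
        rw [peel_apply_left, h.line, h1, h.ext _ haS]
      by_cases hz' : z = Sum.inl (v, b)
      · subst hz'
        rw [peel_apply_right, hroot]
      · rw [peel_apply_of_ne _ hz hz', h.line]
    · exact h.vert w (Finset.mem_of_mem_erase hw)
    · rw [← h1]
      have := h.vert v hv
      cases b
      · exact this.symm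
      · exact this
  · rintro ⟨h, hq⟩
    have hcv : c v = j := by
      have := h.color v (by simp)
      rwa [Function.update_self] at this
    have hq' : μ (Sum.inl (v, !b)) = q := by
      rw [h.ext _ (by simp), peelMomenta_other]
    have h1 : μ (Sum.inl (v, b)) = p a := by
      rw [h.ext _ (by simp), peelMomenta_self]
    have hext : ∀ x, x ∉ body S → μ x = p x := by
      intro x hx
      rw [h.ext x fun h' => hx ((mem_body_erase hv b).2 (Or.inr (Or.inr h'))),
        peelMomenta_of_ne (hnv x hx)]
    refine ⟨⟨fun w hw => ?_, hext, fun z => ?_, fun w hw => ?_⟩, hcv, hq'⟩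
    · have hwv : w ≠ v := by rintro rfl; exact hw hv
      rw [h.color w fun h' => hw (Finset.mem_of_mem_erase h'), Function.update_of_ne hwv]
    · by_cases hz : z = a
      · subst hz
        rw [hroot, h1, hext _ haS]
      by_cases hz' : z = Sum.inl (v, b)
      · subst hz'
        have := h.line a
        rw [peel_apply_left] at this
        rw [this, h1, hext _ haS]
      · have := h.line z
        rwa [peel_apply_of_ne _ hz hz'] at this
    · by_cases hwv : w = v
      · subst hwv
        rw [hcv]
        have : μ (Sum.inl (w, b)) j = μ (Sum.inl (w, !b)) j := by rw [h1, hq', hq]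
        cases b
        · exact this
        · exact this.symm
      · exact h.vert w (Finset.mem_erase.2 ⟨hwv, hw⟩)

/-- The condition on the closed faces before and after the removal of the vertex `v` hooked to the
root `a`. The faces of the new root in colours other than that of `v` are closed before the removal
and open afterwards, which is why the condition on its momentum appears separately. -/
theorem loopsIn_peel_iff {a : Node n E} (hs : Separated S A Y) (ha : a ∈ A) {v : Fin n}
    (hv : v ∈ S) {b : Bool} (hf : IsForest S A Y π) (hroot : π a = Sum.inl (v, b))
    (hl : IsLabelling S c₀ p c π μ) :
    LoopsIn I S A c π μ ↔ LoopsIn I (S.erase v) (insert (Sum.inl (v, !b)) A) c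
      (π * Equiv.swap a (Sum.inl (v, b))) μ ∧ ∀ k, k ≠ c v → I (μ (Sum.inl (v, !b)) k) := by
  have hx₁ : ∀ a' ∈ A, ∀ b', a' ≠ Sum.inl (v, b') := by
    rintro a' ha' b' rfl
    exact hs.root _ ha' (by simpa using hv)
  have hf' := (isForest_and_root_iff hs ha hv b).1 ⟨hf, hroot⟩
  constructor
  · intro h
    constructor
    · intro x hx k hk
      refine h x ((mem_body_erase hv b).2 (Or.inr (Or.inr hx))) k fun a' ha' hc => ?_
      have hxne : x ≠ Sum.inl (v, b) := by rintro rfl; simp at hx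
      rcases conn_or_of_peel hs ha hv hroot hxne (hx₁ a' ha' b) hc with h' | ⟨-, h' | h'⟩
      · exact hk a' (Finset.mem_insert_of_mem ha') h'
      · exact hk a (Finset.mem_insert_of_mem ha) h'.1
      · exact hk _ (Finset.mem_insert_self _ _) h'.1
    · -- the new root does not lie on the tree of an old one, so its face was closed
      intro k hk
      refine h _ (by simpa) k fun a' ha' hc => ?_
      rcases conn_or_of_peel hs ha hv hroot (by simp) (hx₁ a' ha' b) hc with h' | ⟨h', -⟩
      · exact hx₁ a' ha' _ (hf'.eq_of_conn (hs.peel hv _) (Finset.mem_insert_self _ _)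
          (Finset.mem_insert_of_mem ha') (conn_mono (colorClass_subset _ _ _) h')).symm
      · exact hk h'.symm
  · rintro ⟨h, hI⟩ x hx k hk
    rcases (mem_body_erase hv b).1 hx with rfl | rfl | hx'
    · refine absurd ?_ (hk a ha)
      rw [← hroot]
      exact (conn π _).symm (conn_step _ _ _)
    · by_cases hkv : k = c v
      · subst hkv
        exact absurd (conn_root_of_color hv hroot) (hk a ha)
      · exact hI k hkv
    · by_cases hex : ∃ a' ∈ insert (Sum.inl (v, !b)) A,
        conn (π * Equiv.swap a (Sum.inl (v, b))) (colorClass c (S.erase v) k) x a'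
      · obtain ⟨a', ha', hc⟩ := hex
        have hc' := conn_of_conn_peel hroot hc
        rcases Finset.mem_insert.1 ha' with rfl | ha'
        · by_cases hkv : k = c v
          · subst hkv
            exact absurd ((conn π _).trans hc' (conn_root_of_color hv hroot)) (hk a ha)
          · rw [hl.eq_of_conn hc']
            exact hI k hkv
        · exact absurd hc' (hk a' ha')
      · push Not at hex
        exact h x hx' k hex

end ForestSum

section ForestSum

variable {d n E : ℕ} {R K : Type*} [Fintype R] [CommRing K]
variable {S : Finset (Fin n)} {A Y : Finset (Node n E)} {c₀ c : Fin n → Fin d}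
  {p μ : Node n E → Fin d → R} {π : Equiv.Perm (Node n E)}

/-- The colourings, contractions and momentum assignments of the graphs on `n` vertices. -/
abbrev Config (d n E : ℕ) (R : Type*) : Type _ :=
  (Fin n → Fin d) × Equiv.Perm (Node n E) × (Node n E → Fin d → R)

/-- The configurations that are forests with a labelling by momenta. -/
structure IsLabelledForest (I : R → Prop) (S : Finset (Fin n)) (A Y : Finset (Node n E))
    (c₀ : Fin n → Fin d) (p : Node n E → Fin d → R) (z : Config d n E R) : Prop where
  forest : IsForest S A Y z.2.1
  labelling : IsLabelling S c₀ p z.1 z.2.1 z.2.2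
  loops : LoopsIn I S A z.1 z.2.1 z.2.2

open Classical in
/-- The sum over the labelled forests which satisfy `Q` of the product of the propagators of all
lines that start at a root, at an additional point or at a vertex in `S`. -/
def forestSum (C : (Fin d → R) → K) (I : R → Prop) (S : Finset (Fin n)) (A Y : Finset (Node n E))
    (c₀ : Fin n → Fin d) (p : Node n E → Fin d → R)
    (Q : (Fin n → Fin d) → Equiv.Perm (Node n E) → Prop) : K :=
  ∑ z : Config d n E R, if IsLabelledForest I S A Y c₀ p z ∧ Q z.1 z.2.1 then
    (∏ x ∈ A ∪ Y, C (z.2.2 x)) * ∏ x ∈ body S, C (z.2.2 x) else 0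

open Classical in
/-- The momenta of a loop attached by a vertex of colour `j` to a line of momentum `r`. -/
def loopMomenta (I : R → Prop) (j : Fin d) (r : Fin d → R) : Finset (Fin d → R) :=
  Finset.univ.filter fun q => q j = r j ∧ ∀ k, k ≠ j → I (q k)

variable {C : (Fin d → R) → K} {I : R → Prop}
  {Q Q' : (Fin n → Fin d) → Equiv.Perm (Node n E) → Prop}

theorem forestSum_congr (h : ∀ c π, (∀ v, v ∉ S → c v = c₀ v) → IsForest S A Y π →
    (Q c π ↔ Q' c π)) :
    forestSum C I S A Y c₀ p Q = forestSum C I S A Y c₀ p Q' := by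
  classical
  refine Finset.sum_congr rfl fun z _ => if_congr ?_ rfl rfl
  exact and_congr_right fun hz => h _ _ hz.labelling.color hz.forest

theorem forestSum_eq_zero (h : ∀ c π, (∀ v, v ∉ S → c v = c₀ v) → IsForest S A Y π → ¬ Q c π) :
    forestSum C I S A Y c₀ p Q = 0 := by
  classical
  refine Finset.sum_eq_zero fun z _ => if_neg ?_
  exact fun hz => h _ _ hz.1.labelling.color hz.1.forest hz.2

theorem forestSum_or (h : ∀ c π, (∀ v, v ∉ S → c v = c₀ v) → IsForest S A Y π → Q c π →
    ¬ Q' c π) :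
    forestSum C I S A Y c₀ p (fun c π => Q c π ∨ Q' c π)
      = forestSum C I S A Y c₀ p Q + forestSum C I S A Y c₀ p Q' := by
  classical
  rw [forestSum, forestSum, forestSum, ← Finset.sum_add_distrib]
  refine Finset.sum_congr rfl fun z _ => ?_
  by_cases hz : IsLabelledForest I S A Y c₀ p z
  · by_cases hQ : Q z.1 z.2.1
    · simp [hz, hQ, h _ _ hz.labelling.color hz.forest hQ]
    · simp [hz, hQ]
  · simp [hz]

theorem prod_body_erase {v : Fin n} (hv : v ∈ S) (b : Bool) (f : Node n E → K) :
    ∏ x ∈ body S, f x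
      = f (Sum.inl (v, b)) * (f (Sum.inl (v, !b)) * ∏ x ∈ body (S.erase v), f x) := by
  classical
  have : (body S : Finset (Node n E))
      = insert (Sum.inl (v, b)) (insert (Sum.inl (v, !b)) (body (S.erase v))) := by
    ext x
    rw [mem_body_erase hv b, Finset.mem_insert, Finset.mem_insert]
  rw [this, Finset.prod_insert (by simp), Finset.prod_insert (by simp)]

theorem isLabelledForest_peel_iff {a : Node n E} (hs : Separated S A Y) (ha : a ∈ A) {v : Fin n}
    (hv : v ∈ S) {b : Bool} {j : Fin d} {q : Fin d → R} :
    IsLabelledForest I S A Y c₀ p (c, π, μ) ∧ π a = Sum.inl (v, b) ∧ c v = j ∧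
        μ (Sum.inl (v, !b)) = q ↔
      IsLabelledForest I (S.erase v) (insert (Sum.inl (v, !b)) A) Y (Function.update c₀ v j)
        (peelMomenta p a v b q) (c, π * Equiv.swap a (Sum.inl (v, b)), μ) ∧
        q ∈ loopMomenta I j (p a) := by
  simp only [loopMomenta, Finset.mem_filter, Finset.mem_univ, true_and]
  constructor
  · rintro ⟨⟨hf, hl, hI⟩, hroot, hc, hq⟩
    have h1 := (isForest_and_root_iff hs ha hv b).1 ⟨hf, hroot⟩
    have h2 := (isLabelling_peel_iff hs ha hv hroot).1 ⟨hl, hc, hq⟩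
    have h3 := (loopsIn_peel_iff hs ha hv hf hroot hl).1 hI
    refine ⟨⟨h1, h2.1, h3.1⟩, h2.2, fun k hk => ?_⟩
    have hk' : k ≠ c v := by rwa [hc]
    exact hq ▸ h3.2 k hk'
  · rintro ⟨⟨hf, hl, hI⟩, hqj, hqI⟩
    obtain ⟨h1, hroot⟩ := (isForest_and_root_iff hs ha hv b).2 hf
    obtain ⟨h2, hc, hq⟩ := (isLabelling_peel_iff hs ha hv hroot).2 ⟨hl, hqj⟩
    refine ⟨⟨h1, h2, (loopsIn_peel_iff hs ha hv h1 hroot h2).2 ⟨hI, fun k hk => ?_⟩⟩,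
      hroot, hc, hq⟩
    rw [hq]
    exact hqI k (by rwa [hc] at hk)

/-- The recursion that removes the vertex hooked to the root `a`. -/
theorem forestSum_root {a : Node n E} (hs : Separated S A Y) (ha : a ∈ A)
    (hQ : ∀ c π, IsForest S A Y π → Q c π → ∃ v ∈ S, ∃ b, π a = Sum.inl (v, b)) :
    forestSum C I S A Y c₀ p Q = ∑ v ∈ S, ∑ b : Bool, ∑ j : Fin d, ∑ q ∈ loopMomenta I j (p a),
      C (p a) * forestSum C I (S.erase v) (insert (Sum.inl (v, !b)) A) Y (Function.update c₀ v j)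
        (peelMomenta p a v b q) fun c π => Q c (π * Equiv.swap a (Sum.inl (v, b))) := by
  classical
  -- sort the configurations by the field hooked to `a`, the colour of its vertex and the momentum
  -- of the other field; exactly one term of the fourfold sum is not zero
  have key : ∀ z : Config d n E R, (if IsLabelledForest I S A Y c₀ p z ∧ Q z.1 z.2.1 then
      (∏ x ∈ A ∪ Y, C (z.2.2 x)) * ∏ x ∈ body S, C (z.2.2 x) else 0)
      = ∑ v ∈ S, ∑ b : Bool, ∑ j : Fin d, ∑ q : Fin d → R,
        if (IsLabelledForest I S A Y c₀ p z ∧ z.2.1 a = Sum.inl (v, b) ∧ z.1 v = j ∧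
          z.2.2 (Sum.inl (v, !b)) = q) ∧ Q z.1 z.2.1 then
        (∏ x ∈ A ∪ Y, C (z.2.2 x)) * ∏ x ∈ body S, C (z.2.2 x) else 0 := by
    intro z
    by_cases hz : IsLabelledForest I S A Y c₀ p z ∧ Q z.1 z.2.1
    · obtain ⟨v, hv, b, hvb⟩ := hQ _ _ hz.1.forest hz.2
      rw [if_pos hz, Finset.sum_eq_single v, Finset.sum_eq_single b, Finset.sum_eq_single (z.1 v),
        Finset.sum_eq_single (z.2.2 (Sum.inl (v, !b)))]
      · rw [if_pos ⟨⟨hz.1, hvb, rfl, rfl⟩, hz.2⟩]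
      · intro q _ hq
        exact if_neg fun h => hq h.1.2.2.2.symm
      · simp
      · intro j _ hj
        exact Finset.sum_eq_zero fun q _ => if_neg fun h => hj h.1.2.2.1.symm
      · simp
      · intro b' _ hb
        refine Finset.sum_eq_zero fun j _ => Finset.sum_eq_zero fun q _ => if_neg fun h => hb ?_
        have := hvb.symm.trans h.1.2.1
        simp only [Sum.inl.injEq, Prod.mk.injEq] at this
        exact this.2.symm
      · simp
      · intro w _ hw
        refine Finset.sum_eq_zero fun b' _ => Finset.sum_eq_zero fun j _ =>
          Finset.sum_eq_zero fun q _ => if_neg fun h => hw ?_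
        have := hvb.symm.trans h.1.2.1
        simp only [Sum.inl.injEq, Prod.mk.injEq] at this
        exact this.1.symm
      · exact fun h => absurd hv h
    · rw [if_neg hz]
      refine (Finset.sum_eq_zero fun v _ => Finset.sum_eq_zero fun b' _ =>
        Finset.sum_eq_zero fun j _ => Finset.sum_eq_zero fun q _ => if_neg fun h => hz ?_).symm
      exact ⟨h.1.1, h.2⟩
  rw [forestSum, Finset.sum_congr rfl fun z _ => key z, Finset.sum_comm]
  refine Finset.sum_congr rfl fun v hv => ?_
  rw [Finset.sum_comm]
  refine Finset.sum_congr rfl fun b _ => ?_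
  rw [Finset.sum_comm]
  refine Finset.sum_congr rfl fun j _ => ?_
  rw [Finset.sum_comm]
  conv_rhs => rw [loopMomenta, Finset.sum_filter]
  refine Finset.sum_congr rfl fun q _ => ?_
  have hmem : (q j = p a j ∧ ∀ k, k ≠ j → I (q k)) ↔ q ∈ loopMomenta I j (p a) := by
    simp [loopMomenta]
  have haS := hs.root a ha
  by_cases hq : q ∈ loopMomenta I j (p a)
  · -- multiplication by the transposition is the bijection onto the smaller configurations
    rw [if_pos (hmem.2 hq), forestSum, Finset.mul_sum]
    refine Fintype.sum_equiv (Equiv.prodCongr (Equiv.refl _) (Equiv.prodCongr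
      (Equiv.mulRight (Equiv.swap a (Sum.inl (v, b)))) (Equiv.refl _))) _ _ ?_
    rintro ⟨c, π, μ⟩
    simp only [Equiv.prodCongr_apply, Prod.map_apply, Equiv.refl_apply, Equiv.coe_mulRight]
    have hiff := isLabelledForest_peel_iff (I := I) (c₀ := c₀) (p := p) (c := c) (μ := μ) (π := π)
      hs ha hv (b := b) (j := j) (q := q)
    rw [mul_assoc π, Equiv.swap_mul_self, mul_one]
    by_cases hz : IsLabelledForest I (S.erase v) (insert (Sum.inl (v, !b)) A) Y
        (Function.update c₀ v j) (peelMomenta p a v b q)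
        (c, π * Equiv.swap a (Sum.inl (v, b)), μ) ∧ Q c π
    · rw [if_pos ⟨hiff.2 ⟨hz.1, hq⟩, hz.2⟩, if_pos hz, prod_body_erase hv b, Finset.insert_union,
        Finset.prod_insert, show μ (Sum.inl (v, b)) = _ from hz.1.labelling.ext _ (by simp),
        peelMomenta_self]
      · ring
      · rw [Finset.mem_union, not_or]
        exact ⟨fun h => hs.root _ h (by simpa), fun h => (hs.mark _ h).2 (by simpa)⟩
    · rw [if_neg hz, if_neg, mul_zero]
      exact fun h => hz ⟨(hiff.1 h.1).1, h.2⟩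
  · rw [if_neg (fun h => hq (hmem.1 h))]
    refine Finset.sum_eq_zero ?_
    rintro ⟨c, π, μ⟩ -
    refine if_neg fun h => hq ?_
    exact ((isLabelledForest_peel_iff hs ha hv).1 h.1).2

/-- A root that is contracted with itself contributes its propagator. -/
theorem forestSum_fixed {a : Node n E} (hs : Separated S A Y) (ha : a ∈ A)
    (hQ : ∀ c π, IsForest S A Y π → Q c π → π a = a) :
    forestSum C I S A Y c₀ p Q = C (p a) * forestSum C I S (A.erase a) Y c₀ p Q := by
  classical
  have haY : a ∉ Y := fun h => (hs.mark a h).1 ha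
  rw [forestSum, forestSum, Finset.mul_sum]
  refine Finset.sum_congr rfl fun z _ => ?_
  have hiff : IsLabelledForest I S A Y c₀ p z ∧ Q z.1 z.2.1 ↔
      IsLabelledForest I S (A.erase a) Y c₀ p z ∧ Q z.1 z.2.1 := by
    have hiso : z.2.1 a = a → ∀ x ∈ body S, ∀ k, ¬ conn z.2.1 (colorClass z.1 S k) x a := by
      intro hfix x hx k hc
      have := eq_of_conn_of_fixed hfix (hs.root a ha)
        ((conn _ _).symm (conn_mono (colorClass_subset _ _ _) hc))
      exact hs.root a ha (this ▸ hx)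
    constructor
    · rintro ⟨⟨hf, hl, hI⟩, h⟩
      have hfix := hQ _ _ hf h
      refine ⟨⟨(isForest_and_fixed_iff hs ha).1 ⟨hf, hfix⟩, hl, fun x hx k hk => ?_⟩, h⟩
      refine hI x hx k fun a' ha' hc => ?_
      by_cases haa : a' = a
      · subst haa
        exact hiso hfix x hx k hc
      · exact hk a' (Finset.mem_erase.2 ⟨haa, ha'⟩) hc
    · rintro ⟨⟨hf, hl, hI⟩, h⟩
      obtain ⟨hf', hfix⟩ := (isForest_and_fixed_iff hs ha).2 hf
      exact ⟨⟨hf', hl, fun x hx k hk => hI x hx k fun a' ha' =>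
        hk a' (Finset.mem_of_mem_erase ha')⟩, h⟩
  by_cases hz : IsLabelledForest I S A Y c₀ p z ∧ Q z.1 z.2.1
  · have he : A.erase a ∪ Y = (A ∪ Y).erase a := by
      rw [Finset.erase_union_distrib, Finset.erase_eq_of_notMem haY]
    rw [if_pos hz, if_pos (hiff.1 hz), he,
      ← Finset.mul_prod_erase (A ∪ Y) _ (Finset.mem_union_left _ ha),
      hz.1.labelling.ext a (hs.root a ha), mul_assoc]
  · rw [if_neg hz, if_neg (fun h => hz (hiff.2 h)), mul_zero]

theorem isForest_empty_iff : IsForest (∅ : Finset (Fin n)) (∅ : Finset (Node n E)) ∅ π ↔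
    π = 1 := by
  constructor
  · intro h
    ext1 x
    exact h.fix x (by simp) (by simp) (by simp [body])
  · rintro rfl
    refine ⟨fun _ _ _ _ => rfl, fun x hx => by simp [body] at hx, ?_⟩
    have h1 : ∀ x y : Node n E, conn 1 ∅ x y → x = y := fun x y h =>
      (eq_of_conn_of_fixed (π := 1) (T := ∅) rfl (by simp [body]) h).symm
    have h2 : numClasses (conn (1 : Equiv.Perm (Node n E)) ∅) = Nat.card (Node n E) :=
      (Nat.card_congr (Equiv.ofBijective (Quotient.mk (conn 1 ∅))
        ⟨fun x y h => h1 x y (Quotient.exact h), Quotient.mk_surjective⟩)).symm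
    simp [h2]

theorem forestSum_empty : forestSum C I (∅ : Finset (Fin n)) ∅ ∅ c₀ p (fun _ _ => True) = 1 := by
  classical
  have hb : (body ∅ : Finset (Node n E)) = ∅ := by simp [body]
  have hiff : ∀ z, IsLabelledForest I (∅ : Finset (Fin n)) ∅ ∅ c₀ p z ↔ z = (c₀, 1, p) := by
    rintro ⟨c, π, μ⟩
    constructor
    · rintro ⟨hf, hl, -⟩
      obtain rfl : π = 1 := isForest_empty_iff.1 hf
      obtain rfl : μ = p := funext fun x => hl.ext x (by simp [hb])
      obtain rfl : c = c₀ := funext fun v => hl.color v (by simp)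
      rfl
    · intro h
      simp only [Prod.mk.injEq] at h
      obtain ⟨rfl, rfl, rfl⟩ := h
      exact ⟨isForest_empty_iff.2 rfl, ⟨fun _ _ => rfl, fun _ _ => rfl, fun _ => rfl, by simp⟩,
        fun x hx => by simp [hb] at hx⟩
  rw [forestSum, Finset.sum_eq_single (c₀, 1, p)]
  · rw [if_pos ⟨(hiff _).2 rfl, trivial⟩]
    simp [hb]
  · exact fun z _ hz => if_neg fun h => hz ((hiff z).1 h.1)
  · simp

/-- In a forest without additional points, a root is either contracted with itself or hooked to a
vertex. -/
theorem IsForest.root_cases {a : Node n E} (hf : IsForest S A ∅ π) (hs : Separated S A ∅)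
    (ha : a ∈ A) : π a = a ∨ ∃ v ∈ S, ∃ b, π a = Sum.inl (v, b) := by
  by_cases hb : π a ∈ body S
  · right
    obtain ⟨v, hv, b, h⟩ := mem_body.1 hb
    exact ⟨v, hv, b, h⟩
  · left
    by_cases hA : π a ∈ A
    · exact (hf.eq_of_conn hs ha hA (conn_step _ _ _)).symm
    · exact π.injective (hf.fix _ hA (by simp) hb)

/-- The generating function of the rooted forests is the product over the roots of the generating
function `g` of the rooted trees, the full propagator, because both satisfy the recursion that
removes the vertex hooked to a root. -/
theorem forestSum_eq_coeff {g : (Fin d → R) → K⟦X⟧}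
    (hg : ∀ r, g r = PowerSeries.C (C r) *
      (1 + 2 * PowerSeries.X * ∑ j, ∑ q ∈ loopMomenta I j r, g r * g q))
    (S : Finset (Fin n)) (A : Finset (Node n E)) (hs : Separated S A ∅)
    (c₀ : Fin n → Fin d) (p : Node n E → Fin d → R) :
    forestSum C I S A ∅ c₀ p (fun _ _ => True)
      = S.card.factorial * PowerSeries.coeff S.card (∏ a ∈ A, g (p a)) := by
  classical
  -- removing a vertex lowers the number of vertices by one and raises the number of roots by one,
  -- so the measure counts every vertex twice
  induction hm : 2 * S.card + A.card using Nat.strong_induction_on generalizing S A c₀ p with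
  | _ m ih =>
  rcases A.eq_empty_or_nonempty with rfl | ⟨a, ha⟩
  · rcases S.eq_empty_or_nonempty with rfl | ⟨v, hv⟩
    · simp [forestSum_empty]
    · rw [forestSum_eq_zero, Finset.prod_empty, PowerSeries.coeff_one,
        if_neg (Finset.card_pos.2 ⟨v, hv⟩).ne', mul_zero]
      intro c π _ hf
      obtain ⟨a, ha, -⟩ := hf.reach (Sum.inl (v, false)) (by simp [hv])
      simp at ha
  · have haS := hs.root a ha
    have hcA := Finset.card_erase_add_one ha
    have hsplit : forestSum C I S A ∅ c₀ p (fun _ _ => True)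
        = forestSum C I S A ∅ c₀ p (fun _ π => π a = a)
          + forestSum C I S A ∅ c₀ p (fun _ π => π a ≠ a) := by
      rw [← forestSum_or fun _ _ _ _ h h' => h' h]
      exact forestSum_congr fun c π _ _ => by simp [em]
    have hfixed : forestSum C I S A ∅ c₀ p (fun _ π => π a = a) = C (p a) *
        (S.card.factorial * PowerSeries.coeff S.card (∏ a' ∈ A.erase a, g (p a'))) := by
      rw [forestSum_fixed hs ha fun _ _ _ h => h,
        ← ih (2 * S.card + (A.erase a).card) (by omega) S (A.erase a) (hs.erase a) c₀ p rfl,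
        forestSum_congr (Q' := fun _ _ => True)]
      intro c π _ hf
      exact iff_of_true (hf.fix a (by simp) (by simp) haS) trivial
    have hroot : forestSum C I S A ∅ c₀ p (fun _ π => π a ≠ a)
        = ∑ v ∈ S, ∑ b : Bool, ∑ j : Fin d, ∑ q ∈ loopMomenta I j (p a), C (p a) *
          ((S.card - 1).factorial * PowerSeries.coeff (S.card - 1)
            (g q * ∏ a' ∈ A, g (p a'))) := by
      rw [forestSum_root hs ha fun c π hf hne => (hf.root_cases hs ha).resolve_left hne]
      refine Finset.sum_congr rfl fun v hv => Finset.sum_congr rfl fun b _ =>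
        Finset.sum_congr rfl fun j _ => Finset.sum_congr rfl fun q _ => ?_
      have hstar : (Sum.inl (v, !b) : Node n E) ∉ A := fun h => hs.root _ h (by simpa)
      have hcS := Finset.card_erase_add_one hv
      have hcI := Finset.card_insert_of_notMem hstar
      rw [forestSum_congr (Q' := fun _ _ => True), ih _ (by omega) _ _ (hs.peel hv _) _ _ rfl,
        Finset.prod_insert hstar, peelMomenta_other, Finset.card_erase_of_mem hv]
      · congr 4
        refine Finset.prod_congr rfl fun a' ha' => ?_
        rw [peelMomenta_of_ne]
        rintro b' rfl
        exact hs.root _ ha' (by simpa)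
      · intro c π _ hf
        have := ((isForest_and_root_iff (π := π * Equiv.swap a (Sum.inl (v, b))) hs ha hv b).2
          (by rwa [mul_assoc, Equiv.swap_mul_self, mul_one])).2
        refine iff_of_true (fun h => haS ?_) trivial
        rw [← h, this]
        simpa
    rw [hsplit, hfixed, hroot, ← Finset.mul_prod_erase A _ ha]
    set P := ∏ a' ∈ A.erase a, g (p a') with hP
    -- the equation for `g (p a)`, in the form of the recursion
    have hprod : g (p a) * P = PowerSeries.C (C (p a)) * P
        + PowerSeries.X * (PowerSeries.C (2 * C (p a)) *
          ∑ j, ∑ q ∈ loopMomenta I j (p a), g q * (g (p a) * P)) := by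
      conv_lhs => rw [hg (p a)]
      have hs2 : ∑ j, ∑ q ∈ loopMomenta I j (p a), g q * (g (p a) * P)
          = (∑ j, ∑ q ∈ loopMomenta I j (p a), g (p a) * g q) * P := by
        simp only [Finset.sum_mul]
        exact Finset.sum_congr rfl fun j _ => Finset.sum_congr rfl fun q _ => by ring
      rw [hs2, map_mul, map_ofNat]
      ring
    conv_rhs => rw [hprod]
    rw [map_add, PowerSeries.coeff_C_mul, mul_add]
    congr 1
    · ring
    · simp only [Finset.sum_const, ← Finset.mul_sum, Finset.card_univ, Fintype.card_bool]
      rcases hcard : S.card with _ | m'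
      · simp
      · rw [PowerSeries.coeff_succ_X_mul, PowerSeries.coeff_C_mul, Nat.add_sub_cancel,
          Nat.factorial_succ]
        simp only [map_sum, nsmul_eq_mul]
        push_cast
        ring

end ForestSum

/-! ### Forests with a marked loop -/

section MarkedSum

variable {d n E : ℕ} {R K : Type*} [Fintype R] [CommRing K]
variable {S : Finset (Fin n)} {A : Finset (Node n E)} {c₀ c : Fin n → Fin d}
  {p μ : Node n E → Fin d → R} {π : Equiv.Perm (Node n E)} {C : (Fin d → R) → K} {I : R → Prop}
  {i : Fin d} {a y : Node n E}

/-- The additional point `y` lies on the face of colour `i` of the root `a`, and the loop of the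
intermediate field through `y` contains exactly one other node. -/
structure IsMarked (S : Finset (Fin n)) (i : Fin d) (y a : Node n E) (c : Fin n → Fin d)
    (π : Equiv.Perm (Node n E)) : Prop where
  face : conn π (colorClass c S i) y a
  loop : π (π y) = y

theorem IsForest.root_of_isMarked (hf : IsForest S A {y} π) (hs : Separated S A {y}) (ha : a ∈ A)
    (hm : IsMarked S i y a c π) (hne : π y ≠ a) : ∃ v ∈ S, ∃ b, π a = Sum.inl (v, b) := by
  by_cases hb : π a ∈ body S
  · obtain ⟨v, hv, b, h⟩ := mem_body.1 hb
    exact ⟨v, hv, b, h⟩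
  exfalso
  have hya : y ≠ a := fun h => (hs.mark y (by simp)).1 (h ▸ ha)
  have hfix : π a ≠ a := fun h => hya (eq_of_conn_of_fixed h (hs.root a ha)
    ((conn _ _).symm (conn_mono (colorClass_subset _ _ _) hm.face)))
  by_cases hA : π a ∈ A
  · exact hfix (hf.eq_of_conn hs ha hA (conn_step _ _ _)).symm
  by_cases hy : π a = y
  · exact hne (π.injective (hm.loop.trans hy.symm))
  · exact hfix (π.injective (hf.fix _ hA (by simpa using hy) hb))

/-- Where the marked loop may sit when the vertex hooked to the root `a` is removed: it stays on
the face of `a`, or it is on the face of the new root, which must then be tied to `a` in the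
colour `i`. -/
theorem isMarked_peel_iff (hs : Separated S A {y}) (ha : a ∈ A) {v : Fin n} (hv : v ∈ S) {b : Bool}
    (hf : IsForest S A {y} π) (hroot : π a = Sum.inl (v, b)) :
    IsMarked S i y a c π ∧ π y ≠ a ↔
      (IsMarked (S.erase v) i y a c (π * Equiv.swap a (Sum.inl (v, b))) ∧
        (π * Equiv.swap a (Sum.inl (v, b))) y ≠ a) ∨
      (c v = i ∧
        IsMarked (S.erase v) i y (Sum.inl (v, !b)) c (π * Equiv.swap a (Sum.inl (v, b)))) := by
  have hya : y ≠ a := fun h => (hs.mark y (by simp)).1 (h ▸ ha)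
  have hyx : y ≠ Sum.inl (v, b) := fun h => (hs.mark y (by simp)).2 (by simpa [h])
  have hax : a ≠ Sum.inl (v, b) := fun h => hs.root a ha (by simpa [h])
  have hf' := (isForest_and_root_iff hs ha hv b).1 ⟨hf, hroot⟩
  have hs' := hs.peel hv (!b)
  set π' := π * Equiv.swap a (Sum.inl (v, b)) with hπ'
  have hy1 : π' y = π y := peel_apply_of_ne π hya hyx
  have hy2 : π y ≠ a → π' (π' y) = π (π y) := by
    intro h
    rw [hy1]
    exact peel_apply_of_ne π h fun h' => hya (π.injective (h'.trans hroot.symm))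
  constructor
  · rintro ⟨hm, hne⟩
    have hl : π' (π' y) = y := (hy2 hne).trans hm.loop
    rcases conn_or_of_peel hs ha hv hroot hyx hax hm.face with h | ⟨hk, h | h⟩
    · exact Or.inl ⟨⟨h, hl⟩, hy1 ▸ hne⟩
    · exact Or.inl ⟨⟨h.1, hl⟩, hy1 ▸ hne⟩
    · exact Or.inr ⟨hk, h.1, hl⟩
  · rintro (⟨hm, hne⟩ | ⟨hk, hm⟩)
    · rw [hy1] at hne
      exact ⟨⟨conn_of_conn_peel hroot hm.face, (hy2 hne).symm.trans hm.loop⟩, hne⟩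
    · have hne : π y ≠ a := by
        intro h
        have h1 : conn π' (S.erase v) a (Sum.inl (v, !b)) := by
          refine (conn _ _).trans ((conn _ _).symm ?_)
            (conn_mono (colorClass_subset _ _ _) hm.face)
          rw [← h, ← hy1]
          exact conn_step _ _ _
        have h2 := hf'.eq_of_conn hs' (Finset.mem_insert_of_mem ha) (Finset.mem_insert_self _ _) h1
        exact hs.root a ha (by simpa [h2])
      refine ⟨⟨?_, (hy2 hne).symm.trans hm.loop⟩, hne⟩
      refine (conn _ _).trans (conn_of_conn_peel hroot hm.face) ?_
      rw [← hk]
      exact conn_root_of_color hv hroot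

theorem IsForest.not_isMarked_of_ne {a a' : Node n E} (hf : IsForest S A {y} π)
    (hs : Separated S A {y}) (ha : a ∈ A) (ha' : a' ∈ A) (hne : a ≠ a')
    (hm : IsMarked S i y a c π) : ¬ IsMarked S i y a' c π := fun hm' =>
  hne (hf.eq_of_conn hs ha ha' ((conn _ _).trans
    ((conn _ _).symm (conn_mono (colorClass_subset _ _ _) hm.face))
    (conn_mono (colorClass_subset _ _ _) hm'.face)))

/-- When the marked loop consists of `y` and the root `a`, both may be removed. -/
theorem isForest_and_loop_iff (hs : Separated S A {y}) (ha : a ∈ A) :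
    IsForest S A {y} π ∧ π (π y) = y ∧ π y = a ↔
      IsForest S (A.erase a) ∅ (π * Equiv.swap a y) := by
  have hya : y ≠ a := fun h => (hs.mark y (by simp)).1 (h ▸ ha)
  have haS := hs.root a ha
  have hyS := (hs.mark y (by simp)).2
  have hyA := (hs.mark y (by simp)).1
  set π' := π * Equiv.swap a y with hπ'
  constructor
  · rintro ⟨hf, hl, hy⟩
    have hay : π a = y := by rw [← hy]; exact hl
    have hfa : π' a = a := by rw [hπ', peel_apply_left, hy]
    have hfy : π' y = y := by rw [hπ', peel_apply_right, hay]
    refine ⟨fun x hx _ hb => ?_, fun x hx => ?_, ?_⟩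
    · by_cases h1 : x = a
      · rw [h1, hfa]
      by_cases h2 : x = y
      · rw [h2, hfy]
      rw [hπ', peel_apply_of_ne _ h1 h2]
      exact hf.fix x (fun h => hx (Finset.mem_erase.2 ⟨h1, h⟩)) (by simpa using h2) hb
    · have hxS : x ∈ body S := by simpa using hx
      obtain ⟨a', ha', hc⟩ := hf.reach x (Or.inl hxS)
      let Q : Node n E → Prop := fun z => ∃ a' ∈ insert y A, conn π' S z a'
      have hQ : ∀ z ∈ insert y A, Q z := fun z hz => ⟨z, hz, (conn π' S).refl z⟩
      have hle : conn π S ≤ Setoid.ker Q := by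
        refine conn_le_of_peel (T' := S) hay ?_ ?_ (fun v h h' => absurd h h')
        · intro z w hzw
          exact propext ⟨fun ⟨a', h, h'⟩ => ⟨a', h, (conn π' _).trans ((conn π' _).symm hzw) h'⟩,
            fun ⟨a', h, h'⟩ => ⟨a', h, (conn π' _).trans hzw h'⟩⟩
        · exact propext (iff_of_true (hQ _ (by simp [ha])) (hQ _ (by simp)))
      have hQx : Q x := (show Q x = Q a' from hle hc).mpr (hQ a' (by simp [ha']))
      obtain ⟨a'', ha'', h''⟩ := hQx
      rcases Finset.mem_insert.1 ha'' with rfl | ha''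
      · exact absurd hxS (eq_of_conn_of_fixed hfy hyS ((conn π' _).symm h'') ▸ hyS)
      · by_cases h1 : a'' = a
        · subst h1
          exact absurd hxS (eq_of_conn_of_fixed hfa haS ((conn π' _).symm h'') ▸ haS)
        · exact ⟨a'', Finset.mem_erase.2 ⟨h1, ha''⟩, h''⟩
    · rw [numClasses_peel hay hya]
      have := hf.count
      simp only [Finset.card_singleton, Finset.card_empty] at this ⊢
      omega
  · intro hf
    have hfa : π y = a := by
      have := hf.fix a (by simp) (by simp) haS
      rwa [hπ', peel_apply_left] at this
    have hfy : π a = y := by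
      have := hf.fix y (fun h => hyA (Finset.mem_of_mem_erase h)) (by simp) hyS
      rwa [hπ', peel_apply_right] at this
    refine ⟨⟨fun x hx hy hb => ?_, fun x hx => ?_, ?_⟩, by rw [hfa, hfy], hfa⟩
    · rw [← peel_apply_of_ne π (fun h : x = a => hx (h ▸ ha)) (by simpa using hy)]
      exact hf.fix x (fun h => hx (Finset.mem_of_mem_erase h)) (by simp) hb
    · rcases hx with hx | hx
      · obtain ⟨a', ha', hc⟩ := hf.reach x (Or.inl hx)
        exact ⟨a', Finset.mem_of_mem_erase ha', conn_peel_le hfy le_rfl hc⟩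
      · rw [Finset.mem_singleton] at hx
        subst hx
        exact ⟨a, ha, hfa ▸ conn_step _ _ _⟩
    · have := hf.count
      rw [numClasses_peel hfy hya] at this
      simp only [Finset.card_singleton, Finset.card_empty] at this ⊢
      omega

open Classical in
/-- The forests in which the marked loop consists of `y` and the root `a`: the two must have equal
momenta, they contribute two propagators, and the rest is a forest for the remaining roots. -/
theorem forestSum_loop (hI : ∀ r, I r) (hs : Separated S A {y}) (ha : a ∈ A) :
    forestSum C I S A {y} c₀ p (fun c π => IsMarked S i y a c π ∧ π y = a)
      = (if p a = p y then C (p y) ^ 2 else 0)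
        * forestSum C I S (A.erase a) ∅ c₀ p (fun _ _ => True) := by
  have hya : y ≠ a := fun h => (hs.mark y (by simp)).1 (h ▸ ha)
  have haS := hs.root a ha
  have hyS := (hs.mark y (by simp)).2
  have hyA := (hs.mark y (by simp)).1
  have hiff : ∀ (c : Fin n → Fin d) (π : Equiv.Perm (Node n E)) (μ : Node n E → Fin d → R),
      IsLabelledForest I S A {y} c₀ p (c, π, μ) ∧ IsMarked S i y a c π ∧ π y = a ↔
        IsLabelledForest I S (A.erase a) ∅ c₀ p (c, π * Equiv.swap a y, μ) ∧ p a = p y := by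
    intro c π μ
    constructor
    · rintro ⟨⟨hf, hl, -⟩, hm, hy⟩
      have hay : π a = y := by rw [← hy]; exact hm.loop
      have hpay : p a = p y := by
        have := hl.line y
        rwa [show π y = a from hy, hl.ext a haS, hl.ext y hyS] at this
      refine ⟨⟨(isForest_and_loop_iff hs ha).1 ⟨hf, hm.loop, hy⟩, ⟨hl.color, hl.ext, fun x => ?_,
        hl.vert⟩, fun _ _ _ _ => hI _⟩, hpay⟩
      change μ ((π * Equiv.swap a y) x) = μ x
      by_cases h1 : x = a
      · rw [h1, peel_apply_left, hy]
      by_cases h2 : x = y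
      · rw [h2, peel_apply_right, hay]
      rw [peel_apply_of_ne _ h1 h2]
      exact hl.line x
    · rintro ⟨⟨hf, hl, -⟩, hpay⟩
      obtain ⟨hf', hloop, hy⟩ := (isForest_and_loop_iff hs ha).2 hf
      have hay : π a = y := by rw [← hy]; exact hloop
      have hμ : μ a = μ y := by
        rw [show μ a = p a from hl.ext a haS, show μ y = p y from hl.ext y hyS, hpay]
      refine ⟨⟨hf', ⟨hl.color, hl.ext, fun x => ?_, hl.vert⟩, fun _ _ _ _ => hI _⟩,
        ⟨?_, hloop⟩, hy⟩
      · change μ (π x) = μ x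
        by_cases h1 : x = a
        · rw [h1, hay, hμ]
        by_cases h2 : x = y
        · rw [h2, hy, hμ]
        rw [← peel_apply_of_ne π h1 h2]
        exact hl.line x
      · rw [← hy]; exact conn_step _ _ _
  by_cases hpay : p a = p y
  · rw [if_pos hpay, forestSum, forestSum, Finset.mul_sum]
    refine Fintype.sum_equiv (Equiv.prodCongr (Equiv.refl _) (Equiv.prodCongr
      (Equiv.mulRight (Equiv.swap a y)) (Equiv.refl _))) _ _ ?_
    rintro ⟨c, π, μ⟩
    simp only [Equiv.prodCongr_apply, Prod.map_apply, Equiv.refl_apply, Equiv.coe_mulRight,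
      and_true]
    by_cases hz : IsLabelledForest I S (A.erase a) ∅ c₀ p (c, π * Equiv.swap a y, μ)
    · rw [if_pos ((hiff c π μ).2 ⟨hz, hpay⟩), if_pos hz, Finset.union_empty, Finset.union_comm,
        ← Finset.insert_eq, Finset.prod_insert hyA, ← Finset.mul_prod_erase A _ ha,
        show μ a = p a from hz.labelling.ext a haS, show μ y = p y from hz.labelling.ext y hyS,
        hpay]
      ring
    · rw [if_neg hz, if_neg (fun h => hz ((hiff c π μ).1 h).1), mul_zero]
  · rw [if_neg hpay, zero_mul, forestSum]
    refine Finset.sum_eq_zero ?_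
    rintro ⟨c, π, μ⟩ -
    exact if_neg fun h => hpay ((hiff c π μ).1 h).2

open Classical in
/-- The sum over the forests with a marked loop in the tree of the root `a`, where the loop may or
may not contain `a` itself. -/
theorem forestSum_isMarked (hI : ∀ r, I r) (hs : Separated S A {y}) (ha : a ∈ A) :
    forestSum C I S A {y} c₀ p (IsMarked S i y a)
      = forestSum C I S A {y} c₀ p (fun c π => IsMarked S i y a c π ∧ π y ≠ a)
        + (if p a = p y then C (p y) ^ 2 else 0)
          * forestSum C I S (A.erase a) ∅ c₀ p (fun _ _ => True) := by
  rw [← forestSum_loop hI hs ha (i := i), ← forestSum_or fun _ _ _ _ h h' => h.2 h'.2]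
  exact forestSum_congr fun c π _ _ => by
    by_cases h : π y = a <;> simp [h]

theorem forestSum_color (j : Fin d) (i : Fin d) [Decidable (j = i)] {v : Fin n} (hv : v ∉ S)
    (A Y : Finset (Node n E)) (Q : (Fin n → Fin d) → Equiv.Perm (Node n E) → Prop) :
    forestSum C I S A Y (Function.update c₀ v j) p (fun c π => c v = i ∧ Q c π)
      = if j = i then forestSum C I S A Y (Function.update c₀ v j) p Q else 0 := by
  have hcv : ∀ c : Fin n → Fin d, (∀ w, w ∉ S → c w = Function.update c₀ v j w) → c v = j := by
    intro c hc
    rw [hc v hv, Function.update_self]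
  split_ifs with h
  · exact forestSum_congr fun c π hc _ => by simp [hcv c hc, h]
  · exact forestSum_eq_zero fun c π hc _ hQ => h ((hcv c hc).symm.trans hQ.1)

open Classical in
/-- The recursion for forests with a marked loop. -/
theorem forestSum_isMarked_root (hs : Separated S A {y}) (ha : a ∈ A) :
    forestSum C I S A {y} c₀ p (fun c π => IsMarked S i y a c π ∧ π y ≠ a)
      = ∑ v ∈ S, ∑ b : Bool, ∑ j : Fin d, ∑ q ∈ loopMomenta I j (p a), C (p a) *
        (forestSum C I (S.erase v) (insert (Sum.inl (v, !b)) A) {y} (Function.update c₀ v j)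
          (peelMomenta p a v b q) (fun c π => IsMarked (S.erase v) i y a c π ∧ π y ≠ a) +
        if j = i then forestSum C I (S.erase v) (insert (Sum.inl (v, !b)) A) {y}
          (Function.update c₀ v j) (peelMomenta p a v b q)
          (IsMarked (S.erase v) i y (Sum.inl (v, !b))) else 0) := by
  rw [forestSum_root hs ha fun c π hf h => hf.root_of_isMarked hs ha h.1 h.2]
  refine Finset.sum_congr rfl fun v hv => Finset.sum_congr rfl fun b _ =>
    Finset.sum_congr rfl fun j _ => Finset.sum_congr rfl fun q _ => ?_
  have hs' := hs.peel hv (!b)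
  rw [← forestSum_color j i (Finset.notMem_erase v S), ← forestSum_or]
  · congr 1
    refine forestSum_congr fun c π hc hf => ?_
    have hππ : π * Equiv.swap a (Sum.inl (v, b)) * Equiv.swap a (Sum.inl (v, b)) = π := by
      rw [mul_assoc, Equiv.swap_mul_self, mul_one]
    obtain ⟨hf', hroot⟩ := (isForest_and_root_iff (π := π * Equiv.swap a (Sum.inl (v, b)))
      hs ha hv b).2 (by rwa [hππ])
    have := isMarked_peel_iff (c := c) (i := i) hs ha hv hf' hroot
    rwa [hππ] at this
  · intro c π _ hf h h'
    refine hf.not_isMarked_of_ne hs' (Finset.mem_insert_of_mem ha) (Finset.mem_insert_self _ _)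
      ?_ h.1 h'.2
    rintro rfl
    exact hs.root _ ha (by simpa)

open Classical in
/-- The generating function of the forests with a marked loop. The tree of the root `a` contributes
`h`, the chains of loops in the colour `i` which lead from `a` to the marked loop. -/
theorem forestSum_isMarked_eq_coeff (hI : ∀ r, I r) {g h : (Fin d → R) → K⟦X⟧} {s : Fin d → R}
    (hg : ∀ r, g r = PowerSeries.C (C r) *
      (1 + 2 * PowerSeries.X * ∑ j, ∑ q ∈ loopMomenta I j r, g r * g q))
    (hh : ∀ r, h r = PowerSeries.C (C r) *
      (2 * PowerSeries.X * (∑ j, ∑ q ∈ loopMomenta I j r, h r * g q) +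
        2 * PowerSeries.X * ∑ q ∈ loopMomenta I i r,
          g r * (h q + if q = s then PowerSeries.C (C s ^ 2) else 0)))
    (S : Finset (Fin n)) (A : Finset (Node n E)) (hs : Separated S A {y}) (ha : a ∈ A)
    (c₀ : Fin n → Fin d) (p : Node n E → Fin d → R) (hp : p y = s) :
    forestSum C I S A {y} c₀ p (fun c π => IsMarked S i y a c π ∧ π y ≠ a)
      = S.card.factorial * PowerSeries.coeff S.card (h (p a) * ∏ a' ∈ A.erase a, g (p a')) := by
  induction hm : S.card generalizing S A a c₀ p with
  | zero =>
    rw [forestSum_isMarked_root hs ha, Finset.card_eq_zero.1 hm, hh]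
    simp [mul_assoc]
  | succ m ih =>
    have hstep : ∀ v ∈ S, ∀ b : Bool, ∀ j : Fin d, ∀ q : Fin d → R,
        forestSum C I (S.erase v) (insert (Sum.inl (v, !b)) A) {y} (Function.update c₀ v j)
          (peelMomenta p a v b q) (fun c π => IsMarked (S.erase v) i y a c π ∧ π y ≠ a) +
        (if j = i then forestSum C I (S.erase v) (insert (Sum.inl (v, !b)) A) {y}
          (Function.update c₀ v j) (peelMomenta p a v b q)
          (IsMarked (S.erase v) i y (Sum.inl (v, !b))) else 0)
        = m.factorial * PowerSeries.coeff m ((h (p a) * g q +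
          if j = i then g (p a) * (h q + if q = s then PowerSeries.C (C s ^ 2) else 0) else 0)
            * ∏ a' ∈ A.erase a, g (p a')) := by
      -- the marked loop stays in the tree of `a`, or it passes to the tree of the new root
      intro v hv b j q
      have hs' := hs.peel hv (!b)
      have hstar : (Sum.inl (v, !b) : Node n E) ∉ A := fun h => hs.root _ h (by simpa)
      have hpA : ∀ a' ∈ A, peelMomenta p a v b q a' = p a' := fun a' ha' =>
        peelMomenta_of_ne (by rintro b' rfl; exact hs.root _ ha' (by simpa))
      have hpy : peelMomenta p a v b q y = s := by
        rw [peelMomenta_of_ne, hp]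
        rintro b' rfl
        exact (hs.mark _ (Finset.mem_singleton_self _)).2 (by simpa)
      have hcS : (S.erase v).card = m := by rw [Finset.card_erase_of_mem hv, hm]; rfl
      have hsF : Separated (S.erase v) A ∅ := by
        refine ⟨fun a' ha' => (hs'.root a' (Finset.mem_insert_of_mem ha')), by simp⟩
      have hane : a ≠ Sum.inl (v, !b) := by rintro rfl; exact hstar ha
      have hPA : ∏ a' ∈ A, g (peelMomenta p a v b q a') = g (p a) * ∏ a' ∈ A.erase a, g (p a') := by
        rw [Finset.mul_prod_erase A (fun a' => g (p a')) ha]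
        exact Finset.prod_congr rfl fun a' ha' => by rw [hpA a' ha']
      have hPA' : ∏ a' ∈ A.erase a, g (peelMomenta p a v b q a') = ∏ a' ∈ A.erase a, g (p a') :=
        Finset.prod_congr rfl fun a' ha' => by rw [hpA a' (Finset.mem_of_mem_erase ha')]
      rw [forestSum_isMarked hI hs' (Finset.mem_insert_self _ _),
        ih _ _ hs' (Finset.mem_insert_of_mem ha) _ _ hpy hcS,
        ih _ _ hs' (Finset.mem_insert_self _ _) _ _ hpy hcS,
        Finset.erase_insert hstar, forestSum_eq_coeff hg _ _ hsF, hcS, hpy, peelMomenta_other,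
        hpA a ha, hPA, Finset.erase_insert_of_ne hane.symm,
        Finset.prod_insert (fun h => hstar (Finset.mem_of_mem_erase h)), peelMomenta_other, hPA']
      by_cases hji : j = i
      · by_cases hqs : q = s
        · simp only [hji, hqs, if_true]
          generalize ∏ a' ∈ A.erase a, g (p a') = P
          have e : (h (p a) * g s + g (p a) * (h s + PowerSeries.C (C s ^ 2))) * P
              = h (p a) * (g s * P) + h s * (g (p a) * P)
                + PowerSeries.C (C s ^ 2) * (g (p a) * P) := by ring
          rw [e, map_add, map_add, PowerSeries.coeff_C_mul]
          ring
        · simp only [hji, hqs, if_true, if_false, zero_mul, add_zero]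
          rw [← mul_add, ← map_add]
          congr 2
          ring
      · simp only [hji, if_false, add_zero, mul_assoc]
    rw [forestSum_isMarked_root hs ha]
    rw [Finset.sum_congr rfl fun v hv => Finset.sum_congr rfl fun b _ =>
      Finset.sum_congr rfl fun j _ => Finset.sum_congr rfl fun q _ => by rw [hstep v hv b j q]]
    set P := ∏ a' ∈ A.erase a, g (p a') with hP
    -- the equation for `h (p a)`, in the form of the recursion
    have hrhs : h (p a) * P = PowerSeries.X * (PowerSeries.C (2 * C (p a)) *
        ∑ j, ∑ q ∈ loopMomenta I j (p a), ((h (p a) * g q +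
          if j = i then g (p a) * (h q + if q = s then PowerSeries.C (C s ^ 2) else 0) else 0)
            * P)) := by
      conv_lhs => rw [hh (p a)]
      have h1 : ∑ j, ∑ q ∈ loopMomenta I j (p a), ((h (p a) * g q +
          if j = i then g (p a) * (h q + if q = s then PowerSeries.C (C s ^ 2) else 0) else 0) * P)
          = ((∑ j, ∑ q ∈ loopMomenta I j (p a), h (p a) * g q) + ∑ q ∈ loopMomenta I i (p a),
            g (p a) * (h q + if q = s then PowerSeries.C (C s ^ 2) else 0)) * P := by
        simp only [← Finset.sum_mul, Finset.sum_add_distrib]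
        congr 2
        rw [Finset.sum_eq_single i]
        · simp
        · intro j _ hj
          exact Finset.sum_eq_zero fun q _ => if_neg hj
        · simp
      rw [h1, map_mul, map_ofNat]
      ring
    rw [hrhs, PowerSeries.coeff_succ_X_mul, PowerSeries.coeff_C_mul]
    simp only [Finset.sum_const, ← Finset.mul_sum, Finset.card_univ, Fintype.card_bool, hm,
      map_sum, nsmul_eq_mul, Nat.factorial_succ]
    push_cast
    ring

/-- The trees in which the root `a` forms a loop with one field of a vertex, as in the one-particle
irreducible two-point graphs. -/
theorem forestSum_onePI {g : (Fin d → R) → K⟦X⟧}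
    (hg : ∀ r, g r = PowerSeries.C (C r) *
      (1 + 2 * PowerSeries.X * ∑ j, ∑ q ∈ loopMomenta I j r, g r * g q))
    (hs : Separated S {a} ∅) :
    forestSum C I S {a} ∅ c₀ p (fun _ π => π (π a) = a ∧ π a ≠ a)
      = C (p a) ^ 2 * (S.card.factorial * PowerSeries.coeff S.card
        (2 * PowerSeries.X * ∑ j, ∑ q ∈ loopMomenta I j (p a), g q)) := by
  have ha : a ∈ ({a} : Finset (Node n E)) := Finset.mem_singleton_self a
  have haS := hs.root a ha
  rw [forestSum_root hs ha fun c π hf h => (hf.root_cases hs ha).resolve_left h.2]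
  have hstep : ∀ v ∈ S, ∀ b : Bool, ∀ j : Fin d, ∀ q : Fin d → R,
      forestSum C I (S.erase v) (insert (Sum.inl (v, !b)) {a}) ∅ (Function.update c₀ v j)
        (peelMomenta p a v b q) (fun _ π => (π * Equiv.swap a (Sum.inl (v, b)))
          ((π * Equiv.swap a (Sum.inl (v, b))) a) = a ∧
          (π * Equiv.swap a (Sum.inl (v, b))) a ≠ a)
      = C (p a) * ((S.card - 1).factorial * PowerSeries.coeff (S.card - 1) (g q)) := by
    -- once the vertex is removed, `a` is contracted with itself, and only the tree of the new
    -- root is left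
    intro v hv b j q
    have hs' := hs.peel hv (!b)
    have hane : ∀ b', a ≠ Sum.inl (v, b') := by rintro b' rfl; exact haS (by simpa)
    have hstar : (Sum.inl (v, !b) : Node n E) ∉ ({a} : Finset (Node n E)) := by
      simpa using (hane _).symm
    have hroot : ∀ π, IsForest (S.erase v) (insert (Sum.inl (v, !b)) {a}) ∅ π →
        π (Sum.inl (v, b)) = Sum.inl (v, b) := by
      intro π hf
      exact hf.fix _ (by simpa using (hane b).symm) (by simp) (by simp)
    rw [forestSum_congr (Q' := fun _ π => π a = a),
      forestSum_fixed hs' (Finset.mem_insert_of_mem ha) (fun _ _ _ h => h),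
      Finset.erase_insert_of_ne (hane _).symm, Finset.erase_singleton,
      forestSum_congr (Q' := fun _ _ => True),
      forestSum_eq_coeff hg _ _ ?_, Finset.card_erase_of_mem hv, peelMomenta_of_ne hane]
    · simp
    · have := hs'.erase a
      rwa [Finset.erase_insert_of_ne (hane _).symm, Finset.erase_singleton] at this
    · intro c π _ hf
      have haS' := hs'.root a (by simp)
      exact iff_of_true (hf.fix a (by simpa using hane _) (by simp) haS') trivial
    · intro c π _ hf
      rw [peel_apply_left, hroot π hf, peel_apply_right]
      exact and_iff_left (hane b).symm
  rw [Finset.sum_congr rfl fun v hv => Finset.sum_congr rfl fun b _ =>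
    Finset.sum_congr rfl fun j _ => Finset.sum_congr rfl fun q _ => by rw [hstep v hv b j q]]
  rcases hm : S.card with _ | m
  · rw [Finset.card_eq_zero.1 hm]
    simp [mul_assoc]
  · rw [mul_comm 2 PowerSeries.X, mul_assoc, PowerSeries.coeff_succ_X_mul,
      ← map_ofNat (PowerSeries.C (R := K)) 2, PowerSeries.coeff_C_mul]
    simp only [Finset.sum_const, ← Finset.mul_sum, Finset.card_univ, Fintype.card_bool, hm,
      map_sum, nsmul_eq_mul, Nat.factorial_succ, Nat.add_sub_cancel]
    push_cast
    ring

open Classical in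
/-- The trees with a marked loop in which the root `a`, too, forms a loop with one field of a
vertex, as in the one-particle irreducible four-point graphs. -/
theorem forestSum_isMarked_onePI (hI : ∀ r, I r) {g h : (Fin d → R) → K⟦X⟧} {s : Fin d → R}
    (hg : ∀ r, g r = PowerSeries.C (C r) *
      (1 + 2 * PowerSeries.X * ∑ j, ∑ q ∈ loopMomenta I j r, g r * g q))
    (hh : ∀ r, h r = PowerSeries.C (C r) *
      (2 * PowerSeries.X * (∑ j, ∑ q ∈ loopMomenta I j r, h r * g q) +
        2 * PowerSeries.X * ∑ q ∈ loopMomenta I i r,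
          g r * (h q + if q = s then PowerSeries.C (C s ^ 2) else 0)))
    (hs : Separated S {a} {y}) (hp : p y = s) :
    forestSum C I S {a} {y} c₀ p (fun c π => (IsMarked S i y a c π ∧ π y ≠ a) ∧ π (π a) = a)
      = C (p a) ^ 2 * (S.card.factorial * PowerSeries.coeff S.card
        (2 * PowerSeries.X * ∑ q ∈ loopMomenta I i (p a),
          (h q + if q = s then PowerSeries.C (C s ^ 2) else 0))) := by
  have ha : a ∈ ({a} : Finset (Node n E)) := Finset.mem_singleton_self a
  have haS := hs.root a ha
  have hya : y ≠ a := by simpa using (hs.mark y (by simp)).1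
  rw [forestSum_root hs ha fun c π hf h => hf.root_of_isMarked hs ha h.1.1 h.1.2]
  have hstep : ∀ v ∈ S, ∀ b : Bool, ∀ j : Fin d, ∀ q : Fin d → R,
      forestSum C I (S.erase v) (insert (Sum.inl (v, !b)) {a}) {y} (Function.update c₀ v j)
        (peelMomenta p a v b q) (fun c π => (IsMarked S i y a c
          (π * Equiv.swap a (Sum.inl (v, b))) ∧ (π * Equiv.swap a (Sum.inl (v, b))) y ≠ a) ∧
          (π * Equiv.swap a (Sum.inl (v, b))) ((π * Equiv.swap a (Sum.inl (v, b))) a) = a)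
      = if j = i then C (p a) * ((S.card - 1).factorial * PowerSeries.coeff (S.card - 1)
          (h q + if q = s then PowerSeries.C (C s ^ 2) else 0)) else 0 := by
    intro v hv b j q
    have hs' := hs.peel hv (!b)
    have hane : ∀ b', a ≠ Sum.inl (v, b') := by rintro b' rfl; exact haS (by simpa)
    have hstar : (Sum.inl (v, !b) : Node n E) ∉ ({a} : Finset (Node n E)) := by
      simpa using (hane _).symm
    have hyx : ∀ b', y ≠ Sum.inl (v, b') := by
      rintro b' rfl
      exact (hs.mark _ (Finset.mem_singleton_self _)).2 (by simpa)
    have hpy : peelMomenta p a v b q y = s := by rw [peelMomenta_of_ne hyx, hp]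
    have haS' := hs'.root a (by simp)
    have hcongr : ∀ c π, (∀ w, w ∉ S.erase v → c w = Function.update c₀ v j w) →
        IsForest (S.erase v) (insert (Sum.inl (v, !b)) {a}) {y} π →
        ((IsMarked S i y a c (π * Equiv.swap a (Sum.inl (v, b))) ∧
          (π * Equiv.swap a (Sum.inl (v, b))) y ≠ a) ∧
          (π * Equiv.swap a (Sum.inl (v, b))) ((π * Equiv.swap a (Sum.inl (v, b))) a) = a ↔
        c v = i ∧ (IsMarked (S.erase v) i y (Sum.inl (v, !b)) c π ∧ π a = a)) := by
      intro c π _ hf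
      have hππ : π * Equiv.swap a (Sum.inl (v, b)) * Equiv.swap a (Sum.inl (v, b)) = π := by
        rw [mul_assoc, Equiv.swap_mul_self, mul_one]
      obtain ⟨hf', hroot⟩ := (isForest_and_root_iff (π := π * Equiv.swap a (Sum.inl (v, b)))
        hs ha hv b).2 (by rwa [hππ])
      have h1 := isMarked_peel_iff (c := c) (i := i) hs ha hv hf' hroot
      rw [hππ] at h1
      rw [h1, hroot, peel_apply_right]
      constructor
      · rintro ⟨⟨hm, -⟩ | ⟨hc, hm⟩, hfix⟩
        · -- `a` is isolated after the removal, hence not on the face of `y`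
          exact absurd (eq_of_conn_of_fixed hfix haS' ((conn _ _).symm
            (conn_mono (colorClass_subset _ _ _) hm.face))) hya
        · exact ⟨hc, hm, hfix⟩
      · rintro ⟨hc, hm, hfix⟩
        exact ⟨Or.inr ⟨hc, hm⟩, hfix⟩
    rw [forestSum_congr hcongr, forestSum_color j i (Finset.notMem_erase v S)]
    congr 1
    have hs'' : Separated (S.erase v) ({Sum.inl (v, !b)} : Finset (Node n E)) {y} := by
      have := hs'.erase a
      rwa [Finset.erase_insert_of_ne (hane _).symm, Finset.erase_singleton, insert_empty_eq]
        at this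
    have hsF : Separated (S.erase v) (∅ : Finset (Node n E)) ∅ := ⟨by simp, by simp⟩
    rw [forestSum_fixed hs' (Finset.mem_insert_of_mem ha) (fun _ _ _ h => h.2),
      Finset.erase_insert_of_ne (hane _).symm, Finset.erase_singleton, insert_empty_eq,
      forestSum_congr (Q' := IsMarked (S.erase v) i y (Sum.inl (v, !b))),
      forestSum_isMarked hI hs'' (Finset.mem_singleton_self _),
      forestSum_isMarked_eq_coeff hI hg hh _ _ hs'' (Finset.mem_singleton_self _) _ _ hpy,
      Finset.erase_singleton, forestSum_eq_coeff hg _ _ hsF, Finset.card_erase_of_mem hv,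
      peelMomenta_of_ne hane, peelMomenta_other, hpy, Finset.prod_empty, mul_one]
    · congr 1
      by_cases hqs : q = s
      · simp only [hqs, if_true, map_add]
        rw [mul_add, ← mul_one (PowerSeries.C (C s ^ 2)), PowerSeries.coeff_C_mul]
        ring
      · simp only [hqs, if_false, zero_mul, add_zero]
    · intro c π _ hf
      refine and_iff_left (hf.fix a ?_ ?_ haS')
      · simpa using hane _
      · simpa using hya.symm
  rw [Finset.sum_congr rfl fun v hv => Finset.sum_congr rfl fun b _ =>
    Finset.sum_congr rfl fun j _ => Finset.sum_congr rfl fun q _ => by rw [hstep v hv b j q]]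
  have hcol : ∀ f : (Fin d → R) → K, ∑ j : Fin d, ∑ q ∈ loopMomenta I j (p a),
      C (p a) * (if j = i then f q else 0) = C (p a) * ∑ q ∈ loopMomenta I i (p a), f q := by
    intro f
    rw [Finset.sum_eq_single i]
    · simp [Finset.mul_sum]
    · intro j _ hj
      exact Finset.sum_eq_zero fun q _ => by rw [if_neg hj, mul_zero]
    · simp
  simp only [hcol]
  rcases hm : S.card with _ | m
  · rw [Finset.card_eq_zero.1 hm]
    simp [mul_assoc]
  · rw [mul_comm 2 PowerSeries.X, mul_assoc, PowerSeries.coeff_succ_X_mul,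
      ← map_ofNat (PowerSeries.C (R := K)) 2, PowerSeries.coeff_C_mul]
    simp only [Finset.sum_const, ← Finset.mul_sum, Finset.card_univ, Fintype.card_bool, hm,
      map_sum, nsmul_eq_mul, Nat.factorial_succ, Nat.add_sub_cancel]
    push_cast
    ring

end MarkedSum

/-! ### Faces -/

section Faces

variable {d n E : ℕ} {π : Equiv.Perm (Node n E)} {T : Finset (Fin n)}

/-- The permutation that exchanges the two fields of every vertex in `T`. -/
def linkPerm (T : Finset (Fin n)) : Equiv.Perm (Node n E) :=
  Function.Involutive.toPerm
    (Sum.map (fun e => (e.1, if e.1 ∈ T then !e.2 else e.2)) id) <| by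
      rintro (⟨v, b⟩ | a)
      · by_cases h : v ∈ T <;> simp [h]
      · rfl

theorem linkPerm_inl (v : Fin n) (b : Bool) :
    linkPerm T (Sum.inl (v, b) : Node n E) = Sum.inl (v, if v ∈ T then !b else b) := rfl

theorem linkPerm_inr (a : Fin E) : linkPerm T (Sum.inr a : Node n E) = Sum.inr a := rfl

theorem linkPerm_empty : (linkPerm ∅ : Equiv.Perm (Node n E)) = 1 := by
  ext1 x
  rcases x with ⟨v, b⟩ | a <;> simp [linkPerm_inl, linkPerm_inr]

theorem linkPerm_insert {v : Fin n} (hv : v ∉ T) : (linkPerm (insert v T) : Equiv.Perm (Node n E))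
    = Equiv.swap (Sum.inl (v, false)) (Sum.inl (v, true)) * linkPerm T := by
  ext1 x
  rcases x with ⟨w, b⟩ | a
  · by_cases hw : w = v
    · subst hw
      cases b <;> simp [linkPerm_inl, hv]
    · rw [Equiv.Perm.mul_apply, linkPerm_inl, linkPerm_inl,
        Equiv.swap_apply_of_ne_of_ne (by simp [hw]) (by simp [hw])]
      simp [hw]
  · rw [Equiv.Perm.mul_apply, linkPerm_inr, linkPerm_inr,
      Equiv.swap_apply_of_ne_of_ne (by simp) (by simp)]

/-- The strands inside the vertices of colour `k` exchange the two fields; all other vertices do not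
change the cycles in colour `k`. -/
theorem facePerm_eq (G : FeynmanGraph d n E) (k : Fin d) :
    G.facePerm k = linkPerm (colorClass G.1 Finset.univ k) * G.2 := by
  ext1 x
  rw [FeynmanGraph.facePerm, Equiv.Perm.mul_apply, Equiv.Perm.mul_apply]
  generalize G.2 x = y
  rcases y with ⟨v, b⟩ | a
  · simp [linkPerm_inl, FeynmanGraph.strandFun]
  · simp [linkPerm_inr, FeynmanGraph.strandFun]

theorem sameCycle_linkPerm_le (T : Finset (Fin n)) :
    Equiv.Perm.SameCycle.setoid (linkPerm T * π) ≤ conn π T := by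
  refine sameCycle_le fun x => (conn π T).trans (conn_step π T x) ?_
  rw [Equiv.Perm.mul_apply]
  generalize π x = y
  rcases y with ⟨v, b⟩ | a
  · rw [linkPerm_inl]
    by_cases h : v ∈ T
    · rw [if_pos h]; exact conn_link h _ _
    · rw [if_neg h]
  · rw [linkPerm_inr]

/-- The cycles of `π` joined by all the vertices form a forest: each of the `n` vertices lowers the
number of components by one. -/
def IsAcyclic (π : Equiv.Perm (Node n E)) : Prop :=
  numClasses (conn π ∅) = numClasses (conn π Finset.univ) + n

theorem IsAcyclic.not_conn (h : IsAcyclic π) {v : Fin n} (hv : v ∉ T) :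
    ¬ conn π T (Sum.inl (v, false)) (Sum.inl (v, true)) := by
  intro hc
  have hle : numClasses (conn π (Finset.univ.erase v)) ≤ numClasses (conn π Finset.univ) := by
    refine numClasses_anti (conn_le (conn_step π _) fun w _ => ?_)
    by_cases hw : w = v
    · subst hw
      exact conn_mono (fun u hu => Finset.mem_erase.2
        ⟨by rintro rfl; exact hv hu, by simp⟩) hc
    · exact conn_link (by simp [hw]) _ _
  have h1 := numClasses_conn_empty_le π (Finset.univ.erase v)
  have h2 := Finset.card_erase_add_one (Finset.mem_univ v)
  rw [Finset.card_univ, Fintype.card_fin] at h2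
  unfold IsAcyclic at h
  omega

/-- In a forest, the faces of colour `k` are the classes of nodes that are joined by the
vertices of colour `k`. -/
theorem IsAcyclic.sameCycle_eq (h : IsAcyclic π) (T : Finset (Fin n)) :
    Equiv.Perm.SameCycle.setoid (linkPerm T * π) = conn π T := by
  induction T using Finset.induction_on with
  | empty => rw [linkPerm_empty, one_mul, conn_empty]
  | insert v T hv ih =>
    have hn := h.not_conn hv
    rw [linkPerm_insert hv, mul_assoc, sameCycle_swap_mul_eq, ih, conn_insert]
    rw [← ih] at hn
    exact hn

theorem IsAcyclic.numClasses_eq (h : IsAcyclic π) (T : Finset (Fin n)) :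
    numClasses (conn π T) + T.card = numClasses (conn π ∅) := by
  induction T using Finset.induction_on with
  | empty => simp
  | insert v T hv ih =>
    have := numClasses_mergeClasses _ (h.not_conn hv)
    rw [conn_insert, Finset.card_insert_of_notMem hv]
    omega

/-- In a forest, two nodes that are joined by the vertices in `T` and also by those in `T'` are
joined by the vertices common to `T` and `T'`. -/
theorem IsAcyclic.conn_inter (h : IsAcyclic π) {T' : Finset (Fin n)} {x y : Node n E}
    (hT : conn π T x y) (hT' : conn π T' x y) : conn π (T ∩ T') x y := by
  induction hm : (T \ T').card using Nat.strong_induction_on generalizing T with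
  | _ m ih =>
  rcases (T \ T').eq_empty_or_nonempty with he | ⟨v, hv⟩
  · rwa [Finset.inter_eq_left.2 (Finset.sdiff_eq_empty_iff_subset.1 he)]
  · obtain ⟨hvT, hvT'⟩ := Finset.mem_sdiff.1 hv
    have hc : conn π (T.erase v) x y := by
      rw [← Finset.insert_erase hvT, conn_insert] at hT
      have hle : conn π T' ≤ conn π (Finset.univ.erase v) :=
        conn_mono fun u hu => Finset.mem_erase.2 ⟨by rintro rfl; exact hvT' hu, by simp⟩
      have hle' : conn π (T.erase v) ≤ conn π (Finset.univ.erase v) :=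
        conn_mono (Finset.erase_subset_erase _ (Finset.subset_univ _))
      have hn := h.not_conn (Finset.notMem_erase v Finset.univ)
      set r := conn π (Finset.univ.erase v)
      rcases mergeClasses_iff.1 hT with h1 | ⟨h1, h2⟩ | ⟨h1, h2⟩
      · exact h1
      · exact absurd (r.trans (r.symm (hle' h1)) (r.trans (hle hT') (r.symm (hle' h2)))) hn
      · exact absurd (r.trans (hle' h2) (r.trans (r.symm (hle hT')) (hle' h1))) hn
    have hlt : ((T.erase v) \ T').card < m := by
      rw [← hm]
      refine Finset.card_lt_card ⟨Finset.sdiff_subset_sdiff (Finset.erase_subset _ _) le_rfl, ?_⟩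
      intro hsub
      simpa using hsub hv
    have := ih _ hlt hc rfl
    refine conn_mono ?_ this
    exact Finset.inter_subset_inter_right (Finset.erase_subset _ _)

/-- The bound on the number of faces: inserting a vertex that joins two components merges two faces
of its colour, any other vertex creates at most one face. -/
theorem sum_numClasses_le (c : Fin n → Fin d) (π : Equiv.Perm (Node n E)) (T : Finset (Fin n)) :
    (∑ k, numClasses (Equiv.Perm.SameCycle.setoid (linkPerm (colorClass c T k) * π)))
      + 2 * numClasses (conn π ∅)
      ≤ d * numClasses (conn π ∅) + T.card + 2 * numClasses (conn π T) := by
  induction T using Finset.induction_on with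
  | empty =>
    have : ∀ k, colorClass c ∅ k = ∅ := fun k => by simp [colorClass]
    simp only [this, linkPerm_empty, one_mul, conn_empty]
    simp
  | insert v T hv ih =>
    have hne : ∀ k, k ≠ c v → colorClass c (insert v T) k = colorClass c T k := by
      intro k hk
      ext w
      simp only [mem_colorClass, Finset.mem_insert]
      refine ⟨fun ⟨h, h'⟩ => ⟨h.resolve_left ?_, h'⟩, fun h => ⟨Or.inr h.1, h.2⟩⟩
      rintro rfl
      exact hk h'.symm
    have heq : colorClass c (insert v T) (c v) = insert v (colorClass c T (c v)) := by
      ext w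
      simp only [mem_colorClass, Finset.mem_insert]
      constructor
      · rintro ⟨h | h, h'⟩
        · exact Or.inl h
        · exact Or.inr ⟨h, h'⟩
      · rintro (rfl | h)
        · exact ⟨Or.inl rfl, rfl⟩
        · exact ⟨Or.inr h.1, h.2⟩
    have hv' : v ∉ colorClass c T (c v) := fun h => hv (mem_colorClass.1 h).1
    rw [← Finset.add_sum_erase _ _ (Finset.mem_univ (c v))] at ih ⊢
    rw [Finset.sum_congr rfl fun k hk => by rw [hne k (Finset.ne_of_mem_erase hk)], heq,
      linkPerm_insert hv', mul_assoc, conn_insert, Finset.card_insert_of_notMem hv]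
    by_cases hc : conn π T (Sum.inl (v, false)) (Sum.inl (v, true))
    · -- the number of components stays the same
      have h1 := numClasses_swap_mul_le (linkPerm (colorClass c T (c v)) * π)
        (Sum.inl (v, false)) (Sum.inl (v, true))
      have h2 : mergeClasses (conn π T) (Sum.inl (v, false)) (Sum.inl (v, true)) = conn π T :=
        le_antisymm (mergeClasses_le le_rfl hc) (le_mergeClasses _ _ _)
      rw [h2]
      omega
    · -- two components are joined, so the two faces were different
      have hc' : ¬ (linkPerm (colorClass c T (c v)) * π).SameCycle
          (Sum.inl (v, false)) (Sum.inl (v, true)) := fun h =>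
        hc (conn_mono (colorClass_subset _ _ _) (sameCycle_linkPerm_le _ h))
      have h1 := numClasses_mergeClasses _ hc
      have h2 := numClasses_mergeClasses (Equiv.Perm.SameCycle.setoid _) hc'
      rw [sameCycle_swap_mul_eq hc']
      omega

theorem sum_card_colorClass (c : Fin n → Fin d) :
    ∑ k, (colorClass c Finset.univ k).card = n := by
  have := Finset.card_eq_sum_card_fiberwise (s := Finset.univ) (t := Finset.univ)
    (f := c) (fun _ _ => by simp)
  rw [Finset.card_univ, Fintype.card_fin] at this
  exact this.symm

/-- A connected graph has the maximal number of faces if and only if it is a tree of cycles. -/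
theorem isAcyclic_iff_sum_numClasses (hd : 3 ≤ d) (G : FeynmanGraph d n E)
    (hconn : numClasses (conn G.2 Finset.univ) = 1) :
    IsAcyclic G.2 ↔
      ∑ k, numClasses (Equiv.Perm.SameCycle.setoid (G.facePerm k)) = (d - 1) * n + d := by
  obtain ⟨d, rfl⟩ := Nat.exists_eq_add_of_le' hd
  simp only [facePerm_eq]
  constructor
  · intro h
    have h1 : ∀ k, numClasses (Equiv.Perm.SameCycle.setoid
        (linkPerm (colorClass G.1 Finset.univ k) * G.2)) + (colorClass G.1 Finset.univ k).card
        = n + 1 := by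
      intro k
      rw [h.sameCycle_eq, h.numClasses_eq, h, hconn, add_comm]
    have h2 := Finset.sum_congr rfl fun k (_ : k ∈ Finset.univ) => h1 k
    rw [Finset.sum_add_distrib, sum_card_colorClass] at h2
    simp only [Finset.sum_const, Finset.card_univ, Fintype.card_fin, smul_eq_mul] at h2
    have e : (d + 3) * (n + 1) = ((d + 3 - 1) * n + (d + 3)) + n := by
      rw [show d + 3 - 1 = d + 2 by omega]; ring
    omega
  · intro h
    have h1 := sum_numClasses_le G.1 G.2 Finset.univ
    have h2 := numClasses_conn_empty_le G.2 Finset.univ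
    rw [h, hconn, Finset.card_univ, Fintype.card_fin] at h1
    rw [hconn, Finset.card_univ, Fintype.card_fin] at h2
    unfold IsAcyclic
    rw [hconn]
    refine le_antisymm h2 ?_
    set m := numClasses (conn G.2 ∅)
    -- the bound on the faces leaves the factor `d - 2`, which is positive
    rw [show d + 3 - 1 = d + 2 by omega] at h1
    have h3 : (d + 1) * (1 + n) ≤ (d + 1) * m := by nlinarith
    exact Nat.le_of_mul_le_mul_left h3 (by omega)

end Faces

section Melonic

variable {d n E : ℕ}

namespace FeynmanGraph

/-- Every external point is hooked to a vertex. -/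
def IsHooked (G : FeynmanGraph d n E) : Prop :=
  ∀ a : Fin E, (G.2 (Sum.inr a)).isLeft

theorem card_internalLine (G : FeynmanGraph d n E) (hG : G.IsHooked) :
    Fintype.card G.InternalLine + E = 2 * n := by
  have h1 : (∑ x, if (G.2 x).isLeft then 1 else 0) = 2 * n := by
    rw [Equiv.sum_comp G.2 (fun x => if x.isLeft then 1 else 0), Fintype.sum_sum_type]
    simp [mul_comm]
  rw [Fintype.sum_sum_type, Finset.sum_congr (s₂ := (Finset.univ : Finset (Fin E))) rfl
    fun a _ => if_pos (hG a)] at h1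
  rw [Fintype.card_subtype, Finset.card_filter, ← h1]
  simp

theorem card_internalFace (G : FeynmanGraph d n E) (k : Fin d) :
    Fintype.card (G.InternalFace k) + (Set.range fun a : Fin E => G.cycleOf k (Sum.inr a)).ncard
      = numClasses (Equiv.Perm.SameCycle.setoid (G.facePerm k)) := by
  have h := Set.ncard_add_ncard_compl (Set.range fun a : Fin E => G.cycleOf k (Sum.inr a))
  have h2 : Fintype.card (G.InternalFace k)
      = (Set.range fun a : Fin E => G.cycleOf k (Sum.inr a))ᶜ.ncard := by
    rw [← Nat.card_eq_fintype_card, ← Nat.card_coe_set_eq]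
    refine Nat.card_congr (Equiv.subtypeEquivRight fun f => ?_)
    simp [eq_comm]
  rw [h2, numClasses, ← h, add_comm]

theorem cycleOf_eq_iff (G : FeynmanGraph d n E) (k : Fin d) (x y : Node n E) :
    G.cycleOf k x = G.cycleOf k y ↔ (G.facePerm k).SameCycle x y :=
  ⟨fun h => Quotient.exact h, fun h => Quotient.sound h⟩

/-- A connected two-point graph is melonic if and only if it is a tree of cycles: it has one
external cycle in every colour and `2 n - 1` internal lines. -/
theorem isMelonic_iff_isAcyclic_one (hd : 3 ≤ d) (G : FeynmanGraph d n 1) (hG : G.IsHooked)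
    (hconn : numClasses (conn G.2 Finset.univ) = 1) : G.IsMelonic ↔ IsAcyclic G.2 := by
  rw [isAcyclic_iff_sum_numClasses hd G hconn, IsMelonic]
  have h1 : ∀ k, Fintype.card (G.InternalFace k) + 1
      = numClasses (Equiv.Perm.SameCycle.setoid (G.facePerm k)) := by
    intro k
    rw [← card_internalFace G k, Set.range_unique, Set.ncard_singleton]
  have h2 := Finset.sum_congr rfl fun k (_ : k ∈ Finset.univ) => h1 k
  rw [Finset.sum_add_distrib, Finset.sum_const, Finset.card_univ, Fintype.card_fin, smul_eq_mul,
    mul_one] at h2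
  rw [← h2]
  have h3 := G.card_internalLine hG
  have h4 : (Fintype.card G.InternalLine : ℤ) = 2 * n - 1 := by omega
  rw [h4]
  obtain ⟨d, rfl⟩ := Nat.exists_eq_add_of_le' hd
  rw [show d + 3 - 1 = d + 2 by omega]
  generalize ∑ k, Fintype.card (G.InternalFace k) = F
  push_cast
  constructor
  · intro h
    have : F = (d + 2) * n := by
      zify
      linear_combination h
    omega
  · intro h
    have : F = (d + 2) * n := by omega
    rw [this]
    push_cast
    ring

/-- A four-point graph whose two external points lie on a common face exactly in the colour `i` is
melonic if and only if it is a tree of cycles: it has `2 n - 2` internal lines, one cycle through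
the external points in the colour `i` and two of them in each of the other colours. -/
theorem isMelonic_iff_isAcyclic_two (hd : 3 ≤ d) (G : FeynmanGraph d n 2) (hG : G.IsHooked)
    (hconn : numClasses (conn G.2 Finset.univ) = 1) {i : Fin d}
    (hi : (G.facePerm i).SameCycle (Sum.inr 0) (Sum.inr 1))
    (hb : ∀ k, k ≠ i → ¬ (G.facePerm k).SameCycle (Sum.inr 0) (Sum.inr 1)) :
    G.IsMelonic ↔ IsAcyclic G.2 := by
  rw [isAcyclic_iff_sum_numClasses hd G hconn, IsMelonic]
  have hr : ∀ k, (Set.range fun a : Fin 2 => G.cycleOf k (Sum.inr a))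
      = {G.cycleOf k (Sum.inr 0), G.cycleOf k (Sum.inr 1)} := by
    intro k
    ext f
    simp [Fin.exists_fin_two, eq_comm]
  have h1 : ∀ k, (Fintype.card (G.InternalFace k) + 2 : ℤ)
      = numClasses (Equiv.Perm.SameCycle.setoid (G.facePerm k)) + if k = i then 1 else 0 := by
    intro k
    rw [← card_internalFace G k, hr]
    split_ifs with hk
    · subst hk
      rw [(G.cycleOf_eq_iff _ _ _).2 hi, Set.pair_eq_singleton, Set.ncard_singleton]
      push_cast
      ring
    · rw [Set.ncard_pair fun h => hb k hk ((G.cycleOf_eq_iff _ _ _).1 h)]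
      push_cast
      ring
  have h2 := Finset.sum_congr rfl fun k (_ : k ∈ Finset.univ) => h1 k
  rw [Finset.sum_add_distrib, Finset.sum_add_distrib, Finset.sum_const, Finset.card_univ,
    Fintype.card_fin, nsmul_eq_mul, Finset.sum_ite_eq' Finset.univ i, if_pos (Finset.mem_univ i),
    ← Nat.cast_sum, ← Nat.cast_sum] at h2
  have h3 := G.card_internalLine hG
  have h4 : (Fintype.card G.InternalLine : ℤ) = 2 * n - 2 := by omega
  rw [h4]
  obtain ⟨d, rfl⟩ := Nat.exists_eq_add_of_le' hd
  rw [show d + 3 - 1 = d + 2 by omega]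
  generalize ∑ k, Fintype.card (G.InternalFace k) = F at h2 ⊢
  generalize ∑ k, numClasses (Equiv.Perm.SameCycle.setoid (G.facePerm k)) = F' at h2 ⊢
  push_cast at h2 ⊢
  constructor
  · intro h
    zify
    linear_combination h - h2
  · intro h
    zify at h
    linear_combination h + h2

/-! ### One-particle irreducibility -/

theorem skeleton_rel {G : FeynmanGraph d n E} {S : Set (Fin n × Bool)} {r : Setoid (Node n E)}
    (hv : ∀ v b b', r (Sum.inl (v, b)) (Sum.inl (v, b')))
    (hl : ∀ e, e ∉ S → (G.2 (Sum.inl e)).isLeft → r (Sum.inl e) (G.2 (Sum.inl e)))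
    {v w : Fin n} (h : (G.skeleton S).Reachable v w) (b b' : Bool) :
    r (Sum.inl (v, b)) (Sum.inl (w, b')) := by
  have key : ∀ v w : Fin n, (G.skeleton S).Adj v w → r (Sum.inl (v, b)) (Sum.inl (w, b)) := by
    intro v w hvw
    rw [skeleton, SimpleGraph.fromRel_adj] at hvw
    rcases hvw with ⟨-, ⟨b₁, b₂, hS, h⟩ | ⟨b₁, b₂, hS, h⟩⟩
    · have := hl _ hS (by rw [h]; rfl)
      rw [h] at this
      exact r.trans (hv v b b₁) (r.trans this (hv w b₂ b))
    · have := hl _ hS (by rw [h]; rfl)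
      rw [h] at this
      exact r.symm (r.trans (hv w b b₁) (r.trans this (hv v b₂ b)))
  obtain ⟨p⟩ := h
  have : r (Sum.inl (v, b)) (Sum.inl (w, b)) := by
    induction p with
    | nil => exact r.refl _
    | cons h _ ih => exact r.trans (key _ _ h) ih
  exact r.trans this (hv _ _ _)

theorem conn_of_isOnePI {G : FeynmanGraph d n E} (hG : G.IsOnePI) (x y : Node n E) :
    conn G.2 Finset.univ x y := by
  obtain ⟨hh, hc, -⟩ := hG
  set r := conn G.2 Finset.univ
  have hin : ∀ v b w b', r (Sum.inl (v, b)) (Sum.inl (w, b')) := fun v b w b' =>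
    skeleton_rel (S := ∅) (fun v b b' => conn_link (by simp) b b')
      (fun e _ _ => conn_step _ _ _) (hc.preconnected v w) b b'
  have hout : ∀ x : Node n E, ∃ v b, r x (Sum.inl (v, b)) := by
    rintro (⟨v, b⟩ | a)
    · exact ⟨v, b, r.refl _⟩
    · obtain ⟨⟨v, b⟩, h⟩ := Sum.isLeft_iff.1 (hh a)
      exact ⟨v, b, h ▸ conn_step _ _ _⟩
  obtain ⟨v, b, hx⟩ := hout x
  obtain ⟨w, b', hy⟩ := hout y
  exact r.trans hx (r.trans (hin v b w b') (r.symm hy))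

theorem numClasses_eq_one {α : Type*} [Finite α] {r : Setoid α} (x : α) (h : ∀ y, r y x) :
    numClasses r = 1 := by
  refine Nat.card_eq_one_iff_unique.2 ⟨⟨fun p q => ?_⟩, ⟨Quotient.mk r x⟩⟩
  induction p using Quotient.inductionOn'
  induction q using Quotient.inductionOn'
  exact Quotient.sound (r.trans (h _) (r.symm (h _)))

/-- In a tree of cycles, a line that is not a bridge lies on a cycle all of whose other lines are
internal. Hence the external line of a one-particle irreducible tree returns to an external point
after one field. -/
theorem not_isLeft_of_isOnePI {G : FeynmanGraph d n E} (hG : G.IsOnePI) (ht : IsAcyclic G.2)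
    (a : Fin E) : ¬ (G.2 (G.2 (Sum.inr a))).isLeft := by
  intro hl
  obtain ⟨⟨v, b⟩, hv⟩ := Sum.isLeft_iff.1 (hG.1 a)
  obtain ⟨⟨w, b'⟩, hw⟩ := Sum.isLeft_iff.1 hl
  have hw' : G.2 (Sum.inl (v, b)) = Sum.inl (w, b') := by rw [← hv, hw]
  have hne : (Sum.inl (v, b) : Node n E) ≠ Sum.inr a := by simp
  set π' := G.2 * Equiv.swap (Sum.inr a) (Sum.inl (v, b)) with hπ'
  have hcut := hG.2.2 ⟨(v, b), by rw [hw']; rfl⟩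
  set r := conn π' Finset.univ
  have hstep : ∀ z, z ≠ Sum.inr a → z ≠ Sum.inl (v, b) → r z (G.2 z) := by
    intro z h1 h2
    rw [← peel_apply_of_ne G.2 h1 h2]
    exact conn_step _ _ _
  have hin : ∀ u c, r (Sum.inl (u, c)) (Sum.inl (w, b')) := fun u c =>
    skeleton_rel (S := {(v, b)}) (fun v b b' => conn_link (by simp) b b')
      (fun e he _ => hstep _ (by simp) (by simpa using he)) (hcut.preconnected u w) c b'
  have hall : ∀ z, r z (Sum.inl (w, b')) := by
    rintro (⟨u, c⟩ | a')
    · exact hin u c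
    · by_cases ha : a' = a
      · subst ha
        have := conn_step π' Finset.univ (Sum.inr a')
        rwa [hπ', peel_apply_left, hw'] at this
      · obtain ⟨⟨u, c⟩, hu⟩ := Sum.isLeft_iff.1 (hG.1 a')
        have := hstep (Sum.inr a') (by simpa using ha) (by simp)
        rw [hu] at this
        exact r.trans this (hin u c)
  -- cutting the field out creates one more cycle and leaves the graph connected, but a connected
  -- graph has at most `n + 1` cycles
  have h1 : numClasses (conn π' Finset.univ) = 1 := numClasses_eq_one _ hall
  have h2 : numClasses (conn G.2 Finset.univ) = 1 :=
    numClasses_eq_one (Sum.inr a) fun y => conn_of_isOnePI hG y (Sum.inr a)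
  have h3 := numClasses_peel hv hne
  rw [← hπ'] at h3
  have h4 := numClasses_conn_empty_le π' Finset.univ
  rw [Finset.card_univ, Fintype.card_fin] at h4
  unfold IsAcyclic at ht
  omega

/-- If every external point forms a loop with one field of a vertex, then a connected graph is
one-particle irreducible: any other line lies on a cycle of internal lines. -/
theorem isOnePI_of_loops {G : FeynmanGraph d n E} (a₀ : Fin E) (hh : G.IsHooked)
    (hloop : ∀ a : Fin E, G.2 (G.2 (Sum.inr a)) = Sum.inr a)
    (hconn : ∀ x y, conn G.2 Finset.univ x y) : G.IsOnePI := by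
  have hout : ∀ z, (G.2 z).isLeft = false → ∃ a, G.2 z = Sum.inr a := by
    intro z h
    rcases hz : G.2 z with e | a
    · rw [hz] at h; cases h
    · exact ⟨a, rfl⟩
  -- the vertex of a node; for an external point, the vertex it is hooked to
  let vert : Node n E → Fin n := Sum.elim Prod.fst fun a => ((G.2 (Sum.inr a)).getLeft (hh a)).1
  have hvert : ∀ a v b, G.2 (Sum.inr a) = Sum.inl (v, b) → vert (Sum.inr a) = v := by
    intro a v b h
    simp [vert, h]
  have hadj : ∀ (S : Set (Fin n × Bool)) (e e' : Fin n × Bool), e ∉ S →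
      G.2 (Sum.inl e) = Sum.inl e' → (G.skeleton S).Reachable e.1 e'.1 := by
    intro S e e' he h
    by_cases hne : e.1 = e'.1
    · rw [hne]
    · refine SimpleGraph.Adj.reachable ?_
      rw [skeleton, SimpleGraph.fromRel_adj]
      exact ⟨hne, Or.inl ⟨e.2, e'.2, he, h⟩⟩
  have main : ∀ S : Set (Fin n × Bool), (∀ e ∈ S, ∀ e', G.2 (Sum.inl e) = Sum.inl e' →
      (G.skeleton S).Reachable e.1 e'.1) → (G.skeleton S).Connected := by
    intro S hS
    have hle : conn G.2 Finset.univ ≤ ((G.skeleton S).reachableSetoid).comap vert := by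
      refine conn_le (fun x => ?_) fun v _ => ?_
      · rw [Setoid.comap_rel]
        change (G.skeleton S).Reachable _ _
        rcases x with e | a
        · rcases hx : G.2 (Sum.inl e) with e' | a
          · by_cases he : e ∈ S
            · exact hS e he e' hx
            · exact hadj S e e' he hx
          · have : G.2 (Sum.inr a) = Sum.inl e :=
              G.2.injective (by rw [hloop, hx])
            rw [hvert a e.1 e.2 this]
            rfl
        · obtain ⟨⟨v, b⟩, h⟩ := Sum.isLeft_iff.1 (hh a)
          rw [hvert a v b h, h]
          rfl
      · exact ((G.skeleton S).reachableSetoid).refl _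
    obtain ⟨⟨v₀, b₀⟩, -⟩ := Sum.isLeft_iff.1 (hh a₀)
    have : Nonempty (Fin n) := ⟨v₀⟩
    exact ⟨fun v w => hle (hconn (Sum.inl (v, false)) (Sum.inl (w, false)))⟩
  refine ⟨hh, main ∅ (by simp), ?_⟩
  rintro ⟨e, he⟩
  refine main {e} ?_
  intro f hf e' hee'
  rw [Set.mem_singleton_iff] at hf
  rw [hf] at hee' ⊢
  -- follow the cycle of the line from its end `e'` back to its start `e`
  have hex : ∃ m, (G.2 ^ m) (Sum.inl e') = Sum.inl e := by
    refine ⟨orderOf G.2 - 1, ?_⟩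
    rw [← hee', ← Equiv.Perm.mul_apply, ← pow_succ, Nat.sub_add_cancel (orderOf_pos G.2),
      pow_orderOf_eq_one]
    rfl
  have hleft : ∀ m, ((G.2 ^ m) (Sum.inl e')).isLeft := by
    intro m
    by_contra hm
    have hm' : ((G.2 ^ m) (Sum.inl e')).isRight := by simpa using hm
    obtain ⟨a, ha⟩ := Sum.isRight_iff.1 hm'
    -- an external point on the cycle would be the end of the line
    have hinv : ∀ j, (G.2 ^ j) (Sum.inr a) = Sum.inr a ∨
        (G.2 ^ j) (Sum.inr a) = G.2 (Sum.inr a) := by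
      intro j
      induction j with
      | zero => exact Or.inl rfl
      | succ j ih =>
        rw [pow_succ', Equiv.Perm.mul_apply]
        rcases ih with h | h
        · exact Or.inr (by rw [h])
        · exact Or.inl (by rw [h, hloop])
    obtain ⟨j, -, hj⟩ := (show G.2.SameCycle (Sum.inr a) (Sum.inl e) from
      ((show G.2.SameCycle (Sum.inl e) (Sum.inr a) from
        ⟨(m + 1 : ℕ), by rw [zpow_natCast, pow_succ, Equiv.Perm.mul_apply, hee', ha]⟩).symm)
      ).exists_pow_eq'
    rcases hinv j with h | h
    · rw [h] at hj; cases hj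
    · rw [h] at hj
      rw [← hj, hloop] at hee'
      cases hee'
  have key : ∀ m ≤ Nat.find hex, ∀ e'', (G.2 ^ m) (Sum.inl e') = Sum.inl e'' →
      (G.skeleton {e}).Reachable e'.1 e''.1 := by
    intro m
    induction m with
    | zero =>
      intro _ e'' h
      have : e' = e'' := by simpa using h
      rw [this]
    | succ m ih =>
      intro hm e'' h
      obtain ⟨f, hf⟩ := Sum.isLeft_iff.1 (hleft m)
      refine (ih (by omega) f hf).trans (hadj _ f e'' ?_ ?_)
      · intro hfe
        refine Nat.find_min hex (show m < Nat.find hex by omega) ?_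
        rw [hf, hfe]
      · rw [← hf, ← h, pow_succ', Equiv.Perm.mul_apply]
  exact (key _ le_rfl e (Nat.find_spec hex)).symm

end FeynmanGraph

end Melonic

namespace FeynmanGraph

variable {d n : ℕ}

/-- The one-particle irreducible melonic two-point graphs are the trees of cycles in which the
external point forms a loop with one field of a vertex. -/
theorem isOnePI_and_isMelonic_iff (hd : 3 ≤ d) (G : FeynmanGraph d n 1) :
    G.IsOnePI ∧ G.IsMelonic ↔ IsForest Finset.univ {Sum.inr 0} ∅ G.2 ∧
      G.2 (G.2 (Sum.inr 0)) = Sum.inr 0 ∧ G.2 (Sum.inr 0) ≠ Sum.inr 0 := by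
  have hcard : Fintype.card (Node n 1) = 2 * n + 1 := by simp [mul_comm]
  constructor
  · rintro ⟨h1, h2⟩
    have hconn := conn_of_isOnePI h1
    have hnc : numClasses (conn G.2 Finset.univ) = 1 :=
      numClasses_eq_one (Sum.inr 0) fun y => hconn y _
    have ht := (isMelonic_iff_isAcyclic_one hd G h1.1 hnc).1 h2
    refine ⟨⟨?_, fun x _ => ⟨Sum.inr 0, by simp, hconn _ _⟩, ?_⟩, ?_, ?_⟩
    · rintro (⟨v, b⟩ | a) hA - hb
      · simp at hb
      · rw [Subsingleton.elim a 0] at hA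
        simp at hA
    · rw [ht, hnc, hcard]
      simp only [Finset.card_univ, Fintype.card_fin, Finset.card_empty]
      omega
    · have := not_isLeft_of_isOnePI h1 ht 0
      rcases h : G.2 (G.2 (Sum.inr 0)) with e | a
      · rw [h] at this; exact absurd rfl this
      · rw [Subsingleton.elim a 0]
    · intro h
      have := h1.1 0
      rw [h] at this
      cases this
  · rintro ⟨hf, hl, hne⟩
    have hr : ∀ x, conn G.2 Finset.univ x (Sum.inr 0) := by
      rintro (⟨v, b⟩ | a)
      · obtain ⟨a, ha, h⟩ := hf.reach (Sum.inl (v, b)) (by simp)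
        rw [Finset.mem_singleton] at ha
        rwa [ha] at h
      · rw [Subsingleton.elim a 0]
    have hnc : numClasses (conn G.2 Finset.univ) = 1 := numClasses_eq_one (Sum.inr 0) hr
    have ht : IsAcyclic G.2 := by
      have := hf.count
      rw [hcard] at this
      simp only [Finset.card_univ, Fintype.card_fin, Finset.card_empty] at this
      unfold IsAcyclic
      omega
    have hh : G.IsHooked := by
      intro a
      rw [Subsingleton.elim a 0]
      rcases h : G.2 (Sum.inr 0) with e | a
      · rfl
      · rw [Subsingleton.elim a 0] at h
        exact absurd h hne
    refine ⟨isOnePI_of_loops 0 hh (fun a => ?_) fun x y =>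
      (conn _ _).trans (hr x) ((conn _ _).symm (hr y)),
      (isMelonic_iff_isAcyclic_one hd G hh hnc).2 ht⟩
    rw [Subsingleton.elim a 0, hl]

/-- The one-particle irreducible melonic four-point graphs whose boundary graph is the bubble of
colour `i`, with the external points paired such that they share the face of colour `i`. -/
theorem isOnePI_and_isMelonic_and_hasBoundary_iff (hd : 3 ≤ d) (G : FeynmanGraph d n 2)
    (i : Fin d) :
    (G.IsOnePI ∧ G.IsMelonic ∧ G.HasBoundary i) ∧
        (G.facePerm i).SameCycle (Sum.inr 0) (Sum.inr 1) ↔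
      IsForest Finset.univ {Sum.inr 0} {Sum.inr 1} G.2 ∧
        (IsMarked Finset.univ i (Sum.inr 1) (Sum.inr 0) G.1 G.2 ∧
          G.2 (Sum.inr 1) ≠ Sum.inr 0) ∧ G.2 (G.2 (Sum.inr 0)) = Sum.inr 0 := by
  have hcard : Fintype.card (Node n 2) = 2 * n + 2 := by simp [mul_comm]
  have hle : ∀ k, Equiv.Perm.SameCycle.setoid (G.facePerm k)
      ≤ conn G.2 (colorClass G.1 Finset.univ k) := by
    intro k
    rw [facePerm_eq]
    exact sameCycle_linkPerm_le _
  constructor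
  · rintro ⟨⟨h1, h2, h3⟩, hi⟩
    have hb : ∀ k, k ≠ i → ¬ (G.facePerm k).SameCycle (Sum.inr 0) (Sum.inr 1) :=
      fun k hk h => (h3 k hk).1 h hi
    have hconn := conn_of_isOnePI h1
    have hnc : numClasses (conn G.2 Finset.univ) = 1 :=
      numClasses_eq_one (Sum.inr 0) fun y => hconn y _
    have ht := (isMelonic_iff_isAcyclic_two hd G h1.1 hnc hi hb).1 h2
    -- the external points do not lie on the same cycle of the contraction
    have hcyc : ¬ conn G.2 ∅ (Sum.inr 0) (Sum.inr 1) := by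
      intro h
      obtain ⟨k, hk⟩ : ∃ k : Fin d, k ≠ i := by
        have : Nontrivial (Fin d) := Fin.nontrivial_iff_two_le.2 (by omega)
        exact exists_ne i
      refine hb k hk ?_
      change Equiv.Perm.SameCycle.setoid (G.facePerm k) _ _
      rw [facePerm_eq, ht.sameCycle_eq]
      exact conn_mono (Finset.empty_subset _) h
    have hloop : ∀ a, G.2 (G.2 (Sum.inr a)) = Sum.inr a := by
      intro a
      have hn := not_isLeft_of_isOnePI h1 ht a
      rcases h : G.2 (G.2 (Sum.inr a)) with e | a'
      · rw [h] at hn; exact absurd rfl hn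
      · have hc : conn G.2 ∅ (Sum.inr a) (Sum.inr a') := by
          rw [← h]
          exact (conn _ _).trans (conn_step _ _ _) (conn_step _ _ _)
        fin_cases a <;> fin_cases a'
        · rfl
        · exact absurd hc hcyc
        · exact absurd ((conn _ _).symm hc) hcyc
        · rfl
    refine ⟨⟨?_, fun x _ => ⟨Sum.inr 0, by simp, hconn _ _⟩, ?_⟩,
      ⟨⟨(conn _ _).symm (hle i hi), hloop 1⟩, ?_⟩, hloop 0⟩
    · rintro (⟨v, b⟩ | a) hA hY hb
      · simp at hb
      · fin_cases a
        · simp at hA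
        · simp at hY
    · rw [ht, hnc, hcard]
      simp only [Finset.card_univ, Fintype.card_fin, Finset.card_singleton]
      omega
    · intro h
      have := h1.1 1
      rw [h] at this
      cases this
  · rintro ⟨hf, ⟨hm, hne⟩, hl⟩
    have hr : ∀ x, conn G.2 Finset.univ x (Sum.inr 0) := by
      have : ∀ x : Node n 2, x ∈ body Finset.univ ∨ x ∈ ({Sum.inr 1} : Finset (Node n 2)) →
          conn G.2 Finset.univ x (Sum.inr 0) := by
        intro x hx
        obtain ⟨a, ha, h⟩ := hf.reach x hx
        rw [Finset.mem_singleton] at ha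
        rwa [ha] at h
      rintro (⟨v, b⟩ | a)
      · exact this _ (by simp)
      · fin_cases a
        · exact (conn _ _).refl _
        · exact this _ (by simp)
    have hnc : numClasses (conn G.2 Finset.univ) = 1 := numClasses_eq_one (Sum.inr 0) hr
    have ht : IsAcyclic G.2 := by
      have := hf.count
      rw [hcard] at this
      simp only [Finset.card_univ, Fintype.card_fin, Finset.card_singleton] at this
      unfold IsAcyclic
      omega
    have h0 : (G.2 (Sum.inr 0)).isLeft := by
      rcases h : G.2 (Sum.inr 0) with e | a
      · rfl
      · exfalso
        fin_cases a
        · have := eq_of_conn_of_fixed h (by simp) ((conn _ _).symm hm.face)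
          simp at this
        · exact hne (by rw [← hl]; exact congrArg G.2 h.symm)
    have h1 : (G.2 (Sum.inr 1)).isLeft := by
      rcases h : G.2 (Sum.inr 1) with e | a
      · rfl
      · exfalso
        fin_cases a
        · exact hne h
        · have := eq_of_conn_of_fixed h (by simp) hm.face
          simp at this
    have hh : G.IsHooked := by
      intro a
      fin_cases a
      · exact h0
      · exact h1
    have hi : (G.facePerm i).SameCycle (Sum.inr 0) (Sum.inr 1) := by
      change Equiv.Perm.SameCycle.setoid (G.facePerm i) _ _
      rw [facePerm_eq, ht.sameCycle_eq]
      exact (conn _ _).symm hm.face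
    have hb : ∀ k, k ≠ i → ¬ (G.facePerm k).SameCycle (Sum.inr 0) (Sum.inr 1) := by
      -- a common face in two colours would put both external points on the same cycle of the
      -- contraction, which consists of the point `0` and one field
      intro k hk h
      have h2 := ht.conn_inter ((conn _ _).symm hm.face) (hle k h)
      have h3 : colorClass G.1 Finset.univ i ∩ colorClass G.1 Finset.univ k = ∅ := by
        ext v
        simp only [Finset.mem_inter, mem_colorClass, Finset.notMem_empty, iff_false]
        rintro ⟨⟨-, h⟩, -, h'⟩
        exact hk (h'.symm.trans h)
      rw [h3] at h2
      have hle0 : conn G.2 ∅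
          ≤ Setoid.ker fun z => z = Sum.inr 0 ∨ z = G.2 (Sum.inr 0) := by
        refine conn_le (fun z => propext ⟨?_, ?_⟩) (by simp)
        · rintro (rfl | rfl)
          · exact Or.inr rfl
          · exact Or.inl hl
        · rintro (h | h)
          · exact Or.inr (G.2.injective (h.trans hl.symm))
          · exact Or.inl (G.2.injective h)
      have h4 : (Sum.inr 1 : Node n 2) = Sum.inr 0 ∨ (Sum.inr 1 : Node n 2) = G.2 (Sum.inr 0) :=
        (show (_ ∨ _) = (_ ∨ _) from hle0 h2).mp (Or.inl rfl)
      rcases h4 with h4 | h4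
      · simp at h4
      · rw [← h4] at h0
        cases h0
    refine ⟨⟨isOnePI_of_loops 0 hh (fun a => ?_) fun x y =>
      (conn _ _).trans (hr x) ((conn _ _).symm (hr y)),
      (isMelonic_iff_isAcyclic_two hd G hh hnc hi hb).2 ht, fun k hk => ?_⟩, hi⟩
    · fin_cases a
      · exact hl
      · exact hm.loop
    · exact iff_of_false (hb k hk) (not_not.2 hi)

/-! ### Exchanging the external points -/

/-- The four-point graph with the two external points of type `T̄` exchanged. -/
def exchange (G : FeynmanGraph d n 2) : FeynmanGraph d n 2 :=
  (G.1, Equiv.swap (Sum.inr 0) (Sum.inr 1) * G.2)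

theorem exchange_exchange (G : FeynmanGraph d n 2) : G.exchange.exchange = G := by
  simp [exchange, ← mul_assoc]

/-- The exchange of the external points as a bijection of the four-point graphs. -/
def exchangeEquiv (d n : ℕ) : FeynmanGraph d n 2 ≃ FeynmanGraph d n 2 :=
  Function.Involutive.toPerm exchange exchange_exchange

theorem facePerm_exchange (G : FeynmanGraph d n 2) (k : Fin d) :
    G.exchange.facePerm k = Equiv.swap (Sum.inr 0) (Sum.inr 1) * G.facePerm k := by
  rw [facePerm_eq, facePerm_eq, exchange, ← mul_assoc, ← mul_assoc]
  congr 1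
  ext1 x
  rw [Equiv.Perm.mul_apply, Equiv.Perm.mul_apply]
  rcases x with ⟨v, b⟩ | a
  · rw [Equiv.swap_apply_of_ne_of_ne (by simp) (by simp), linkPerm_inl,
      Equiv.swap_apply_of_ne_of_ne (by simp) (by simp)]
  · fin_cases a
    · simp [linkPerm_inr]
    · simp [linkPerm_inr]

theorem exchange_apply_eq_inl_iff (G : FeynmanGraph d n 2) (x : Node n 2) (e : Fin n × Bool) :
    G.exchange.2 x = Sum.inl e ↔ G.2 x = Sum.inl e := by
  rw [exchange, Equiv.Perm.mul_apply]
  generalize G.2 x = y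
  rcases y with e' | a
  · rw [Equiv.swap_apply_of_ne_of_ne (by simp) (by simp)]
  · fin_cases a <;> simp

theorem isLeft_exchange_apply (G : FeynmanGraph d n 2) (x : Node n 2) :
    (G.exchange.2 x).isLeft = (G.2 x).isLeft := by
  rw [Bool.eq_iff_iff, Sum.isLeft_iff, Sum.isLeft_iff]
  simp only [exchange_apply_eq_inl_iff]

theorem skeleton_exchange (G : FeynmanGraph d n 2) (S : Set (Fin n × Bool)) :
    G.exchange.skeleton S = G.skeleton S := by
  simp only [skeleton, exchange_apply_eq_inl_iff]

theorem isOnePI_exchange (G : FeynmanGraph d n 2) : G.exchange.IsOnePI ↔ G.IsOnePI := by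
  simp only [IsOnePI, isLeft_exchange_apply, skeleton_exchange, Subtype.forall]

theorem sameCycle_exchange (G : FeynmanGraph d n 2) (k : Fin d) :
    (G.exchange.facePerm k).SameCycle (Sum.inr 0) (Sum.inr 1) ↔
      ¬ (G.facePerm k).SameCycle (Sum.inr 0) (Sum.inr 1) := by
  rw [facePerm_exchange]
  exact ⟨fun h h' => not_sameCycle_swap_mul (by simp) h' h, sameCycle_swap_mul_of_not⟩

theorem hasBoundary_exchange (G : FeynmanGraph d n 2) (i : Fin d) :
    G.exchange.HasBoundary i ↔ G.HasBoundary i := by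
  simp only [HasBoundary, sameCycle_exchange]
  refine forall₂_congr fun k _ => ?_
  tauto

theorem card_internalFace_exchange (G : FeynmanGraph d n 2) (k : Fin d) :
    Fintype.card (G.exchange.InternalFace k) = Fintype.card (G.InternalFace k) := by
  have hr : ∀ G : FeynmanGraph d n 2, (Set.range fun a : Fin 2 => G.cycleOf k (Sum.inr a))
      = {G.cycleOf k (Sum.inr 0), G.cycleOf k (Sum.inr 1)} := by
    intro G
    ext f
    simp [Fin.exists_fin_two, eq_comm]
  have key : ∀ G : FeynmanGraph d n 2, ¬ (G.facePerm k).SameCycle (Sum.inr 0) (Sum.inr 1) →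
      Fintype.card (G.exchange.InternalFace k) = Fintype.card (G.InternalFace k) := by
    intro G h
    have h' := (G.sameCycle_exchange k).2 h
    have h1 := card_internalFace G k
    have h2 := card_internalFace G.exchange k
    have h3 := numClasses_mergeClasses (Equiv.Perm.SameCycle.setoid (G.facePerm k)) h
    rw [hr, Set.ncard_pair fun he => h ((G.cycleOf_eq_iff _ _ _).1 he)] at h1
    rw [hr, (G.exchange.cycleOf_eq_iff _ _ _).2 h', Set.pair_eq_singleton, Set.ncard_singleton,
      facePerm_exchange, sameCycle_swap_mul_eq h] at h2
    omega
  by_cases h : (G.facePerm k).SameCycle (Sum.inr 0) (Sum.inr 1)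
  · have := key G.exchange (fun h' => (G.sameCycle_exchange k).1 h' h)
    rw [exchange_exchange] at this
    exact this.symm
  · exact key G h

/-- Internal lines are unchanged by the exchange. -/
def internalLineExchange (G : FeynmanGraph d n 2) : G.exchange.InternalLine ≃ G.InternalLine :=
  Equiv.subtypeEquivRight fun e => by rw [isLeft_exchange_apply]

theorem isMelonic_exchange (G : FeynmanGraph d n 2) : G.exchange.IsMelonic ↔ G.IsMelonic := by
  simp only [IsMelonic, card_internalFace_exchange, Fintype.card_congr G.internalLineExchange]

end FeynmanGraph

/-! ### Amplitudes as sums over momentum assignments -/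

section Amplitude

variable {d n E Λ : ℕ} {R : Type*}

/-- An assignment of momenta to the lines that is constant along the faces, takes the value `r` on
the external faces and values of `emb` on the internal faces. -/
structure IsFaceLabelling (emb : Momentum Λ → R) (r : Fin d → R) (G : FeynmanGraph d n E)
    (μ : Node n E → Fin d → R) : Prop where
  face : ∀ k x, μ (G.facePerm k x) k = μ x k
  ext : ∀ a, μ (Sum.inr a) = r
  loops : ∀ x k, (∀ a : Fin E, ¬ (G.facePerm k).SameCycle x (Sum.inr a)) →
    μ x k ∈ Set.range emb

variable {emb : Momentum Λ → R} {r : Fin d → R} {G : FeynmanGraph d n E}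
  {μ : Node n E → Fin d → R}

theorem IsFaceLabelling.eq_of_sameCycle (h : IsFaceLabelling emb r G μ) {k : Fin d}
    {x y : Node n E} (hxy : (G.facePerm k).SameCycle x y) : μ x k = μ y k := by
  have hle : Equiv.Perm.SameCycle.setoid (G.facePerm k) ≤ Setoid.ker fun z => μ z k :=
    sameCycle_le fun x => (h.face k x).symm
  exact hle hxy

/-- The propagator of a line, as a function of its momentum. -/
def lineFactor (B : Counterterms) (val : R → ℝ) (q : Fin d → R) : ℝ⟦X⟧ :=
  (kinetic B fun k => val (q k))⁻¹

open Classical in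
/-- The sum over the momenta of the internal faces as a sum over the momenta of the lines. -/
theorem amplitude_eq [Fintype R] (B : Counterterms) {val : R → ℝ} {p : Fin d → ℝ}
    (hemb : Function.Injective emb) (hval : ∀ m, val (emb m) = ((m : ℤ) : ℝ))
    (hp : ∀ k, val (r k) = p k) (G : FeynmanGraph d n E) :
    amplitude Λ B G p = ∑ μ : Node n E → Fin d → R, if IsFaceLabelling emb r G μ then
      ∏ e : G.InternalLine, lineFactor B val (μ (Sum.inl e.1)) else 0 := by
  rw [amplitude, ← Finset.sum_filter]
  let φ : (∀ k, G.InternalFace k → Momentum Λ) → Node n E → Fin d → R := fun m x k =>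
    if h : ∀ a : Fin E, G.cycleOf k x ≠ G.cycleOf k (Sum.inr a) then
      emb (m k ⟨G.cycleOf k x, h⟩) else r k
  have hφ : ∀ m x k, val (φ m x k) = lineMomentum G p m x k := by
    intro m x k
    by_cases h : ∀ a : Fin E, G.cycleOf k x ≠ G.cycleOf k (Sum.inr a)
    · simp only [φ, lineMomentum, dif_pos h, hval]
    · simp only [φ, lineMomentum, dif_neg h, hp]
  have hcyc : ∀ k x y, (G.facePerm k).SameCycle x y → G.cycleOf k x = G.cycleOf k y :=
    fun k x y h => (G.cycleOf_eq_iff k x y).2 h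
  refine Finset.sum_nbij φ ?_ ?_ ?_ ?_
  · intro m _
    rw [Finset.mem_filter]
    refine ⟨Finset.mem_univ _, fun k x => ?_, fun a => ?_, fun x k h => ?_⟩
    · have : G.cycleOf k (G.facePerm k x) = G.cycleOf k x :=
        (hcyc k _ _ (sameCycle_step (G.facePerm k) x)).symm
      simp only [φ, this]
    · funext k
      simp only [φ]
      rw [dif_neg]
      push Not
      exact ⟨a, rfl⟩
    · have h' : ∀ a : Fin E, G.cycleOf k x ≠ G.cycleOf k (Sum.inr a) :=
        fun a ha => h a ((G.cycleOf_eq_iff _ _ _).1 ha)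
      simp only [φ, dif_pos h']
      exact ⟨_, rfl⟩
  · intro m _ m' _ hmm
    funext k f
    obtain ⟨f, hf⟩ := f
    induction f using Quotient.inductionOn' with
    | h x =>
      have := congrFun (congrFun hmm x) k
      simp only [φ] at this
      have hf' : ∀ a : Fin E, G.cycleOf k x ≠ G.cycleOf k (Sum.inr a) := hf
      rw [dif_pos hf', dif_pos hf'] at this
      exact hemb this
  · intro μ hμ
    have hμ : IsFaceLabelling emb r G μ := by simpa using hμ
    have hex : ∀ k (f : G.InternalFace k), ∃ m, emb m = μ (Quotient.out f.1) k := by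
      intro k f
      refine hμ.loops _ _ fun a ha => f.2 a ?_
      rw [← hcyc k _ _ ha]
      exact (Quotient.out_eq f.1).symm
    choose m hm using hex
    refine ⟨m, by simp, ?_⟩
    funext x k
    by_cases h : ∀ a : Fin E, G.cycleOf k x ≠ G.cycleOf k (Sum.inr a)
    · simp only [φ, dif_pos h, hm]
      exact hμ.eq_of_sameCycle
        ((G.cycleOf_eq_iff k _ _).1 (Quotient.out_eq (G.cycleOf k x)))
    · simp only [φ, dif_neg h]
      push Not at h
      obtain ⟨a, ha⟩ := h
      rw [hμ.eq_of_sameCycle ((G.cycleOf_eq_iff _ _ _).1 ha), hμ.ext]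
  · intro m _
    refine Finset.prod_congr rfl fun e _ => ?_
    rw [lineFactor]
    congr 2
    funext k
    exact (hφ m _ k).symm

theorem IsFaceLabelling.exchange {G : FeynmanGraph d n 2} {μ : Node n 2 → Fin d → R}
    (h : IsFaceLabelling emb r G μ) : IsFaceLabelling emb r G.exchange μ := by
  refine ⟨fun k x => ?_, h.ext, fun x k hx => h.loops x k fun a ha => ?_⟩
  · rw [← h.face k x, FeynmanGraph.facePerm_exchange, Equiv.Perm.mul_apply]
    generalize G.facePerm k x = y
    rcases y with ⟨v, b⟩ | a
    · rw [Equiv.swap_apply_of_ne_of_ne (by simp) (by simp)]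
    · have hr : ∀ a, μ (Sum.inr a) k = r k := fun a => by rw [h.ext]
      fin_cases a
      · simp [hr]
      · simp [hr]
  · -- a face runs through an external point before and after the exchange
    let Q : Node n 2 → Prop := fun z => ∃ a, (G.exchange.facePerm k).SameCycle z (Sum.inr a)
    have hle : Equiv.Perm.SameCycle.setoid (G.facePerm k) ≤ Setoid.ker Q := by
      refine le_sameCycle_swap_mul (a := Sum.inr 0) (b := Sum.inr 1) ?_ ?_
      · rw [← FeynmanGraph.facePerm_exchange]
        intro z w hzw
        exact propext ⟨fun ⟨a, h⟩ => ⟨a, hzw.symm.trans h⟩, fun ⟨a, h⟩ => ⟨a, hzw.trans h⟩⟩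
      · exact propext (iff_of_true ⟨0, Equiv.Perm.SameCycle.refl _ _⟩
          ⟨1, Equiv.Perm.SameCycle.refl _ _⟩)
    obtain ⟨a', ha'⟩ : Q x := (show Q x = Q (Sum.inr a) from hle ha).mpr
      ⟨a, Equiv.Perm.SameCycle.refl _ _⟩
    exact hx a' ha'

theorem isFaceLabelling_exchange {G : FeynmanGraph d n 2} {μ : Node n 2 → Fin d → R} :
    IsFaceLabelling emb r G.exchange μ ↔ IsFaceLabelling emb r G μ :=
  ⟨fun h => by simpa [FeynmanGraph.exchange_exchange] using h.exchange, fun h => h.exchange⟩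

theorem amplitude_exchange [Fintype R] (B : Counterterms) {val : R → ℝ} {p : Fin d → ℝ}
    (hemb : Function.Injective emb) (hval : ∀ m, val (emb m) = ((m : ℤ) : ℝ))
    (hp : ∀ k, val (r k) = p k) (G : FeynmanGraph d n 2) :
    amplitude Λ B G.exchange p = amplitude Λ B G p := by
  classical
  rw [amplitude_eq B hemb hval hp, amplitude_eq B hemb hval hp]
  refine Finset.sum_congr rfl fun μ _ => ?_
  rw [if_congr isFaceLabelling_exchange rfl rfl]
  congr 1
  exact Fintype.prod_equiv G.internalLineExchange _ _ fun e => rfl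

/-- In a tree of cycles, conservation of momentum along the faces is conservation along the cycles
and, in the colour of the vertex, across every vertex. -/
theorem isFaceLabelling_iff (ht : IsAcyclic G.2) (c₀ : Fin n → Fin d) :
    IsFaceLabelling emb r G μ ↔ IsLabelling Finset.univ c₀ (fun _ => r) G.1 G.2 μ ∧
      LoopsIn (· ∈ Set.range emb) Finset.univ (Finset.univ.map Function.Embedding.inr)
        G.1 G.2 μ := by
  have hiff : ∀ k x y, (G.facePerm k).SameCycle x y ↔
      conn G.2 (colorClass G.1 Finset.univ k) x y := by
    intro k x y
    rw [← ht.sameCycle_eq, ← facePerm_eq]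
    rfl
  constructor
  · intro h
    have heq : ∀ k x y, conn G.2 (colorClass G.1 Finset.univ k) x y → μ x k = μ y k :=
      fun k x y hc => h.eq_of_sameCycle ((hiff k x y).2 hc)
    refine ⟨⟨by simp, fun x hx => ?_, fun x => ?_, fun v _ => ?_⟩, fun x _ k hk => ?_⟩
    · rcases x with ⟨v, b⟩ | a
      · simp at hx
      · exact h.ext a
    · funext k
      exact (heq k _ _ (conn_step _ _ _)).symm
    · exact heq _ _ _ (conn_link (by simp) _ _)
    · exact h.loops x k fun a ha => hk (Sum.inr a) (by simp) ((hiff _ _ _).1 ha)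
  · rintro ⟨h, hl⟩
    refine ⟨fun k x => ?_, fun a => h.ext _ (by simp), fun x k hx => ?_⟩
    · exact (h.eq_of_conn ((hiff k _ _).1 (sameCycle_step _ x))).symm
    · rcases x with ⟨v, b⟩ | a
      · refine hl _ (by simp) k fun a ha hc => ?_
        obtain ⟨a, -, rfl⟩ := Finset.mem_map.1 ha
        exact hx a ((hiff _ _ _).2 hc)
      · exact absurd (Equiv.Perm.SameCycle.refl _ _) (hx a)

/-- The product over all lines is the product over the internal lines times the propagators of the
external legs. -/
theorem prod_lines {M : Type*} [CommMonoid M] (hh : G.IsHooked) {f : Node n E → M} {m : M}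
    (hext : ∀ a, f (Sum.inr a) = m) (hin : ∀ e a, G.2 (Sum.inl e) = Sum.inr a → f (Sum.inl e) = m) :
    (∏ x ∈ Finset.univ.map Function.Embedding.inr, f x) * ∏ x ∈ body Finset.univ, f x
      = m ^ (2 * E) * ∏ e : G.InternalLine, f (Sum.inl e.1) := by
  classical
  have h1 : ∏ x ∈ body (Finset.univ : Finset (Fin n)), f x
      = ∏ e : Fin n × Bool, f (Sum.inl e) := by
    rw [body, Finset.prod_map, Finset.univ_product_univ]
    rfl
  have h2 : ∏ e : G.InternalLine, f (Sum.inl e.1)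
      = ∏ e ∈ Finset.univ.filter (fun e => (G.2 (Sum.inl e)).isLeft), f (Sum.inl e) :=
    (Finset.prod_subtype _ (by simp) fun e => f (Sum.inl e)).symm
  have h3 : ∏ e ∈ Finset.univ.filter (fun e => ¬ (G.2 (Sum.inl e)).isLeft), f (Sum.inl e)
      = m ^ E := by
    rw [Finset.prod_congr rfl fun e he => ?_, Finset.prod_const]
    · congr 1
      have h4 := G.card_internalLine hh
      have h5 := Finset.card_filter_add_card_filter_not (s := Finset.univ)
        (fun e : Fin n × Bool => ((G.2 (Sum.inl e)).isLeft : Prop))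
      have h6 : Fintype.card G.InternalLine
          = (Finset.univ.filter fun e => (G.2 (Sum.inl e)).isLeft).card := by
        rw [Fintype.card_subtype]
      have h7 : (Finset.univ : Finset (Fin n × Bool)).card = 2 * n := by simp [mul_comm]
      omega
    · obtain ⟨a, ha⟩ : ∃ a, G.2 (Sum.inl e) = Sum.inr a := by
        rcases h : G.2 (Sum.inl e) with e' | a
        · simp [h] at he
        · exact ⟨a, rfl⟩
      exact hin e a ha
  have h8 : ∏ a : Fin E, f (Function.Embedding.inr a) = m ^ E :=
    (Finset.prod_congr rfl fun a _ => hext a).trans (by simp)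
  rw [h1, Finset.prod_map, h2, ← Finset.prod_filter_mul_prod_filter_not Finset.univ
    (fun e : Fin n × Bool => ((G.2 (Sum.inl e)).isLeft : Prop)) fun e => f (Sum.inl e), h3, h8]
  rw [two_mul, pow_add, mul_assoc]
  congr 1
  exact mul_comm _ _

end Amplitude

/-! ### Sums over Feynman graphs -/

section GraphSum

variable {d n E Λ : ℕ} {R : Type*} [Fintype R] {emb : Momentum Λ → R} {r : Fin d → R}
  {val : R → ℝ} {p : Fin d → ℝ} {B : Counterterms}

open Classical in
/-- In a tree of cycles, the amplitude with propagators put on the `2 * E` external legs is a sum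
over the labellings used for the forests. -/
theorem lineFactor_mul_amplitude (hemb : Function.Injective emb)
    (hval : ∀ m, val (emb m) = ((m : ℤ) : ℝ)) (hp : ∀ k, val (r k) = p k)
    {G : FeynmanGraph d n E} (hh : G.IsHooked) (ht : IsAcyclic G.2) (c₀ : Fin n → Fin d) :
    lineFactor B val r ^ (2 * E) * amplitude Λ B G p =
      ∑ μ : Node n E → Fin d → R, if IsLabelling Finset.univ c₀ (fun _ => r) G.1 G.2 μ ∧
        LoopsIn (· ∈ Set.range emb) Finset.univ (Finset.univ.map Function.Embedding.inr)
          G.1 G.2 μ then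
        (∏ x ∈ Finset.univ.map Function.Embedding.inr, lineFactor B val (μ x)) *
          ∏ x ∈ body Finset.univ, lineFactor B val (μ x) else 0 := by
  rw [amplitude_eq B hemb hval hp, Finset.mul_sum]
  refine Finset.sum_congr rfl fun μ _ => ?_
  have hiff := isFaceLabelling_iff (emb := emb) (r := r) (μ := μ) ht c₀
  by_cases h : IsFaceLabelling emb r G μ
  · have hl := (hiff.1 h).1
    rw [if_pos h, if_pos (hiff.1 h), prod_lines hh (m := lineFactor B val r)]
    · intro a
      rw [h.ext]
    · intro e a hea
      rw [← hl.line (Sum.inl e), hea, h.ext]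
  · rw [if_neg h, if_neg (fun h' => h (hiff.2 h')), mul_zero]

open Classical in
/-- The order `n` of the self-energy, in terms of the full propagator `g` of the rooted trees. -/
theorem sum_twoPoint_graphs (hd : 3 ≤ d) (hemb : Function.Injective emb)
    (hval : ∀ m, val (emb m) = ((m : ℤ) : ℝ)) (hp : ∀ k, val (r k) = p k)
    (hC : lineFactor B val r ≠ 0) {g : (Fin d → R) → ℝ⟦X⟧⟦X⟧}
    (hg : ∀ s, g s = PowerSeries.C (lineFactor B val s) * (1 + 2 * PowerSeries.X *
      ∑ j, ∑ q ∈ loopMomenta (· ∈ Set.range emb) j s, g s * g q)) :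
    (∑ G : FeynmanGraph d n 1, if G.IsOnePI ∧ G.IsMelonic then amplitude Λ B G p else 0)
      = n.factorial * PowerSeries.coeff n (2 * PowerSeries.X *
        ∑ j, ∑ q ∈ loopMomenta (· ∈ Set.range emb) j r, g q) := by
  have hs : Separated (Finset.univ : Finset (Fin n)) ({Sum.inr 0} : Finset (Node n 1)) ∅ :=
    ⟨by simp, by simp⟩
  let c₀ : Fin n → Fin d := fun _ => ⟨0, by omega⟩
  refine mul_left_cancel₀ (pow_ne_zero 2 hC) ?_
  have h := forestSum_onePI (C := lineFactor B val) (c₀ := c₀) (p := fun _ => r) hg hs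
  rw [Finset.card_univ, Fintype.card_fin] at h
  rw [← h, forestSum, Finset.mul_sum, Fintype.sum_prod_type, Fintype.sum_prod_type]
  refine Finset.sum_congr rfl fun c _ => ?_
  rw [Fintype.sum_prod_type]
  refine Finset.sum_congr rfl fun π _ => ?_
  have hiff := FeynmanGraph.isOnePI_and_isMelonic_iff hd (c, π)
  have hroots : (Finset.univ.map Function.Embedding.inr : Finset (Node n 1)) = {Sum.inr 0} := rfl
  by_cases hG : FeynmanGraph.IsOnePI ((c, π) : FeynmanGraph d n 1) ∧ FeynmanGraph.IsMelonic (c, π)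
  · have hnc : numClasses (conn π Finset.univ) = 1 :=
      FeynmanGraph.numClasses_eq_one (Sum.inr 0) fun y =>
        FeynmanGraph.conn_of_isOnePI hG.1 y (Sum.inr 0)
    have ht := (FeynmanGraph.isMelonic_iff_isAcyclic_one hd (c, π) hG.1.1 hnc).1 hG.2
    have := lineFactor_mul_amplitude (B := B) hemb hval hp hG.1.1 ht c₀
    rw [mul_one] at this
    rw [if_pos hG, this]
    refine Finset.sum_congr rfl fun μ _ => ?_
    rw [hroots, Finset.union_empty]
    congr 1
    exact propext ⟨fun h => ⟨⟨(hiff.1 hG).1, h.1, h.2⟩, (hiff.1 hG).2⟩,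
      fun h => ⟨h.1.labelling, h.1.loops⟩⟩
  · rw [if_neg hG, mul_zero]
    refine (Finset.sum_eq_zero fun μ _ => if_neg fun h => hG ?_).symm
    exact hiff.2 ⟨h.1.forest, h.2⟩

open Classical in
/-- The order `n` of the four-point function. The factor `2` counts the two ways to pair the
external points, which are exchanged by `FeynmanGraph.exchange`. -/
theorem sum_fourPoint_graphs (hd : 3 ≤ d) (hemb : Function.Bijective emb)
    (hval : ∀ m, val (emb m) = ((m : ℤ) : ℝ)) (hp : ∀ k, val (r k) = p k)
    (hC : lineFactor B val r ≠ 0) {i : Fin d} {g h : (Fin d → R) → ℝ⟦X⟧⟦X⟧}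
    (hg : ∀ s, g s = PowerSeries.C (lineFactor B val s) * (1 + 2 * PowerSeries.X *
      ∑ j, ∑ q ∈ loopMomenta (· ∈ Set.range emb) j s, g s * g q))
    (hh : ∀ s, h s = PowerSeries.C (lineFactor B val s) *
      (2 * PowerSeries.X * (∑ j, ∑ q ∈ loopMomenta (· ∈ Set.range emb) j s, h s * g q) +
        2 * PowerSeries.X * ∑ q ∈ loopMomenta (· ∈ Set.range emb) i s,
          g s * (h q + if q = r then PowerSeries.C (lineFactor B val r ^ 2) else 0))) :
    lineFactor B val r ^ 2 * (∑ G : FeynmanGraph d n 2,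
      if G.IsOnePI ∧ G.IsMelonic ∧ G.HasBoundary i then amplitude Λ B G p else 0)
      = 2 * (n.factorial * PowerSeries.coeff n (2 * PowerSeries.X *
        ∑ q ∈ loopMomenta (· ∈ Set.range emb) i r,
          (h q + if q = r then PowerSeries.C (lineFactor B val r ^ 2) else 0))) := by
  have hs : Separated (Finset.univ : Finset (Fin n)) ({Sum.inr 0} : Finset (Node n 2))
      {Sum.inr 1} := ⟨by simp, by simp⟩
  let c₀ : Fin n → Fin d := fun _ => ⟨0, by omega⟩
  have hI : ∀ x : R, x ∈ Set.range emb := hemb.2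
  let P : FeynmanGraph d n 2 → Prop := fun G => G.IsOnePI ∧ G.IsMelonic ∧ G.HasBoundary i
  let D : FeynmanGraph d n 2 → Prop := fun G =>
    (G.facePerm i).SameCycle (Sum.inr 0) (Sum.inr 1)
  have hPex : ∀ G : FeynmanGraph d n 2, P G.exchange ↔ P G := fun G => by
    simp only [P, FeynmanGraph.isOnePI_exchange, FeynmanGraph.isMelonic_exchange,
      FeynmanGraph.hasBoundary_exchange]
  have hDex : ∀ G : FeynmanGraph d n 2, D G.exchange ↔ ¬ D G := fun G => G.sameCycle_exchange i
  have hsplit : (∑ G : FeynmanGraph d n 2, if P G then amplitude Λ B G p else 0)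
      = 2 * ∑ G : FeynmanGraph d n 2, if P G ∧ D G then amplitude Λ B G p else 0 := by
    have h1 : (∑ G : FeynmanGraph d n 2, if P G ∧ ¬ D G then amplitude Λ B G p else 0)
        = ∑ G : FeynmanGraph d n 2, if P G ∧ D G then amplitude Λ B G p else 0 := by
      refine Fintype.sum_equiv (FeynmanGraph.exchangeEquiv d n) _ _ fun G => ?_
      change _ = if P G.exchange ∧ D G.exchange then amplitude Λ B G.exchange p else 0
      rw [amplitude_exchange B hemb.1 hval hp]
      exact if_congr (and_congr (hPex G).symm (hDex G).symm) rfl rfl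
    rw [two_mul]
    nth_rewrite 1 [← h1]
    rw [← Finset.sum_add_distrib]
    refine Finset.sum_congr rfl fun G _ => ?_
    by_cases hP : P G <;> by_cases hD : D G <;> simp [hP, hD]
  change lineFactor B val r ^ 2 *
    (∑ G : FeynmanGraph d n 2, if P G then amplitude Λ B G p else 0) = _
  rw [hsplit, mul_left_comm]
  congr 1
  refine mul_left_cancel₀ (pow_ne_zero 2 hC) ?_
  have hf := forestSum_isMarked_onePI (C := lineFactor B val) (c₀ := c₀) (p := fun _ => r)
    hI hg hh hs rfl
  rw [Finset.card_univ, Fintype.card_fin] at hf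
  rw [← hf, ← mul_assoc, ← pow_add, forestSum, Finset.mul_sum, Fintype.sum_prod_type,
    Fintype.sum_prod_type]
  refine Finset.sum_congr rfl fun c _ => ?_
  rw [Fintype.sum_prod_type]
  refine Finset.sum_congr rfl fun π _ => ?_
  have hiff := FeynmanGraph.isOnePI_and_isMelonic_and_hasBoundary_iff hd (c, π) i
  have hroots : (Finset.univ.map Function.Embedding.inr : Finset (Node n 2))
      = {Sum.inr 0} ∪ {Sum.inr 1} := by
    ext x
    rcases x with x | a
    · simp
    · fin_cases a <;> simp
  by_cases hG : P (c, π) ∧ D (c, π)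
  · have hnc : numClasses (conn π Finset.univ) = 1 :=
      FeynmanGraph.numClasses_eq_one (Sum.inr 0) fun y =>
        FeynmanGraph.conn_of_isOnePI hG.1.1 y (Sum.inr 0)
    have ht := (FeynmanGraph.isMelonic_iff_isAcyclic_two hd (c, π) hG.1.1.1 hnc hG.2
      fun k hk h => (hG.1.2.2 k hk).1 h hG.2).1 hG.1.2.1
    have := lineFactor_mul_amplitude (B := B) hemb.1 hval hp hG.1.1.1 ht c₀
    rw [if_pos hG, this]
    refine Finset.sum_congr rfl fun μ _ => ?_
    rw [hroots]
    congr 1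
    exact propext ⟨fun h => ⟨⟨(hiff.1 hG).1, h.1, fun _ _ _ _ => hI _⟩, (hiff.1 hG).2⟩,
      fun h => ⟨h.1.labelling, fun _ _ _ _ => hI _⟩⟩
  · rw [if_neg hG, mul_zero]
    refine (Finset.sum_eq_zero fun μ _ => if_neg fun h => hG ?_).symm
    exact hiff.2 ⟨h.1.forest, h.2⟩

end GraphSum

/-! ### The full propagator -/

section FullPropagator

variable {d : ℕ} {R K : Type*} [Fintype R] [CommRing K]

/-- The coefficients of the full propagator, defined by the recursion that removes the vertex next
to the root. -/
def fullCoeff (C : (Fin d → R) → K) (I : R → Prop) : ℕ → (Fin d → R) → K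
  | 0, s => C s
  | m + 1, s => 2 * C s * ∑ j, ∑ q ∈ loopMomenta I j s, ∑ a : Fin (m + 1),
      fullCoeff C I a s * fullCoeff C I (m - a) q
  termination_by m => m
  decreasing_by all_goals omega

/-- The generating function of the rooted trees. -/
def fullPropagator (C : (Fin d → R) → K) (I : R → Prop) (s : Fin d → R) : K⟦X⟧ :=
  PowerSeries.mk fun m => fullCoeff C I m s

theorem fullPropagator_eq (C : (Fin d → R) → K) (I : R → Prop) (s : Fin d → R) :
    fullPropagator C I s = PowerSeries.C (C s) * (1 + 2 * PowerSeries.X *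
      ∑ j, ∑ q ∈ loopMomenta I j s, fullPropagator C I s * fullPropagator C I q) := by
  ext m
  rw [PowerSeries.coeff_C_mul, mul_comm 2 PowerSeries.X, mul_assoc, map_add]
  rcases m with _ | m
  · simp [fullPropagator, fullCoeff]
  · rw [PowerSeries.coeff_succ_X_mul, ← map_ofNat (PowerSeries.C (R := K)) 2,
      PowerSeries.coeff_C_mul, PowerSeries.coeff_one, if_neg (Nat.succ_ne_zero m), zero_add,
      fullPropagator, PowerSeries.coeff_mk, fullCoeff]
    simp only [map_sum, PowerSeries.coeff_mul, fullPropagator, PowerSeries.coeff_mk]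
    rw [mul_comm 2 (C s), mul_assoc]
    congr 2
    refine Finset.sum_congr rfl fun j _ => Finset.sum_congr rfl fun q _ => ?_
    rw [Finset.Nat.sum_antidiagonal_eq_sum_range_succ_mk, Finset.sum_range]

/-- The sum of the ladder of loops of colour `i` at external momentum `s`. -/
def ladder (C : (Fin d → R) → K) (I : R → Prop) (i : Fin d) (s : Fin d → R) : K⟦X⟧ :=
  PowerSeries.invOfUnit
    (1 - 2 * PowerSeries.X * ∑ q ∈ loopMomenta I i s, fullPropagator C I q ^ 2) 1

theorem ladder_mul (C : (Fin d → R) → K) (I : R → Prop) (i : Fin d) (s : Fin d → R) :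
    (1 - 2 * PowerSeries.X * ∑ q ∈ loopMomenta I i s, fullPropagator C I q ^ 2)
      * ladder C I i s = 1 :=
  PowerSeries.mul_invOfUnit _ _ (by simp)

open Classical in
/-- The tree with a marked loop of momentum `s`, as a function of the momentum `q` of its root. -/
def markedPropagator (C : (Fin d → R) → K) (I : R → Prop) (i : Fin d) (s q : Fin d → R) :
    K⟦X⟧ :=
  if q i = s i then
    2 * PowerSeries.X * fullPropagator C I q ^ 2 * PowerSeries.C (C s ^ 2) * ladder C I i s
  else 0

open Classical in
theorem sum_markedPropagator (C : (Fin d → R) → K) {I : R → Prop} (hI : ∀ x, I x) (i : Fin d)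
    (s : Fin d → R) : ∑ q ∈ loopMomenta I i s, (markedPropagator C I i s q +
      if q = s then PowerSeries.C (C s ^ 2) else 0) = PowerSeries.C (C s ^ 2) * ladder C I i s := by
  have h := ladder_mul C I i s
  have hmem : ∀ q ∈ loopMomenta I i s, q i = s i := fun q hq => by
    rw [loopMomenta, Finset.mem_filter] at hq
    exact hq.2.1
  have hs : s ∈ loopMomenta I i s := by simp [loopMomenta, hI]
  rw [Finset.sum_add_distrib, Finset.sum_ite_eq' _ s, if_pos hs,
    Finset.sum_congr rfl fun q hq => by rw [markedPropagator, if_pos (hmem q hq)],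
    ← Finset.sum_mul, ← Finset.sum_mul, ← Finset.mul_sum]
  linear_combination (-PowerSeries.C (C s ^ 2)) * h

open Classical in
theorem markedPropagator_eq (C : (Fin d → R) → K) {I : R → Prop} (hI : ∀ x, I x) (i : Fin d)
    (s q : Fin d → R) : markedPropagator C I i s q = PowerSeries.C (C q) *
      (2 * PowerSeries.X * (∑ j, ∑ q' ∈ loopMomenta I j q,
          markedPropagator C I i s q * fullPropagator C I q') +
        2 * PowerSeries.X * ∑ q' ∈ loopMomenta I i q, fullPropagator C I q *
          (markedPropagator C I i s q' + if q' = s then PowerSeries.C (C s ^ 2) else 0)) := by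
  have hg := fullPropagator_eq C I q
  rw [← Finset.mul_sum]
  simp only [← Finset.mul_sum] at hg ⊢
  by_cases hq : q i = s i
  · have hl : loopMomenta I i q = loopMomenta I i s := by simp [loopMomenta, hq]
    rw [hl, sum_markedPropagator C hI, markedPropagator, if_pos hq]
    set g := fullPropagator C I q
    set L := ladder C I i s
    set σ := ∑ j, ∑ q' ∈ loopMomenta I j q, fullPropagator C I q'
    linear_combination (2 * PowerSeries.X * g * PowerSeries.C (C s ^ 2) * L) * hg
  · have h0 : ∑ q' ∈ loopMomenta I i q, (markedPropagator C I i s q' +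
        if q' = s then PowerSeries.C (C s ^ 2) else 0) = 0 := by
      refine Finset.sum_eq_zero fun q' hq' => ?_
      rw [loopMomenta, Finset.mem_filter] at hq'
      have h1 : q' i ≠ s i := by rw [hq'.2.1]; exact hq
      have h2 : q' ≠ s := fun h => h1 (by rw [h])
      rw [markedPropagator, if_neg h1, if_neg h2, add_zero]
    rw [h0, markedPropagator, if_neg hq]
    ring

end FullPropagator

/-! ### Evaluation of power series at a topologically nilpotent element -/

section Evaluation

variable {K : Type*} [CommRing K] {x : K⟦X⟧}

theorem X_pow_dvd_eval (hx : PowerSeries.X ∣ x) {N : ℕ} {P : Polynomial K⟦X⟧}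
    (hP : ∀ n < N, P.coeff n = 0) : PowerSeries.X ^ N ∣ P.eval x := by
  have h := Polynomial.eval_dvd (x := x) ((Polynomial.X_pow_dvd_iff).2 hP)
  rw [Polynomial.eval_pow, Polynomial.eval_X] at h
  exact (pow_dvd_pow_of_dvd hx N).trans h

theorem eq_of_X_pow_dvd_sub {f g : K⟦X⟧} (h : ∀ N, PowerSeries.X ^ N ∣ f - g) : f = g := by
  ext r
  have := PowerSeries.X_pow_dvd_iff.1 (h (r + 1)) r (Nat.lt_succ_self r)
  rwa [map_sub, sub_eq_zero] at this

/-- The value at `x`, a multiple of `X`, of a power series with coefficients in `K⟦X⟧`: the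
coefficient of `X ^ r` only depends on the terms of order at most `r`. -/
def evalAt (x : K⟦X⟧) (f : K⟦X⟧⟦X⟧) : K⟦X⟧ :=
  PowerSeries.mk fun r => PowerSeries.coeff r ((PowerSeries.trunc (r + 1) f).eval x)

theorem X_pow_dvd_evalAt_sub (hx : PowerSeries.X ∣ x) (f : K⟦X⟧⟦X⟧) (N : ℕ) :
    PowerSeries.X ^ N ∣ evalAt x f - (PowerSeries.trunc N f).eval x := by
  rw [PowerSeries.X_pow_dvd_iff]
  intro r hr
  have h : PowerSeries.X ^ (r + 1) ∣
      (PowerSeries.trunc (r + 1) f - PowerSeries.trunc N f).eval x := by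
    refine X_pow_dvd_eval hx fun n hn => ?_
    rw [Polynomial.coeff_sub, PowerSeries.coeff_trunc, PowerSeries.coeff_trunc, if_pos hn,
      if_pos (by omega), sub_self]
  have := PowerSeries.X_pow_dvd_iff.1 h r (Nat.lt_succ_self r)
  rw [Polynomial.eval_sub, map_sub] at this
  rw [map_sub, evalAt, PowerSeries.coeff_mk, this]

theorem evalAt_eq_of_dvd (hx : PowerSeries.X ∣ x) {f : K⟦X⟧⟦X⟧} {a : K⟦X⟧}
    (h : ∀ N, PowerSeries.X ^ N ∣ (PowerSeries.trunc N f).eval x - a) : evalAt x f = a :=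
  eq_of_X_pow_dvd_sub fun N => by
    simpa using dvd_add (X_pow_dvd_evalAt_sub hx f N) (h N)

/-- Evaluation at a multiple of `X`, as a ring homomorphism. -/
def evalHom (hx : PowerSeries.X ∣ x) : K⟦X⟧⟦X⟧ →+* K⟦X⟧ where
  toFun := evalAt x
  map_one' := by
    refine evalAt_eq_of_dvd hx fun N => ?_
    rcases N with _ | N
    · simp
    · simp [PowerSeries.trunc_one]
  map_zero' := by
    ext r
    simp [evalAt]
  map_add' f g := by
    ext r
    simp [evalAt]
  map_mul' f g := by
    refine evalAt_eq_of_dvd hx fun N => ?_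
    have hf := X_pow_dvd_evalAt_sub hx f N
    have hg := X_pow_dvd_evalAt_sub hx g N
    have h : PowerSeries.X ^ N ∣ (PowerSeries.trunc N (f * g) -
        PowerSeries.trunc N f * PowerSeries.trunc N g).eval x := by
      refine X_pow_dvd_eval hx fun n hn => ?_
      rw [Polynomial.coeff_sub, PowerSeries.coeff_trunc, if_pos hn, Polynomial.coeff_mul,
        PowerSeries.coeff_mul, sub_eq_zero]
      refine Finset.sum_congr rfl fun a ha => ?_
      rw [Finset.HasAntidiagonal.mem_antidiagonal] at ha
      rw [PowerSeries.coeff_trunc, PowerSeries.coeff_trunc, if_pos (by omega),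
        if_pos (by omega)]
    rw [Polynomial.eval_sub, Polynomial.eval_mul] at h
    have e : (PowerSeries.trunc N (f * g)).eval x - evalAt x f * evalAt x g =
        ((PowerSeries.trunc N (f * g)).eval x -
          (PowerSeries.trunc N f).eval x * (PowerSeries.trunc N g).eval x) -
        ((evalAt x f - (PowerSeries.trunc N f).eval x) * evalAt x g +
          (PowerSeries.trunc N f).eval x * (evalAt x g - (PowerSeries.trunc N g).eval x)) := by
      ring
    rw [e]
    exact dvd_sub h (dvd_add (hf.mul_right _) (hg.mul_left _))

theorem evalHom_apply (hx : PowerSeries.X ∣ x) (f : K⟦X⟧⟦X⟧) : evalHom hx f =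
    PowerSeries.mk fun r => ∑ n ∈ Finset.range (r + 1),
      PowerSeries.coeff r (x ^ n * PowerSeries.coeff n f) := by
  ext r
  change PowerSeries.coeff r (evalAt x f) = _
  rw [evalAt, PowerSeries.coeff_mk, PowerSeries.coeff_mk, Polynomial.eval,
    PowerSeries.eval₂_trunc_eq_sum_range, map_sum]
  simp [mul_comm]

@[simp]
theorem evalHom_C (hx : PowerSeries.X ∣ x) (a : K⟦X⟧) : evalHom hx (PowerSeries.C a) = a := by
  refine evalAt_eq_of_dvd hx fun N => ?_
  rcases N with _ | N
  · simp
  · simp [PowerSeries.trunc_C]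

@[simp]
theorem evalHom_X (hx : PowerSeries.X ∣ x) : evalHom hx PowerSeries.X = x := by
  refine evalAt_eq_of_dvd hx fun N => ?_
  rcases N with _ | _ | N
  · simp
  · have h : PowerSeries.trunc 1 (PowerSeries.X : K⟦X⟧⟦X⟧) = 0 := by
      ext n
      simp only [PowerSeries.coeff_trunc, PowerSeries.coeff_X]
      split_ifs <;> first | omega | simp
    simpa [h] using hx
  · simp [PowerSeries.trunc_X]

end Evaluation

/-! ### Closed equations for the self-energy and the four-point function -/

section ClosedEquations

variable {d Λ : ℕ} {B : Counterterms}

theorem X_dvd_coupling (B : Counterterms) : PowerSeries.X ∣ -(B.Zvert * PowerSeries.X) :=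
  (dvd_mul_left _ _).neg_right

open Classical in
/-- If the orders of the perturbative expansion are `n!` times the coefficients of `f`, then its
sum is the value of `f` at `-(Zvert * lam)`. -/
theorem melonicSum_eq_evalHom {E : ℕ} {p : Fin d → ℝ} {P : ∀ n, FeynmanGraph d n E → Prop}
    {f : ℝ⟦X⟧⟦X⟧} (hf : ∀ n, (∑ G : FeynmanGraph d n E,
      if G.IsOnePI ∧ G.IsMelonic ∧ P n G then amplitude Λ B G p else 0)
        = n.factorial * PowerSeries.coeff n f) :
    melonicSum Λ B p P = evalHom (X_dvd_coupling B) f := by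
  rw [evalHom_apply, melonicSum]
  congr 1
  funext r
  refine Finset.sum_congr rfl fun n _ => ?_
  have hn : PowerSeries.C ((n.factorial : ℝ)⁻¹) * (n.factorial : ℝ⟦X⟧) = 1 := by
    rw [← map_natCast (PowerSeries.C (R := ℝ)), ← map_mul,
      inv_mul_cancel₀ (Nat.cast_ne_zero.2 n.factorial_ne_zero), map_one]
  rw [melonicOrder, hf]
  congr 1
  linear_combination ((-(B.Zvert * PowerSeries.X)) ^ n * PowerSeries.coeff n f) * hn

theorem constantCoeff_selfEnergy (p : Fin d → ℝ) :
    PowerSeries.constantCoeff (selfEnergy Λ B p) = 0 := by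
  rw [← PowerSeries.coeff_zero_eq_constantCoeff_apply, selfEnergy, melonicSum,
    PowerSeries.coeff_mk, zero_add, Finset.sum_range_one, melonicOrder,
    Finset.sum_eq_zero, mul_zero, map_zero]
  intro G _
  refine if_neg fun h => ?_
  obtain ⟨⟨v, _⟩, _⟩ := Sum.isLeft_iff.1 (h.1.1 0)
  exact v.elim0

theorem mem_loopMomenta {R : Type*} [Fintype R] {I : R → Prop} {j : Fin d} {s q : Fin d → R} :
    q ∈ loopMomenta I j s ↔ q j = s j ∧ ∀ k, k ≠ j → I (q k) := by
  simp [loopMomenta]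

theorem lineFactor_ne_zero {R : Type*}
    (hB : ∀ q : Fin d → ℝ, PowerSeries.constantCoeff (kinetic B q) ≠ 0)
    (val : R → ℝ) (s : Fin d → R) : lineFactor B val s ≠ 0 := by
  intro h
  have := PowerSeries.mul_inv_cancel _ (hB fun k => val (s k))
  rw [lineFactor] at h
  rw [h, mul_zero] at this
  exact zero_ne_one this

section Labels

variable {R : Type*} [Fintype R] {emb : Momentum Λ → R} {val : R → ℝ}

theorem selfEnergy_eq_evalHom (hd : 3 ≤ d) (hemb : Function.Injective emb)
    (hval : ∀ m, val (emb m) = ((m : ℤ) : ℝ))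
    (hB : ∀ q : Fin d → ℝ, PowerSeries.constantCoeff (kinetic B q) ≠ 0) (s : Fin d → R) :
    selfEnergy Λ B (fun k => val (s k)) = evalHom (X_dvd_coupling B) (2 * PowerSeries.X *
      ∑ j, ∑ q ∈ loopMomenta (· ∈ Set.range emb) j s,
        fullPropagator (lineFactor B val) (· ∈ Set.range emb) q) := by
  refine melonicSum_eq_evalHom (P := fun _ _ => True) fun n => ?_
  rw [← sum_twoPoint_graphs hd hemb hval (fun _ => rfl) (lineFactor_ne_zero hB val s)
    (fullPropagator_eq _ _)]
  refine Finset.sum_congr rfl fun G _ => ?_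
  congr 1
  rw [and_true]

/-- The full propagator of the rooted trees is the effective propagator. -/
theorem evalHom_fullPropagator (hd : 3 ≤ d) (hemb : Function.Injective emb)
    (hval : ∀ m, val (emb m) = ((m : ℤ) : ℝ))
    (hB : ∀ q : Fin d → ℝ, PowerSeries.constantCoeff (kinetic B q) ≠ 0) (s : Fin d → R) :
    evalHom (X_dvd_coupling B) (fullPropagator (lineFactor B val) (· ∈ Set.range emb) s)
      = effPropagator Λ B fun k => val (s k) := by
  have hS := selfEnergy_eq_evalHom hd hemb hval hB s
  have hg := congrArg (evalHom (X_dvd_coupling B))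
    (fullPropagator_eq (lineFactor B val) (· ∈ Set.range emb) s)
  simp only [← Finset.mul_sum] at hg
  rw [map_mul, map_add, mul_left_comm, map_mul, ← hS, evalHom_C, map_one] at hg
  have hk := PowerSeries.mul_inv_cancel _ (hB fun k => val (s k))
  rw [effPropagator, PowerSeries.eq_inv_iff_mul_eq_one, twoPoint]
  · rw [lineFactor] at hg
    set g := evalHom (X_dvd_coupling B)
      (fullPropagator (lineFactor B val) (· ∈ Set.range emb) s)
    linear_combination (kinetic B fun k => val (s k)) * hg +
      (1 + g * selfEnergy Λ B fun k => val (s k)) * hk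
  · rw [twoPoint, map_sub, constantCoeff_selfEnergy, sub_zero]
    exact hB _

end Labels

/-- The melonic Schwinger-Dyson equation: the self-energy is a sum over the colours of tadpoles
which only depend on the component of the external momentum in that colour. -/
theorem selfEnergy_eq (hd : 3 ≤ d)
    (hB : ∀ q : Fin d → ℝ, PowerSeries.constantCoeff (kinetic B q) ≠ 0) (p : Fin d → ℝ) :
    selfEnergy Λ B p = -(2 * B.Zvert * PowerSeries.X) * ∑ j, ∑ m : Fin d → Momentum Λ,
      if (m j : ℤ) = 0 then
        effPropagator Λ B (Function.update (fun k => ((m k : ℤ) : ℝ)) j (p j)) else 0 := by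
  -- the external momentum is real: it is labelled by new symbols
  let val : Momentum Λ ⊕ Fin d → ℝ := Sum.elim (fun m => ((m : ℤ) : ℝ)) p
  have h := selfEnergy_eq_evalHom (val := val) hd
    (Sum.inl_injective (α := Momentum Λ) (β := Fin d)) (fun _ => rfl) hB Sum.inr
  change selfEnergy Λ B p = _ at h
  rw [h, map_mul, map_mul, evalHom_X, map_ofNat, map_sum]
  have e : 2 * -(B.Zvert * PowerSeries.X) = -(2 * B.Zvert * PowerSeries.X) := by ring
  rw [e]
  congr 1
  refine Finset.sum_congr rfl fun j _ => ?_
  rw [map_sum, ← Finset.sum_filter]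
  symm
  refine Finset.sum_nbij (fun m => Function.update (fun k => Sum.inl (m k)) j (Sum.inr j))
    ?_ ?_ ?_ ?_
  · intro m _
    rw [mem_loopMomenta]
    refine ⟨Function.update_self .., fun k hk => ?_⟩
    rw [Function.update_of_ne hk]
    exact ⟨_, rfl⟩
  · intro m hm m' hm' hmm
    have h1 : (m j : ℤ) = 0 := by simpa using hm
    have h2 : (m' j : ℤ) = 0 := by simpa using hm'
    funext k
    by_cases hk : k = j
    · subst hk
      exact Subtype.ext (h1.trans h2.symm)
    · have := congrFun hmm k
      simp only [Function.update_of_ne hk] at this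
      exact Sum.inl_injective this
  · intro q hq
    rw [Finset.mem_coe, mem_loopMomenta] at hq
    have h0 : (0 : ℤ) ∈ Finset.Icc (-(Λ : ℤ)) (Λ : ℤ) := by simp
    have hex : ∀ k, ∃ m : Momentum Λ, (k = j → (m : ℤ) = 0) ∧ (k ≠ j → Sum.inl m = q k) := by
      intro k
      by_cases hk : k = j
      · exact ⟨⟨0, h0⟩, fun _ => rfl, fun h => absurd hk h⟩
      · obtain ⟨m, hm⟩ := hq.2 k hk
        exact ⟨m, fun h => absurd h hk, fun _ => hm⟩
    choose m hm using hex
    refine ⟨m, by simpa using (hm j).1 rfl, ?_⟩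
    funext k
    by_cases hk : k = j
    · subst hk
      simp [hq.1]
    · simp only [Function.update_of_ne hk]
      exact (hm k).2 hk
  · intro m _
    rw [evalHom_fullPropagator hd Sum.inl_injective (fun _ => rfl) hB]
    congr 1
    funext k
    by_cases hk : k = j
    · subst hk
      simp [val]
    · simp [val, Function.update_of_ne hk]

/-- The four-point function at zero momentum is a geometric series of loops. -/
theorem fourPoint_mul (hd : 3 ≤ d)
    (hB : ∀ q : Fin d → ℝ, PowerSeries.constantCoeff (kinetic B q) ≠ 0) (i : Fin d) :
    fourPoint Λ B i 0 * (1 + 2 * B.Zvert * PowerSeries.X * loopA Λ B i)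
      = 4 * B.Zvert * PowerSeries.X := by
  classical
  let z : Momentum Λ := ⟨0, by simp⟩
  let val : Momentum Λ → ℝ := fun m => ((m : ℤ) : ℝ)
  let s : Fin d → Momentum Λ := fun _ => z
  let I : Momentum Λ → Prop := (· ∈ Set.range (id : Momentum Λ → Momentum Λ))
  have hI : ∀ m, I m := fun m => ⟨m, rfl⟩
  let C : (Fin d → Momentum Λ) → ℝ⟦X⟧ := lineFactor B val
  have hC : C s ≠ 0 := lineFactor_ne_zero hB val s
  have hsum : melonicSum (E := 2) Λ B 0 (fun _ G => G.HasBoundary i)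
      = evalHom (X_dvd_coupling B) (4 * PowerSeries.X * ladder C I i s) := by
    refine melonicSum_eq_evalHom fun n => ?_
    have h := sum_fourPoint_graphs (n := n) (i := i) (p := 0) (r := s) (val := val) (B := B)
      hd Function.bijective_id (fun _ => rfl) (fun k => by simp [val, s, z]) hC
      (fullPropagator_eq _ _) (markedPropagator_eq C hI i s)
    have hm := sum_markedPropagator C hI i s
    refine mul_left_cancel₀ (pow_ne_zero 2 hC) (h.trans ?_)
    have e : 2 * PowerSeries.X * (PowerSeries.C (C s ^ 2) * ladder C I i s)
        = PowerSeries.C (C s ^ 2) * (2 * PowerSeries.X * ladder C I i s) := by ring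
    have e' : (4 : ℝ⟦X⟧⟦X⟧) * PowerSeries.X * ladder C I i s
        = 2 • (2 * PowerSeries.X * ladder C I i s) := by
      rw [two_nsmul]
      ring
    rw [e', map_nsmul]
    erw [hm]
    rw [e, PowerSeries.coeff_C_mul, two_nsmul]
    ring
  have hl := congrArg (evalHom (X_dvd_coupling B)) (ladder_mul C I i s)
  rw [map_mul, map_sub, map_one, map_mul, map_mul, evalHom_X, map_ofNat, map_sum] at hl
  have hA : ∑ q ∈ loopMomenta I i s, evalHom (X_dvd_coupling B) (fullPropagator C I q ^ 2)
      = loopA Λ B i := by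
    rw [loopA, ← Finset.sum_filter]
    refine Finset.sum_congr ?_ fun q _ => ?_
    · ext q
      simp [loopMomenta, hI, s, z, Subtype.ext_iff]
    · rw [map_pow, evalHom_fullPropagator hd Function.injective_id (fun _ => rfl) hB]
  rw [hA] at hl
  rw [fourPoint, hsum, map_mul, map_mul, evalHom_X, map_ofNat]
  linear_combination (4 * B.Zvert * PowerSeries.X) * hl

end ClosedEquations

/-! ### Coefficientwise limits -/

section Limits

open Filter
open scoped PowerSeries.WithPiTopology

theorem tendsto_inv_powerSeries {α : Type*} {l : Filter α} {f : α → ℝ⟦X⟧} {a : ℝ⟦X⟧}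
    (hf : Tendsto f l (𝓝 a)) (ha : PowerSeries.constantCoeff a ≠ 0) :
    Tendsto (fun t => (f t)⁻¹) l (𝓝 a⁻¹) := by
  rw [PowerSeries.WithPiTopology.tendsto_iff_coeff_tendsto] at hf ⊢
  have h0 : Tendsto (fun t => (PowerSeries.constantCoeff (f t))⁻¹) l
      (𝓝 (PowerSeries.constantCoeff a)⁻¹) := by
    simpa using (hf 0).inv₀ (by simpa using ha)
  intro r
  induction r using Nat.strong_induction_on with
  | _ r ih =>
    have hinv : ∀ g : ℝ⟦X⟧, PowerSeries.coeff r g⁻¹ = _ := fun g => PowerSeries.coeff_inv r g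
    by_cases hr : r = 0
    · simp only [if_pos hr] at hinv
      rw [hinv a]
      exact h0.congr fun t => (hinv _).symm
    · simp only [if_neg hr] at hinv
      rw [hinv a]
      refine Tendsto.congr (fun t => (hinv _).symm)
        (h0.neg.mul (tendsto_finsetSum _ fun x _ => ?_))
      by_cases hx : x.2 < r
      · simp only [if_pos hx]
        exact (hf _).mul (ih _ hx)
      · simp only [if_neg hx]
        exact tendsto_const_nhds

theorem eq_zero_of_isLittleO {α E F : Type*} [TopologicalSpace α] [NormedAddCommGroup E]
    [NormedAddCommGroup F] {f : α → E} {g : α → F} {a : α} (h : f =o[𝓝 a] g) (hg : g a = 0) :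
    f a = 0 := by
  have := (h.def one_pos).self_of_nhds
  simpa [hg] using this

end Limits

/-! ### The renormalization conditions -/

section Renormalization

open Filter
open scoped PowerSeries.WithPiTopology

variable {d Λ : ℕ} {B : Counterterms} {mr2 : ℝ}

theorem sum_update_sq {i : Fin d} {q : Fin d → ℝ} (hq : q i = 0) (t : ℝ) :
    ∑ k, (Function.update q i t k) ^ 2 = t ^ 2 + ∑ k, q k ^ 2 := by
  rw [← sub_eq_iff_eq_add, ← Finset.sum_sub_distrib, Finset.sum_eq_single i]
  · simp [hq]
  · intro k _ hk
    simp [Function.update_of_ne hk]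
  · simp

/-- The renormalization condition of the two-point function: coefficientwise in the coupling,
`Γ⁽²⁾(p) = mr2 + p² + o(p²)`. -/
def IsNormalized (Λ : ℕ) (B : Counterterms) (d : ℕ) (mr2 : ℝ) : Prop :=
  ∀ r : ℕ, (fun p : Fin d → ℝ => PowerSeries.coeff r
      (twoPoint Λ B p - PowerSeries.C (mr2 + ∑ k, p k ^ 2)))
    =o[𝓝 0] fun p : Fin d → ℝ => ∑ k, p k ^ 2

theorem IsNormalized.twoPoint_zero (h : IsNormalized Λ B d mr2) :
    twoPoint Λ B (0 : Fin d → ℝ) = PowerSeries.C mr2 := by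
  rw [← sub_eq_zero]
  ext r
  have := eq_zero_of_isLittleO (h r) (by simp)
  simpa using this

/-- The renormalization condition along one axis: `(Γ⁽²⁾(p) - Γ⁽²⁾(0)) / p²` tends to `1`. -/
theorem IsNormalized.tendsto (h : IsNormalized Λ B d mr2) (i : Fin d) :
    Tendsto (fun t : ℝ => PowerSeries.C (t ^ 2)⁻¹ *
      (twoPoint Λ B (Function.update 0 i t) - twoPoint Λ B (0 : Fin d → ℝ))) (𝓝[≠] 0) (𝓝 1) := by
  rw [PowerSeries.WithPiTopology.tendsto_iff_coeff_tendsto]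
  intro r
  have hu : Tendsto (fun t : ℝ => Function.update (0 : Fin d → ℝ) i t) (𝓝[≠] 0) (𝓝 0) := by
    have hc : Continuous fun t : ℝ => Function.update (0 : Fin d → ℝ) i t :=
      continuous_const.update i continuous_id
    have := hc.tendsto 0
    rw [Function.update_eq_self_iff.2 (by simp)] at this
    exact this.mono_left nhdsWithin_le_nhds
  have h1 := ((h r).comp_tendsto hu).tendsto_div_nhds_zero.add_const
    (PowerSeries.coeff r (1 : ℝ⟦X⟧))
  simp only [Function.comp_def, sum_update_sq (q := (0 : Fin d → ℝ)) rfl, Pi.zero_apply, ne_eq,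
    OfNat.ofNat_ne_zero, not_false_eq_true, zero_pow, Finset.sum_const_zero, add_zero,
    zero_add] at h1
  refine h1.congr' ?_
  filter_upwards [self_mem_nhdsWithin] with t ht
  have ht2 : t ^ 2 ≠ 0 := pow_ne_zero 2 ht
  have hone : (1 : ℝ⟦X⟧) = PowerSeries.C (t ^ 2)⁻¹ * PowerSeries.C (t ^ 2) := by
    rw [← map_mul, inv_mul_cancel₀ ht2, map_one]
  rw [h.twoPoint_zero, div_eq_inv_mul, ← PowerSeries.coeff_C_mul, ← map_add]
  congr 1
  rw [map_add]
  linear_combination hone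

theorem coeff_zero_twoPoint (p : Fin d → ℝ) : PowerSeries.constantCoeff (twoPoint Λ B p) =
    PowerSeries.constantCoeff (kinetic B p) := by
  rw [twoPoint, map_sub, constantCoeff_selfEnergy, sub_zero]

theorem constantCoeff_kinetic (p : Fin d → ℝ) : PowerSeries.constantCoeff (kinetic B p) =
    (∑ k, p k ^ 2) * PowerSeries.constantCoeff B.Zwave + PowerSeries.constantCoeff B.massSq := by
  simp [kinetic]

/-- At order zero the propagators are those of the free theory of squared mass `mr2`. -/
theorem IsNormalized.constantCoeff_kinetic_ne_zero (h : IsNormalized Λ B d mr2)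
    (hmr2 : 0 < mr2) (i : Fin d) (q : Fin d → ℝ) :
    PowerSeries.constantCoeff (kinetic B q) ≠ 0 := by
  have hm : PowerSeries.constantCoeff B.massSq = mr2 := by
    have := congrArg PowerSeries.constantCoeff h.twoPoint_zero
    simpa [coeff_zero_twoPoint, constantCoeff_kinetic] using this
  have hw : PowerSeries.constantCoeff B.Zwave = 1 := by
    have h1 := (PowerSeries.WithPiTopology.tendsto_iff_coeff_tendsto _ _ _ _).1 (h.tendsto i) 0
    refine tendsto_nhds_unique (f := fun _ : ℝ => PowerSeries.constantCoeff B.Zwave)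
      (l := 𝓝[≠] (0 : ℝ)) tendsto_const_nhds ?_
    simp only [PowerSeries.coeff_zero_eq_constantCoeff, map_one] at h1
    refine h1.congr' ?_
    filter_upwards [self_mem_nhdsWithin] with t ht
    have ht2 : t ^ 2 ≠ 0 := pow_ne_zero 2 ht
    simp only [map_mul, map_sub, coeff_zero_twoPoint, constantCoeff_kinetic,
      sum_update_sq (q := (0 : Fin d → ℝ)) rfl]
    simp [ht2]
  rw [constantCoeff_kinetic, hm, hw]
  positivity

/-- The variation of the two-point function when the component `i` of the momentum moves from `0`
to `t`. -/
def axisShift (Λ : ℕ) (B : Counterterms) (i : Fin d) (t : ℝ) : ℝ⟦X⟧ :=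
  PowerSeries.C (t ^ 2) * B.Zwave + 2 * B.Zvert * PowerSeries.X * ∑ m : Fin d → Momentum Λ,
    if (m i : ℤ) = 0 then
      effPropagator Λ B (Function.update (fun k => ((m k : ℤ) : ℝ)) i t) -
        effPropagator Λ B (fun k => ((m k : ℤ) : ℝ))
    else 0

/-- As the self-energy is a sum of functions of one component of the momentum each, the variation
of the two-point function along an axis does not depend on the other components. -/
theorem twoPoint_update_sub (hd : 3 ≤ d)
    (hB : ∀ q : Fin d → ℝ, PowerSeries.constantCoeff (kinetic B q) ≠ 0) {i : Fin d}
    {q : Fin d → ℝ} (hq : q i = 0) (t : ℝ) :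
    twoPoint Λ B (Function.update q i t) - twoPoint Λ B q = axisShift Λ B i t := by
  have hself : ∀ m : Fin d → Momentum Λ, (m i : ℤ) = 0 →
      Function.update (fun k => ((m k : ℤ) : ℝ)) i 0 = fun k => ((m k : ℤ) : ℝ) := by
    intro m hm
    rw [Function.update_eq_self_iff]
    simp [hm]
  have hS : (∑ j, ∑ m : Fin d → Momentum Λ, if (m j : ℤ) = 0 then effPropagator Λ B
        (Function.update (fun k => ((m k : ℤ) : ℝ)) j (Function.update q i t j)) else 0) -
      (∑ j, ∑ m : Fin d → Momentum Λ, if (m j : ℤ) = 0 then effPropagator Λ B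
        (Function.update (fun k => ((m k : ℤ) : ℝ)) j (q j)) else 0) =
      ∑ m : Fin d → Momentum Λ, if (m i : ℤ) = 0 then
        effPropagator Λ B (Function.update (fun k => ((m k : ℤ) : ℝ)) i t) -
          effPropagator Λ B (fun k => ((m k : ℤ) : ℝ)) else 0 := by
    rw [← Finset.sum_sub_distrib, Finset.sum_eq_single i]
    · rw [← Finset.sum_sub_distrib]
      refine Finset.sum_congr rfl fun m _ => ?_
      by_cases hm : (m i : ℤ) = 0
      · rw [if_pos hm, if_pos hm, if_pos hm, Function.update_self, hq, hself m hm]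
      · rw [if_neg hm, if_neg hm, if_neg hm, sub_zero]
    · intro j _ hj
      rw [Function.update_of_ne hj, sub_self]
    · simp
  rw [twoPoint, twoPoint, selfEnergy_eq hd hB, selfEnergy_eq hd hB q, kinetic, kinetic,
    sum_update_sq hq,
    map_add, axisShift, ← hS]
  ring

/-- Along the axis `i`, the wave-function renormalization only has to absorb the effect of one
loop with a double propagator. -/
theorem IsNormalized.Zwave_eq (h : IsNormalized Λ B d mr2) (hmr2 : 0 < mr2) (hd : 3 ≤ d)
    (i : Fin d) : B.Zwave = 1 + 2 * B.Zvert * PowerSeries.X * loopA Λ B i := by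
  have hB := h.constantCoeff_kinetic_ne_zero hmr2 i
  have hΓ : ∀ q : Fin d → ℝ, PowerSeries.constantCoeff (twoPoint Λ B q) ≠ 0 := fun q => by
    rw [coeff_zero_twoPoint]
    exact hB q
  let u : ℝ → ℝ⟦X⟧ := fun t => PowerSeries.C (t ^ 2)⁻¹ * axisShift Λ B i t
  let loop : ℝ → ℝ⟦X⟧ := fun t => ∑ m : Fin d → Momentum Λ, if (m i : ℤ) = 0 then
    effPropagator Λ B (Function.update (fun k => ((m k : ℤ) : ℝ)) i t) *
      effPropagator Λ B (fun k => ((m k : ℤ) : ℝ)) else 0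
  have hu : Tendsto u (𝓝[≠] 0) (𝓝 1) := by
    refine (h.tendsto i).congr fun t => ?_
    rw [twoPoint_update_sub hd hB (by simp)]
  have hC : Tendsto (fun t : ℝ => PowerSeries.C (t ^ 2)) (𝓝[≠] 0) (𝓝 (0 : ℝ⟦X⟧)) := by
    have hc : Continuous fun t : ℝ => PowerSeries.C (t ^ 2) :=
      PowerSeries.WithPiTopology.continuous_C.comp (continuous_pow 2)
    have := (hc.tendsto 0).mono_left (nhdsWithin_le_nhds (s := {0}ᶜ))
    simpa using this
  have hCu : ∀ t : ℝ, t ≠ 0 → PowerSeries.C (t ^ 2) * u t = axisShift Λ B i t := by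
    intro t ht
    rw [← mul_assoc, ← map_mul, mul_inv_cancel₀ (pow_ne_zero 2 ht), map_one, one_mul]
  have hshift : Tendsto (axisShift Λ B i) (𝓝[≠] 0) (𝓝 0) := by
    have h1 := hC.mul hu
    rw [zero_mul] at h1
    refine h1.congr' ?_
    filter_upwards [self_mem_nhdsWithin] with t ht using hCu t ht
  have hloop : Tendsto loop (𝓝[≠] 0) (𝓝 (loopA Λ B i)) := by
    refine tendsto_finsetSum _ fun m _ => ?_
    by_cases hm : (m i : ℤ) = 0
    · simp only [if_pos hm]
      rw [pow_two]
      refine Tendsto.mul_const _ (tendsto_inv_powerSeries ?_ (hΓ _))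
      have h1 := hshift.add_const (twoPoint Λ B fun k => ((m k : ℤ) : ℝ))
      rw [zero_add] at h1
      refine h1.congr fun t => ?_
      rw [← twoPoint_update_sub hd hB (q := fun k => ((m k : ℤ) : ℝ)) (by simp [hm]),
        sub_add_cancel]
    · simp only [if_neg hm]
      exact tendsto_const_nhds
  have hkey : ∀ t : ℝ, t ≠ 0 →
      u t * (1 + 2 * B.Zvert * PowerSeries.X * loop t) = B.Zwave := by
    intro t ht
    -- the difference of two propagators is minus the shift times their product
    have hdiff : (∑ m : Fin d → Momentum Λ, if (m i : ℤ) = 0 then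
        effPropagator Λ B (Function.update (fun k => ((m k : ℤ) : ℝ)) i t) -
          effPropagator Λ B (fun k => ((m k : ℤ) : ℝ)) else 0)
        = -(axisShift Λ B i t * loop t) := by
      rw [Finset.mul_sum, ← Finset.sum_neg_distrib]
      refine Finset.sum_congr rfl fun m _ => ?_
      by_cases hm : (m i : ℤ) = 0
      · rw [if_pos hm, if_pos hm,
          ← twoPoint_update_sub hd hB (q := fun k => ((m k : ℤ) : ℝ)) (by simp [hm]) t]
        have h1 := PowerSeries.mul_inv_cancel _
          (hΓ (Function.update (fun k => ((m k : ℤ) : ℝ)) i t))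
        have h2 := PowerSeries.mul_inv_cancel _ (hΓ fun k => ((m k : ℤ) : ℝ))
        rw [effPropagator, effPropagator]
        linear_combination (twoPoint Λ B fun k => ((m k : ℤ) : ℝ))⁻¹ * h1 -
          (twoPoint Λ B (Function.update (fun k => ((m k : ℤ) : ℝ)) i t))⁻¹ * h2
      · rw [if_neg hm, if_neg hm, mul_zero, neg_zero]
    have hs : axisShift Λ B i t = PowerSeries.C (t ^ 2) * B.Zwave +
        2 * B.Zvert * PowerSeries.X * -(axisShift Λ B i t * loop t) := by
      conv_lhs => rw [axisShift, hdiff]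
    have hinv : PowerSeries.C (t ^ 2)⁻¹ * PowerSeries.C (t ^ 2) = (1 : ℝ⟦X⟧) := by
      rw [← map_mul, inv_mul_cancel₀ (pow_ne_zero 2 ht), map_one]
    simp only [u]
    linear_combination PowerSeries.C (t ^ 2)⁻¹ * hs + B.Zwave * hinv
  have hlim := hu.mul ((hloop.const_mul (2 * B.Zvert * PowerSeries.X)).const_add 1)
  rw [one_mul] at hlim
  refine tendsto_nhds_unique (tendsto_const_nhds (x := B.Zwave) (f := 𝓝[≠] (0 : ℝ))) ?_
  refine hlim.congr' ?_
  filter_upwards [self_mem_nhdsWithin] with t ht using hkey t ht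

end Renormalization

end MelonicTGFT

end

theorem mainTheorem2 (Λ : ℕ) (mr2 : ℝ) (hmr2 : 0 < mr2) (B : MelonicTGFT.Counterterms)
    (h4 : MelonicTGFT.fourPoint Λ B (0 : Fin 5) 0 = 4 * PowerSeries.X)
    (h2 : ∀ r : ℕ,
      (fun p : Fin 5 → ℝ => PowerSeries.coeff r
        (MelonicTGFT.twoPoint Λ B p - PowerSeries.C (mr2 + ∑ k, p k ^ 2)))
      =o[𝓝 0] fun p : Fin 5 → ℝ => ∑ k, p k ^ 2) :
    B.Zvert = (1 - 2 * PowerSeries.X * MelonicTGFT.loopA Λ B (0 : Fin 5))⁻¹ ∧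
    B.Zwave = B.Zvert ∧
    B.massSq = PowerSeries.C mr2 + MelonicTGFT.selfEnergy Λ B (0 : Fin 5 → ℝ) := by
  have h : MelonicTGFT.IsNormalized Λ B 5 mr2 := h2
  have hw := h.Zwave_eq hmr2 (by norm_num) 0
  have hv := MelonicTGFT.fourPoint_mul (Λ := Λ) (by norm_num)
    (h.constantCoeff_kinetic_ne_zero hmr2 0) (0 : Fin 5)
  rw [h4] at hv
  have h4X : (4 : ℝ⟦X⟧) * PowerSeries.X ≠ 0 := by
    refine mul_ne_zero ?_ PowerSeries.X_ne_zero
    rw [← map_ofNat (PowerSeries.C (R := ℝ)) 4]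
    simp
  have hZ : 1 + 2 * B.Zvert * PowerSeries.X * MelonicTGFT.loopA Λ B (0 : Fin 5) = B.Zvert :=
    mul_left_cancel₀ h4X (by rw [hv]; ring)
  refine ⟨?_, hw.trans hZ, ?_⟩
  · rw [PowerSeries.eq_inv_iff_mul_eq_one (by simp)]
    linear_combination -hZ
  · have h0 := h.twoPoint_zero
    rw [MelonicTGFT.twoPoint, MelonicTGFT.kinetic] at h0
    simp only [Pi.zero_apply, ne_eq, OfNat.ofNat_ne_zero, not_false_eq_true, zero_pow,
      Finset.sum_const_zero, map_zero, zero_mul, zero_add] at h0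
    linear_combination h0
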